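/- Let $n\ge 1$. Let $X\subset\mathbb C^n$ be either the unit polydisc $\mathbb D^n$, with $\Gamma_X=\mathbb T^n$, or a bounded complete Reinhardt domain with $C^2$ boundary, with $\Gamma_X=\partial X$; let $d=n$, respectively $d=2n-1$, be the real dimension of $\Gamma_X$ and $\sigma$ the induced Lebesgue ($d$-dimensional surface) measure on $\Gamma_X$. Let $G$ be a finite subgroup of $U(n)$ leaving $X$ and $\Gamma_X$ invariant, let $\Omega\subset\mathbb C^n$ be a bounded domain, and let $\Phi:X\to\Omega$ be a proper surjective holomorphic map which extends smoothly to $\partial X$ and whose fibres on $X$ are exactly the $G$-orbits (so $\Omega\cong X/G$). Put $\Gamma_\Omega=\Phi(\Gamma_X)$, let $m$ be the induced Lebesgue ($d$-dimensional Hausdorff) measure on $\Gamma_\Omega$, and assume that also on $\Gamma_X$ the fibres of $\Phi$ are $G$-orbits, up to a $\sigma$-null set. Let $w\ge 0$ be the $G$-invariant density of the pulled-back surface measure, i.e. $\frac1{|G|}\int_{\Gamma_X\cap\Phi^{-1}(E)}w\,d\sigma=m(E)$ for all Borel $E$. Boundary values are $F^*(z)=\lim_{r\to1^-}F(rz)$,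 and, for $f$ on $\Omega$, $f^*(\Phi(z))=(f\circ\Phi)^*(z)$, $z\in\Gamma_X$. Assume that the quadruple $(X,\Omega,\Phi,G)$ is admissible: there is a $G$-invariant holomorphic function $g$ without zeros on $X$ such that $g^*$ exists and $|g^*|^2=w$ $\sigma$-a.e.; fix such a $g$. For $0<p<\infty$ let $H^p(X)$ be the space of holomorphic $F$ on $X$ with $\sup_{0<r<1}\int_{\Gamma_X}|F(rz)|^p\,d\sigma(z)<\infty$, and let $H^p(\Omega)$ be the space of holomorphic $f$ on $\Omega$ with $$\frac1{|G|}\sup_{0<r<1}\int_{\Gamma_X}|f(\Phi(rz))|^p\,|g(rz)|^2\,d\sigma(z)<\infty .$$ Through boundary values, $H^2(X)$ and $H^2(\Omega)$ are closed subspaces of $L^2(\Gamma_X)=L^2(\sigma)$ and $L^2(\Gamma_\Omega)=L^2(m)$; let $S_X$ and $S_\Omega$ be the orthogonal projections onto them. $H^p(\Omega)$ carries the norm $\|f^*\|_{L^p(\Gamma_\Omega)}$. Theorem B. Let $1<p<\infty$. Then $S_\Omega$ is bounded in the $L^p(\Gamma_\Omega)$-norm, i.e. there is $C<\infty$ with $$\|S_\Omega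 \varphi\|_{L^p(\Gamma_\Omega)}\le C\|\varphi\|_{L^p(\Gamma_\Omega)}\qquad\text{for all }\varphi\in L^2(\Gamma_\Omega)\cap L^p(\Gamma_\Omega),$$ if and only if $S_X$ is bounded on the $G$-invariant functions of $L^p(\Gamma_X,w^{1-p/2})$, i.e. there is $C<\infty$ with $$\|S_X h\|_{L^p(\Gamma_X,w^{1-p/2})}\le C\|h\|_{L^p(\Gamma_X,w^{1-p/2})}\qquad\text{for all $G$-invariant }h\in L^2(\Gamma_X)\cap L^p(\Gamma_X,w^{1-p/2}).$$ The same equivalence holds with the Hardy spaces as target spaces: the first estimate holds and $S_\Omega\varphi$ is the boundary function of an element of $H^2(\Omega)\cap H^p(\Omega)$ for all such $\varphi$, if and only if the second estimate holds and $S_Xh$ is the boundary function of an element of $H^2(X)\cap H^p(X,w^{1-p/2})$ for all such $h$. Here $H^p(X,w^{1-p/2})$ is the space of holomorphic $F$ on $X$ with $\sup_{0<r<1}\int_{\Gamma_X}|F(rz)|^p|g(rz)|^{2-p}\,d\sigma(z)<\infty$. -/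

import Mathlib

open Set Filter Topology MeasureTheory
open scoped ENNReal NNReal ContDiff

/-- Complex Euclidean space `ℂⁿ` with its Hermitian norm. -/
abbrev Cn (n : ℕ) : Type := EuclideanSpace ℂ (Fin n)

/-- The open unit polydisc. -/
def unitPolydisc (n : ℕ) : Set (Cn n) := {z | ∀ j, ‖z j‖ < 1}

/-- The unit torus, i.e. the distinguished boundary of the polydisc. -/
def unitTorus (n : ℕ) : Set (Cn n) := {z | ∀ j, ‖z j‖ = 1}

/-- A complete Reinhardt domain centered at the origin (such a set is automatically connected). -/
def IsCompleteReinhardt {n : ℕ} (X : Set (Cn n)) : Prop :=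
  IsOpen X ∧ X.Nonempty ∧ ∀ z ∈ X, ∀ z' : Cn n, (∀ j, ‖z' j‖ ≤ ‖z j‖) → z' ∈ X

/-- The boundary of `X` is `C²`: near each boundary point `X` is the sublevel set of
a `C²` function with non-vanishing differential. -/
def HasC2Boundary {n : ℕ} (X : Set (Cn n)) : Prop :=
  ∀ q ∈ frontier X, ∃ U : Set (Cn n), IsOpen U ∧ q ∈ U ∧ ∃ ρ : Cn n → ℝ,
    ContDiffOn ℝ 2 ρ U ∧ fderiv ℝ ρ q ≠ 0 ∧ X ∩ U = {z ∈ U | ρ z < 0}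

/-- The pairs `(X, Γ)` under consideration, with `d` the real dimension of `Γ`: either the polydisc
with its distinguished boundary, or a bounded complete Reinhardt domain with `C²` boundary
together with its whole topological boundary. -/
def IsModelPair {n : ℕ} (X Γ : Set (Cn n)) (d : ℕ) : Prop :=
  (X = unitPolydisc n ∧ Γ = unitTorus n ∧ d = n) ∨
  (IsCompleteReinhardt X ∧ Bornology.IsBounded X ∧ HasC2Boundary X ∧
    Γ = frontier X ∧ d = 2 * n - 1)

/-- The induced Lebesgue measure on a `d`-dimensional subset `S` of `ℂⁿ`: the `d`-dimensional
Hausdorff measure (normalised to agree with Lebesgue measure on `ℝᵈ`) restricted to `S`. -/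
noncomputable def inducedMeasure {n : ℕ} (d : ℕ) (S : Set (Cn n)) : Measure (Cn n) :=
  (Measure.euclideanHausdorffMeasure d).restrict S

/-- `F` has the boundary value `l` at `z`: `F (r z) → l` as `r → 1⁻`. -/
def HasBoundaryValue {n : ℕ} (F : Cn n → ℂ) (z : Cn n) (l : ℂ) : Prop :=
  Tendsto (fun r : ℝ => F ((r : ℂ) • z)) (𝓝[<] 1) (𝓝 l)

/-- The quadruple `(X, Ω, Φ, G)`: `Ω` is the quotient of the model domain `X` by the finite group
`G` of unitary maps, realised by the proper holomorphic map `Φ : X → Ω`, which extends smoothly to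
the boundary. `Γ` is the part `Γ_X` of the boundary of `X` on which integrals are taken. -/
structure QuotientQuadruple (n : ℕ) where
  X : Set (Cn n)
  Γ : Set (Cn n)
  /-- the real dimension of `Γ` -/
  d : ℕ
  model : IsModelPair X Γ d
  Ω : Set (Cn n)
  isOpen_Ω : IsOpen Ω
  isConnected_Ω : IsConnected Ω
  isBounded_Ω : Bornology.IsBounded Ω
  /-- a finite subgroup of `U(n)`, the group of linear isometries of `ℂⁿ` -/
  G : Subgroup (Cn n ≃ₗᵢ[ℂ] Cn n)
  finite_G : Finite G
  invariant_X : ∀ τ ∈ G, ∀ z ∈ X, τ z ∈ X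
  invariant_Γ : ∀ τ ∈ G, ∀ z ∈ Γ, τ z ∈ Γ
  Φ : Cn n → Cn n
  holomorphic_Φ : DifferentiableOn ℂ Φ X
  smooth_Φ : ∃ U : Set (Cn n), IsOpen U ∧ closure X ⊆ U ∧ ContDiffOn ℝ ∞ Φ U
  /-- `Φ` maps `X` onto `Ω` -/
  image_Φ : Φ '' X = Ω
  /-- `Φ : X → Ω` is proper -/
  proper_Φ : ∀ K ⊆ Ω, IsCompact K → IsCompact (X ∩ Φ ⁻¹' K)
  /-- the fibres of `Φ` on `X` are the orbits of `G`, so that `Φ` induces `X / G ≅ Ω` -/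
  fibre_X : ∀ z ∈ X, ∀ z' ∈ X, Φ z' = Φ z ↔ ∃ τ ∈ G, τ z = z'
  /-- almost every fibre of `Φ` on `Γ` is a single orbit of `G` -/
  fibre_Γ : ∀ᵐ z ∂(inducedMeasure d Γ), ∀ z' ∈ Γ, Φ z' = Φ z → ∃ τ ∈ G, τ z = z'

namespace QuotientQuadruple

variable {n : ℕ} (Q : QuotientQuadruple n)

/-- The induced boundary `Γ_Ω = Φ(Γ_X)`. -/
def ΓΩ : Set (Cn n) := Q.Φ '' Q.Γ

/-- The induced Lebesgue measure on `Γ_X`. -/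
noncomputable def σ : Measure (Cn n) := inducedMeasure Q.d Q.Γ

/-- The induced Lebesgue measure on `Γ_Ω`. -/
noncomputable def m : Measure (Cn n) := inducedMeasure Q.d Q.ΓΩ

/-- `w` is the (`G`-invariant) density with respect to `σ` of the pulled-back surface measure. -/
structure IsPullbackDensity (w : Cn n → ℝ) : Prop where
  measurable : Measurable w
  nonneg : ∀ z, 0 ≤ w z
  invariant : ∀ τ ∈ Q.G, ∀ᵐ z ∂Q.σ, w (τ z) = w z
  density : ∀ S : Set (Cn n), MeasurableSet S →
    (Nat.card Q.G : ℝ≥0∞)⁻¹ *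
      ∫⁻ z in Q.Γ ∩ Q.Φ ⁻¹' S, ENNReal.ofReal (w z) ∂(Measure.euclideanHausdorffMeasure Q.d)
        = Q.m S

/-- `g` witnesses that `w` is admissible: a `G`-invariant zero-free holomorphic function on `X` whose
boundary values `g*` exist and satisfy `|g*|² = w` almost everywhere on `Γ_X`. -/
structure IsAdmissible (w : Cn n → ℝ) (g : Cn n → ℂ) : Prop where
  holomorphic : DifferentiableOn ℂ g Q.X
  ne_zero : ∀ z ∈ Q.X, g z ≠ 0
  invariant : ∀ τ ∈ Q.G, ∀ z ∈ Q.X, g (τ z) = g z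
  boundary : ∀ᵐ z ∂Q.σ, ∃ l : ℂ, HasBoundaryValue g z l ∧ ‖l‖ ^ 2 = w z

/-- `F ∈ Hᵖ(X)`. -/
def MemHardyX (p : ℝ) (F : Cn n → ℂ) : Prop :=
  DifferentiableOn ℂ F Q.X ∧
    (⨆ r ∈ Ioo (0 : ℝ) 1, ∫⁻ z, ‖F ((r : ℂ) • z)‖ₑ ^ p ∂Q.σ) < ⊤

/-- `F ∈ Hᵖ(X, w^{1-p/2})`, where the weight `w^{1-p/2} = |g*|^{2-p}` on `Γ_X` is extended
to `X` as `|g|^{2-p}`. -/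
def MemWeightedHardyX (g : Cn n → ℂ) (p : ℝ) (F : Cn n → ℂ) : Prop :=
  DifferentiableOn ℂ F Q.X ∧
    (⨆ r ∈ Ioo (0 : ℝ) 1,
      ∫⁻ z, ‖F ((r : ℂ) • z)‖ₑ ^ p * ‖g ((r : ℂ) • z)‖ₑ ^ (2 - p) ∂Q.σ) < ⊤

/-- `f ∈ Hᵖ(Ω)`. -/
def MemHardyΩ (g : Cn n → ℂ) (p : ℝ) (f : Cn n → ℂ) : Prop :=
  DifferentiableOn ℂ f Q.Ω ∧
    (Nat.card Q.G : ℝ≥0∞)⁻¹ * (⨆ r ∈ Ioo (0 : ℝ) 1,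
      ∫⁻ z, ‖f (Q.Φ ((r : ℂ) • z))‖ₑ ^ p * ‖g ((r : ℂ) • z)‖ₑ ^ (2 : ℝ) ∂Q.σ) < ⊤

/-- `φ` is the boundary function `F*` of the function `F` on `X`. -/
def IsBoundaryX (F φ : Cn n → ℂ) : Prop := ∀ᵐ z ∂Q.σ, HasBoundaryValue F z (φ z)

/-- `φ` is (almost everywhere) the boundary function `f*` of the function `f` on `Ω`, which is given
on `Γ_Ω` by `f* (Φ z) = (f ∘ Φ)* (z)`. -/
def IsBoundaryΩ (f φ : Cn n → ℂ) : Prop :=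
  ∃ u : Cn n → ℂ, u =ᵐ[Q.m] φ ∧ ∀ᵐ z ∂Q.σ, HasBoundaryValue (f ∘ Q.Φ) z (u (Q.Φ z))

/-! Facts needed to see that the boundary functions of `H²` form a linear subspace of `L²`. -/

theorem smul_mem {z : Cn n} (hz : z ∈ Q.Γ) {r : ℝ} (hr : r ∈ Ioo (0 : ℝ) 1) :
    (r : ℂ) • z ∈ Q.X := by
  have hnorm : ∀ j, ‖((r : ℂ) • z) j‖ = r * ‖z j‖ := fun j => by
    simp [abs_of_pos hr.1]
  rcases Q.model with ⟨hX, hΓ, -⟩ | ⟨hX, -, -, hΓ, -⟩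
  · rw [hX]
    rw [hΓ] at hz
    intro j
    rw [hnorm, hz j, mul_one]
    exact hr.2
  · rw [hΓ] at hz
    have h1 : ∀ᶠ w in 𝓝 z, ∀ j, r * ‖z j‖ ≤ ‖w j‖ := by
      rw [Filter.eventually_all]
      intro j
      by_cases h0 : z j = 0
      · simp [h0]
      · have hlt : r * ‖z j‖ < ‖z j‖ := by
          have := norm_pos_iff.mpr h0
          nlinarith [hr.2]
        have hc : Continuous fun w : Cn n => ‖w j‖ := by fun_prop
        filter_upwards [hc.continuousAt.eventually_const_lt hlt] with w hw using hw.le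
    obtain ⟨w, hw, hwX⟩ :=
      ((mem_closure_iff_frequently.mp (frontier_subset_closure hz)).and_eventually h1).exists
    exact hX.2.2 w hw _ fun j => (hnorm j).le.trans (hwX j)

theorem measurableSet_Γ : MeasurableSet Q.Γ := by
  rcases Q.model with ⟨-, hΓ, -⟩ | ⟨-, -, -, hΓ, -⟩
  · have : Q.Γ = ⋂ j, {z : Cn n | ‖z j‖ = 1} := by
      rw [hΓ]
      ext z
      simp [unitTorus]
    rw [this]
    refine MeasurableSet.iInter fun j => ?_
    exact (isClosed_eq (by fun_prop) continuous_const).measurableSet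
  · rw [hΓ]
    exact isClosed_frontier.measurableSet

theorem aemeasurable_dilate {F : Cn n → ℂ} (hF : ContinuousOn F Q.X) {r : ℝ}
    (hr : r ∈ Ioo (0 : ℝ) 1) : AEMeasurable (fun z => F ((r : ℂ) • z)) Q.σ := by
  refine ContinuousOn.aemeasurable ?_ Q.measurableSet_Γ
  exact hF.comp (by fun_prop) fun z hz => Q.smul_mem hz hr

theorem continuousOn_comp_Φ {f : Cn n → ℂ} (hf : DifferentiableOn ℂ f Q.Ω) :
    ContinuousOn (fun z => f (Q.Φ z)) Q.X :=
  hf.continuousOn.comp Q.holomorphic_Φ.continuousOn fun z hz => by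
    rw [← Q.image_Φ]
    exact mem_image_of_mem _ hz

theorem iSup_lintegral_add_lt {ν : Measure (Cn n)} {u v : ℝ → Cn n → ℂ} {k : ℝ → Cn n → ℝ≥0∞}
    (hu : ∀ r ∈ Ioo (0 : ℝ) 1, AEMeasurable (u r) ν)
    (hk : ∀ r ∈ Ioo (0 : ℝ) 1, AEMeasurable (k r) ν)
    (h1 : (⨆ r ∈ Ioo (0 : ℝ) 1, ∫⁻ z, ‖u r z‖ₑ ^ (2 : ℝ) * k r z ∂ν) < ⊤)
    (h2 : (⨆ r ∈ Ioo (0 : ℝ) 1, ∫⁻ z, ‖v r z‖ₑ ^ (2 : ℝ) * k r z ∂ν) < ⊤) :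
    (⨆ r ∈ Ioo (0 : ℝ) 1, ∫⁻ z, ‖u r z + v r z‖ₑ ^ (2 : ℝ) * k r z ∂ν) < ⊤ := by
  set A := ⨆ r ∈ Ioo (0 : ℝ) 1, ∫⁻ z, ‖u r z‖ₑ ^ (2 : ℝ) * k r z ∂ν with hA
  set B := ⨆ r ∈ Ioo (0 : ℝ) 1, ∫⁻ z, ‖v r z‖ₑ ^ (2 : ℝ) * k r z ∂ν with hB
  have hbound : (⨆ r ∈ Ioo (0 : ℝ) 1, ∫⁻ z, ‖u r z + v r z‖ₑ ^ (2 : ℝ) * k r z ∂ν)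
      ≤ 2 * (A + B) := by
    refine iSup₂_le fun r hr => ?_
    calc ∫⁻ z, ‖u r z + v r z‖ₑ ^ (2 : ℝ) * k r z ∂ν
        ≤ ∫⁻ z, 2 * (‖u r z‖ₑ ^ (2 : ℝ) * k r z + ‖v r z‖ₑ ^ (2 : ℝ) * k r z) ∂ν := by
          refine lintegral_mono fun z => ?_
          have h := ENNReal.rpow_add_le_mul_rpow_add_rpow (‖u r z‖ₑ) (‖v r z‖ₑ)
            (p := 2) (by norm_num)
          have h' : ‖u r z + v r z‖ₑ ^ (2 : ℝ)
              ≤ 2 * (‖u r z‖ₑ ^ (2 : ℝ) + ‖v r z‖ₑ ^ (2 : ℝ)) := by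
            refine (ENNReal.rpow_le_rpow (enorm_add_le _ _) (by norm_num)).trans (h.trans_eq ?_)
            norm_num
          calc ‖u r z + v r z‖ₑ ^ (2 : ℝ) * k r z
              ≤ 2 * (‖u r z‖ₑ ^ (2 : ℝ) + ‖v r z‖ₑ ^ (2 : ℝ)) * k r z := by gcongr
            _ = _ := by rw [mul_assoc, add_mul]
      _ = 2 * (∫⁻ z, ‖u r z‖ₑ ^ (2 : ℝ) * k r z ∂ν + ∫⁻ z, ‖v r z‖ₑ ^ (2 : ℝ) * k r z ∂ν) := by
          rw [lintegral_const_mul' _ _ (by norm_num), lintegral_add_left']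
          exact ((hu r hr).enorm.pow_const _).mul (hk r hr)
      _ ≤ 2 * (A + B) := by
          gcongr
          · exact le_iSup₂ (f := fun r (_ : r ∈ Ioo (0 : ℝ) 1) =>
              ∫⁻ z, ‖u r z‖ₑ ^ (2 : ℝ) * k r z ∂ν) r hr
          · exact le_iSup₂ (f := fun r (_ : r ∈ Ioo (0 : ℝ) 1) =>
              ∫⁻ z, ‖v r z‖ₑ ^ (2 : ℝ) * k r z ∂ν) r hr
  exact hbound.trans_lt (ENNReal.mul_lt_top (by norm_num) (ENNReal.add_lt_top.mpr ⟨h1, h2⟩))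

theorem iSup_lintegral_smul_lt {ν : Measure (Cn n)} (c : ℂ) {u : ℝ → Cn n → ℂ}
    {k : ℝ → Cn n → ℝ≥0∞}
    (h1 : (⨆ r ∈ Ioo (0 : ℝ) 1, ∫⁻ z, ‖u r z‖ₑ ^ (2 : ℝ) * k r z ∂ν) < ⊤) :
    (⨆ r ∈ Ioo (0 : ℝ) 1, ∫⁻ z, ‖c * u r z‖ₑ ^ (2 : ℝ) * k r z ∂ν) < ⊤ := by
  have hc : ‖c‖ₑ ^ (2 : ℝ) ≠ ⊤ := ENNReal.rpow_ne_top_of_nonneg (by norm_num) enorm_ne_top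
  have : ∀ r, ∫⁻ z, ‖c * u r z‖ₑ ^ (2 : ℝ) * k r z ∂ν
      = ‖c‖ₑ ^ (2 : ℝ) * ∫⁻ z, ‖u r z‖ₑ ^ (2 : ℝ) * k r z ∂ν := fun r => by
    rw [← lintegral_const_mul' _ _ hc]
    refine lintegral_congr fun z => ?_
    rw [enorm_mul, ENNReal.mul_rpow_of_nonneg _ _ (by norm_num), mul_assoc]
  simp_rw [this, ← ENNReal.mul_iSup]
  exact ENNReal.mul_lt_top hc.lt_top h1

theorem MemHardyX.add {F F' : Cn n → ℂ} (h : Q.MemHardyX 2 F) (h' : Q.MemHardyX 2 F') :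
    Q.MemHardyX 2 (fun z => F z + F' z) := by
  refine ⟨h.1.add h'.1, ?_⟩
  have := iSup_lintegral_add_lt (ν := Q.σ) (u := fun r z => F ((r : ℂ) • z))
    (v := fun r z => F' ((r : ℂ) • z)) (k := fun _ _ => 1)
    (fun r hr => Q.aemeasurable_dilate h.1.continuousOn hr) (fun _ _ => aemeasurable_const)
    (by simpa using h.2) (by simpa using h'.2)
  simpa using this

theorem MemHardyX.const_mul {F : Cn n → ℂ} (c : ℂ) (h : Q.MemHardyX 2 F) :
    Q.MemHardyX 2 (fun z => c * F z) := by
  refine ⟨h.1.const_mul c, ?_⟩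
  have := iSup_lintegral_smul_lt (ν := Q.σ) c (u := fun r z => F ((r : ℂ) • z))
    (k := fun _ _ => 1) (by simpa using h.2)
  simpa using this

theorem card_inv_ne_zero : (Nat.card Q.G : ℝ≥0∞)⁻¹ ≠ 0 :=
  ENNReal.inv_ne_zero.mpr (ENNReal.natCast_ne_top _)

theorem card_inv_ne_top : (Nat.card Q.G : ℝ≥0∞)⁻¹ ≠ ⊤ := by
  have := Q.finite_G
  exact ENNReal.inv_ne_top.mpr (Nat.cast_ne_zero.mpr Nat.card_pos.ne')

theorem MemHardyΩ.add {g f f' : Cn n → ℂ} (hg : ContinuousOn g Q.X) (h : Q.MemHardyΩ g 2 f)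
    (h' : Q.MemHardyΩ g 2 f') : Q.MemHardyΩ g 2 (fun z => f z + f' z) := by
  refine ⟨h.1.add h'.1, ENNReal.mul_lt_top Q.card_inv_ne_top.lt_top ?_⟩
  exact iSup_lintegral_add_lt (ν := Q.σ) (u := fun r z => f (Q.Φ ((r : ℂ) • z)))
    (v := fun r z => f' (Q.Φ ((r : ℂ) • z)))
    (k := fun r z => ‖g ((r : ℂ) • z)‖ₑ ^ (2 : ℝ))
    (fun r hr => Q.aemeasurable_dilate (Q.continuousOn_comp_Φ h.1) hr)
    (fun r hr => (Q.aemeasurable_dilate hg hr).enorm.pow_const _)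
    (ENNReal.lt_top_of_mul_ne_top_right h.2.ne Q.card_inv_ne_zero)
    (ENNReal.lt_top_of_mul_ne_top_right h'.2.ne Q.card_inv_ne_zero)

theorem MemHardyΩ.const_mul {g f : Cn n → ℂ} (c : ℂ) (h : Q.MemHardyΩ g 2 f) :
    Q.MemHardyΩ g 2 (fun z => c * f z) := by
  refine ⟨h.1.const_mul c, ENNReal.mul_lt_top Q.card_inv_ne_top.lt_top ?_⟩
  exact iSup_lintegral_smul_lt (ν := Q.σ) c (u := fun r z => f (Q.Φ ((r : ℂ) • z)))
    (k := fun r z => ‖g ((r : ℂ) • z)‖ₑ ^ (2 : ℝ))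
    (ENNReal.lt_top_of_mul_ne_top_right h.2.ne Q.card_inv_ne_zero)

/-- `H²(X)` as a subspace of `L²(Γ_X)`, through boundary functions. -/
noncomputable def hardySubspaceX : Submodule ℂ (Lp ℂ 2 Q.σ) where
  carrier := {φ | ∃ F : Cn n → ℂ, Q.MemHardyX 2 F ∧ Q.IsBoundaryX F φ}
  zero_mem' := by
    refine ⟨fun _ => 0, ⟨differentiableOn_const 0, by simp⟩, ?_⟩
    filter_upwards [Lp.coeFn_zero ℂ 2 Q.σ] with z hz
    rw [hz]
    exact tendsto_const_nhds
  add_mem' := by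
    rintro φ ψ ⟨F, hF, hφ⟩ ⟨F', hF', hψ⟩
    refine ⟨fun z => F z + F' z, MemHardyX.add Q hF hF', ?_⟩
    filter_upwards [hφ, hψ, Lp.coeFn_add φ ψ] with z h1 h2 h3
    rw [h3]
    exact Tendsto.add h1 h2
  smul_mem' := by
    rintro c φ ⟨F, hF, hφ⟩
    refine ⟨fun z => c * F z, MemHardyX.const_mul Q c hF, ?_⟩
    filter_upwards [hφ, Lp.coeFn_smul c φ] with z h1 h3
    rw [h3]
    exact Tendsto.const_mul c h1

/-- `H²(Ω)` as a subspace of `L²(Γ_Ω)`, through boundary functions. -/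
noncomputable def hardySubspaceΩ (g : Cn n → ℂ) (hg : ContinuousOn g Q.X) :
    Submodule ℂ (Lp ℂ 2 Q.m) where
  carrier := {φ | ∃ f : Cn n → ℂ, Q.MemHardyΩ g 2 f ∧ Q.IsBoundaryΩ f φ}
  zero_mem' := by
    refine ⟨fun _ => 0, ⟨differentiableOn_const 0, by simp⟩, fun _ => 0, ?_, ?_⟩
    · exact (Lp.coeFn_zero ℂ 2 Q.m).symm
    · exact Eventually.of_forall fun z => tendsto_const_nhds
  add_mem' := by
    rintro φ ψ ⟨f, hf, u, hu, hφ⟩ ⟨f', hf', v, hv, hψ⟩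
    refine ⟨fun z => f z + f' z, MemHardyΩ.add Q hg hf hf', fun z => u z + v z, ?_, ?_⟩
    · filter_upwards [hu, hv, Lp.coeFn_add φ ψ] with z h1 h2 h3
      rw [h1, h2, h3, Pi.add_apply]
    · filter_upwards [hφ, hψ] with z h1 h2
      exact Tendsto.add h1 h2
  smul_mem' := by
    rintro c φ ⟨f, hf, u, hu, hφ⟩
    refine ⟨fun z => c * f z, MemHardyΩ.const_mul Q c hf, fun z => c * u z, ?_, ?_⟩
    · filter_upwards [hu, Lp.coeFn_smul c φ] with z h1 h3
      rw [h1, h3, Pi.smul_apply, smul_eq_mul]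
    · filter_upwards [hφ] with z h1
      exact Tendsto.const_mul c h1

/-- The Szegő projection `S_X`: the orthogonal projection of `L²(Γ_X)` onto `H²(X)`. (`H²(X)` is
closed in `L²(Γ_X)`, so taking the closure changes nothing; it makes the projection available
before closedness is proved.) -/
noncomputable def szegoX : Lp ℂ 2 Q.σ →L[ℂ] Lp ℂ 2 Q.σ :=
  Q.hardySubspaceX.topologicalClosure.starProjection

/-- The Szegő projection `S_Ω`: the orthogonal projection of `L²(Γ_Ω)` onto `H²(Ω)`
(again a closed subspace). -/
noncomputable def szegoΩ (g : Cn n → ℂ) (hg : ContinuousOn g Q.X) :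
    Lp ℂ 2 Q.m →L[ℂ] Lp ℂ 2 Q.m :=
  (Q.hardySubspaceΩ g hg).topologicalClosure.starProjection

/-- The measure `w^{1-p/2} dσ` on `Γ_X`. -/
noncomputable def weightedMeasure (w : Cn n → ℝ) (p : ℝ) : Measure (Cn n) :=
  Q.σ.withDensity fun z => ENNReal.ofReal (w z) ^ (1 - p / 2)

/-- `h` is a `G`-invariant function on `Γ_X` (almost everywhere). -/
def IsInvariantΓ (h : Cn n → ℂ) : Prop := ∀ τ ∈ Q.G, ∀ᵐ z ∂Q.σ, h (τ z) = h z

/-- `S_Ω` is bounded in the norm of `Lᵖ(Γ_Ω)`, which is also the norm `‖f‖ = ‖f*‖` of `Hᵖ(Ω)`. As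
usual this is an estimate on the dense subspace `L² ∩ Lᵖ`, on which `S_Ω` is defined. -/
def SzegoΩBounded (g : Cn n → ℂ) (hg : ContinuousOn g Q.X) (p : ℝ) : Prop :=
  ∃ C : ℝ≥0, ∀ φ : Lp ℂ 2 Q.m, MemLp φ (ENNReal.ofReal p) Q.m →
    eLpNorm (Q.szegoΩ g hg φ) (ENNReal.ofReal p) Q.m ≤ C * eLpNorm φ (ENNReal.ofReal p) Q.m

/-- `S_X` is bounded on the `G`-invariant functions in `Lᵖ(Γ_X, w^{1-p/2})`. -/
def SzegoXBoundedOnInvariant (w : Cn n → ℝ) (p : ℝ) : Prop :=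
  ∃ C : ℝ≥0, ∀ h : Lp ℂ 2 Q.σ, Q.IsInvariantΓ h →
    MemLp h (ENNReal.ofReal p) (Q.weightedMeasure w p) →
    eLpNorm (Q.szegoX h) (ENNReal.ofReal p) (Q.weightedMeasure w p)
      ≤ C * eLpNorm h (ENNReal.ofReal p) (Q.weightedMeasure w p)

/-- `S_Ω` maps (the dense subspace `L² ∩ Lᵖ` of) `Lᵖ(Γ_Ω)` into `Hᵖ(Ω)`: the function in `H²(Ω)`
whose boundary function is `S_Ω φ` belongs to `Hᵖ(Ω)`. -/
def SzegoΩMapsToHardy (g : Cn n → ℂ) (hg : ContinuousOn g Q.X) (p : ℝ) : Prop :=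
  ∀ φ : Lp ℂ 2 Q.m, MemLp φ (ENNReal.ofReal p) Q.m →
    ∃ f : Cn n → ℂ, Q.MemHardyΩ g 2 f ∧ Q.MemHardyΩ g p f ∧ Q.IsBoundaryΩ f (Q.szegoΩ g hg φ)

/-- `S_X` maps the `G`-invariant functions in `Lᵖ(Γ_X, w^{1-p/2})` into `Hᵖ(X, w^{1-p/2})`. -/
def SzegoXMapsInvariantToHardy (w : Cn n → ℝ) (g : Cn n → ℂ) (p : ℝ) : Prop :=
  ∀ h : Lp ℂ 2 Q.σ, Q.IsInvariantΓ h →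
    MemLp h (ENNReal.ofReal p) (Q.weightedMeasure w p) →
    ∃ F : Cn n → ℂ, Q.MemHardyX 2 F ∧ Q.MemWeightedHardyX g p F ∧ Q.IsBoundaryX F (Q.szegoX h)

end QuotientQuadruple

/-! Put Tφ = |G|^{-1/2} (φ ∘ Φ) g* (`lift`). The identity defining w is a change of variables, and
|g*|² = w, so T is an isometry of L²(Γ_Ω) into L²(Γ_X). Since |g*|^p w^{1-p/2} = w, T also
multiplies the L^p(Γ_Ω)-norm by a constant when the target carries the weight w^{1-p/2}. Its range
is exactly the space of G-invariant functions (`exists_liftL_eq`). Hence everything follows from S_X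
T = T S_Ω (`szegoX_liftL`), even with the same constant C.

For the intertwining, T sends H²(Ω) into H²(X), because f* lifts to the boundary function of
|G|^{-1/2} (f ∘ Φ) g. Conversely, the average over G of a function in H²(X) has the form |G|^{-1/2}
(f ∘ Φ) g with f in H²(Ω). Pairing an invariant function with ψ is the same as pairing it with the
average of ψ, so Tφ - T S_Ω φ is orthogonal to H²(X).

Two facts need real work. The first is that w > 0 almost everywhere (`ae_density_pos`); without it
g* could vanish and null sets of Γ_Ω need not pull back to null sets. It rests on the Jacobian of Φ
being non-zero a.e. on Γ_X, which follows from a boundary uniqueness theorem on torus orbits, proved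
by Jensen's formula. Where the Jacobian is non-zero, Φ is locally bi-Lipschitz and cannot crush a
set of positive measure.

The second is that an invariant holomorphic function on X descends to a holomorphic function on Ω
(`differentiableOn_descend`). Away from critical values this is the inverse function theorem. The
critical values lie in the zero set of a holomorphic function on Ω, obtained from a power of the
Jacobian, and are removable for continuous functions. -/

section SeveralVariables

/-! ### Holomorphic functions of several variables: Cauchy integrals and removable singularities. -/

open Metric

variable {E F : Type*} [NormedAddCommGroup E] [NormedSpace ℂ E]
  [NormedAddCommGroup F] [NormedSpace ℂ F]

/-- Cauchy's estimate for the derivative of a bounded holomorphic map on a ball. -/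
theorem norm_fderiv_le_of_norm_le_on_ball {f : E → F} {c : E} {r M : ℝ} (hr : 0 < r)
    (hf : DifferentiableOn ℂ f (ball c r)) (hM : ∀ z ∈ ball c r, ‖f z‖ ≤ M) :
    ‖fderiv ℂ f c‖ ≤ 2 * M / r := by
  refine Complex.norm_fderiv_le_div_of_mapsTo_ball hf (fun z hz => ?_) hr
  rw [mem_closedBall, dist_eq_norm]
  have h1 := hM z hz
  have h2 := hM c (mem_ball_self hr)
  linarith [norm_sub_le (f z) (f c)]

/-- An integral depending holomorphically and continuously on a parameter is holomorphic. -/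
theorem differentiableAt_intervalIntegral_of_continuousOn [ProperSpace E]
    {K : E → ℝ → ℂ} {z₀ : E} {r : ℝ} (hr : 0 < r) {a b : ℝ}
    (hK : ContinuousOn (Function.uncurry K) (closedBall z₀ r ×ˢ uIcc a b))
    (hd : ∀ θ ∈ uIcc a b, DifferentiableOn ℂ (fun z => K z θ) (ball z₀ r)) :
    DifferentiableAt ℂ (fun z => ∫ θ in a..b, K z θ) z₀ := by
  have hcomp : IsCompact (closedBall z₀ r ×ˢ uIcc a b) :=
    (isCompact_closedBall _ _).prod isCompact_uIcc
  obtain ⟨M, hM⟩ := hcomp.exists_bound_of_continuousOn hK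
  have hKz : ∀ z ∈ closedBall z₀ r, ContinuousOn (K z) (uIcc a b) := fun z hz =>
    hK.comp (f := fun θ => (z, θ)) (by fun_prop) fun θ hθ => ⟨hz, hθ⟩
  -- Differentiating under the integral needs the derivative to be measurable in θ. It is even
  -- continuous: Cauchy's estimate for K(·, θ) - K(·, θ₀) turns uniform closeness of the kernels
  -- into closeness of derivatives.
  have hcont : ContinuousOn (fun θ => fderiv ℂ (fun z => K z θ) z₀) (uIcc a b) := by
    intro θ₀ hθ₀
    rw [ContinuousWithinAt, Metric.tendsto_nhds]
    intro ε hε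
    have huc := hcomp.uniformContinuousOn_of_continuous hK
    rw [Metric.uniformContinuousOn_iff] at huc
    obtain ⟨δ, hδ, h⟩ := huc (ε * r / 4) (by positivity)
    filter_upwards [inter_mem_nhdsWithin (uIcc a b) (ball_mem_nhds θ₀ hδ)] with θ hθ
    have hdz := fun θ (hθ : θ ∈ uIcc a b) =>
      (hd θ hθ).differentiableAt (ball_mem_nhds z₀ hr)
    rw [dist_eq_norm, ← fderiv_fun_sub (hdz θ hθ.1) (hdz θ₀ hθ₀)]
    have := norm_fderiv_le_of_norm_le_on_ball hr ((hd θ hθ.1).fun_sub (hd θ₀ hθ₀))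
      (M := ε * r / 4) fun z hz => by
        rw [← dist_eq_norm]
        have hz' := ball_subset_closedBall hz
        refine (h (z, θ) ⟨hz', hθ.1⟩ (z, θ₀) ⟨hz', hθ₀⟩ ?_).le
        simpa [Prod.dist_eq, hδ] using hθ.2
    refine this.trans_lt ?_
    rw [show 2 * (ε * r / 4) / r = ε / 2 by field_simp; ring]
    linarith
  have hsub : ∀ x ∈ ball z₀ (r / 2), ball x (r / 2) ⊆ ball z₀ r := fun x hx =>
    ball_subset_ball' (by rw [mem_ball] at hx; linarith)
  refine (intervalIntegral.hasFDerivAt_integral_of_dominated_of_fderiv_le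
    (𝕜 := ℂ) (F' := fun z θ => fderiv ℂ (fun z => K z θ) z) (s := ball z₀ (r / 2))
    (bound := fun _ => 2 * M / (r / 2)) (ball_mem_nhds _ (by positivity)) ?_ ?_ ?_ ?_ ?_
    ?_).differentiableAt
  · filter_upwards [ball_mem_nhds z₀ hr] with z hz
    exact (((hKz z (ball_subset_closedBall hz)).mono uIoc_subset_uIcc).aestronglyMeasurable
      measurableSet_uIoc)
  · exact (hKz z₀ (mem_closedBall_self hr.le)).intervalIntegrable
  · exact (hcont.mono uIoc_subset_uIcc).aestronglyMeasurable measurableSet_uIoc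
  · refine Eventually.of_forall fun θ hθ x hx => ?_
    refine norm_fderiv_le_of_norm_le_on_ball (by positivity)
      ((hd θ (uIoc_subset_uIcc hθ)).mono (hsub x hx)) fun z hz => ?_
    exact hM (z, θ) ⟨ball_subset_closedBall (hsub x hx hz), uIoc_subset_uIcc hθ⟩
  · simp
  · refine Eventually.of_forall fun θ hθ x hx => ?_
    refine ((hd θ (uIoc_subset_uIcc hθ)).differentiableAt ?_).hasFDerivAt
    exact isOpen_ball.mem_nhds (ball_subset_ball (by linarith) hx)

/-- Directional derivatives of holomorphic functions of several variables are holomorphic. -/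
theorem DifferentiableOn.fderiv_apply_of_isOpen [ProperSpace E] {f : E → ℂ} {U : Set E}
    (hU : IsOpen U) (hf : DifferentiableOn ℂ f U) (v : E) :
    DifferentiableOn ℂ (fun z => fderiv ℂ f z v) U := by
  intro z₀ hz₀
  refine DifferentiableAt.differentiableWithinAt ?_
  obtain ⟨r, hr, hball⟩ := Metric.isOpen_iff.mp hU z₀ hz₀
  -- This radius keeps ζ • v within r / 4 for |ζ| ≤ ρ; the summand 1 covers v = 0.
  set ρ : ℝ := r / (4 * (‖v‖ + 1)) with hρ
  have hv : 0 < ‖v‖ + 1 := by positivity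
  have hρ0 : 0 < ρ := by positivity
  have hρv : ρ * ‖v‖ ≤ r / 4 := by
    have : ρ * (‖v‖ + 1) = r / 4 := by rw [hρ]; field_simp
    nlinarith
  have hin : ∀ z ∈ closedBall z₀ (r / 4), ∀ ζ ∈ closedBall (0 : ℂ) ρ, z + ζ • v ∈ U := by
    intro z hz ζ hζ
    apply hball
    rw [mem_ball, dist_eq_norm]
    rw [mem_closedBall, dist_eq_norm] at hz
    rw [mem_closedBall_zero_iff] at hζ
    have h1 : ‖ζ • v‖ ≤ r / 4 := by
      rw [norm_smul]
      exact (mul_le_mul_of_nonneg_right hζ (norm_nonneg v)).trans hρv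
    calc ‖z + ζ • v - z₀‖ = ‖(z - z₀) + ζ • v‖ := by congr 1; abel
      _ ≤ r / 4 + r / 4 := (norm_add_le _ _).trans (add_le_add hz h1)
      _ < r := by linarith
  -- Cauchy's formula for the derivative on the complex line through z in direction v. The radius
  -- does not depend on z, so this is an integral with holomorphic parameter z.
  have key : ∀ z ∈ ball z₀ (r / 4), fderiv ℂ f z v =
      ∫ θ in (0 : ℝ)..2 * Real.pi, (2 * Real.pi * Complex.I : ℂ)⁻¹ *
        (_root_.deriv (circleMap 0 ρ) θ * (((circleMap 0 ρ θ) ^ 2)⁻¹ * f (z + circleMap 0 ρ θ • v))) := by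
    intro z hz
    have hz' := ball_subset_closedBall hz
    have hnb : ∀ ζ ∈ closedBall (0 : ℂ) ρ, DifferentiableAt ℂ (fun ζ : ℂ => f (z + ζ • v)) ζ := by
      intro ζ hζ
      exact (hf.differentiableAt (hU.mem_nhds (hin z hz' ζ hζ))).comp ζ (by fun_prop)
    have h1 : _root_.deriv (fun ζ : ℂ => f (z + ζ • v)) 0 = fderiv ℂ f z v := by
      have hfz : HasFDerivAt f (fderiv ℂ f z) (z + (0 : ℂ) • v) := by
        simpa using (hf.differentiableAt (hU.mem_nhds (by simpa using hin z hz' 0 (by simp [hρ0.le])))).hasFDerivAt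
      have hl : HasDerivAt (fun ζ : ℂ => z + ζ • v) v 0 := by
        simpa using ((hasDerivAt_id (0 : ℂ)).smul_const v).const_add z
      exact (hfz.comp_hasDerivAt 0 hl).deriv
    have hopen : IsOpen {ζ : ℂ | z + ζ • v ∈ U} := hU.preimage (by fun_prop)
    have hdiff : DifferentiableOn ℂ (fun ζ : ℂ => f (z + ζ • v)) {ζ : ℂ | z + ζ • v ∈ U} :=
      hf.comp (by fun_prop) fun ζ hζ => hζ
    have h2 := Complex.two_pi_I_inv_smul_circleIntegral_sub_sq_inv_smul_of_differentiable hopen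
      (c := (0 : ℂ)) (w₀ := 0) (R := ρ) (fun ζ hζ => hin z hz' ζ hζ) hdiff (mem_ball_self hρ0)
    rw [← h1, ← h2, circleIntegral, intervalIntegral.integral_const_mul]
    simp
  have hev : (fun z => fderiv ℂ f z v) =ᶠ[𝓝 z₀] _ :=
    Filter.eventuallyEq_of_mem (ball_mem_nhds z₀ (by positivity : 0 < r / 4)) key
  refine DifferentiableAt.congr_of_eventuallyEq ?_ hev
  have hmem : ∀ θ, circleMap 0 ρ θ ∈ closedBall (0 : ℂ) ρ := fun θ =>
    sphere_subset_closedBall (circleMap_mem_sphere 0 hρ0.le θ)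
  have hne : ∀ θ, circleMap 0 ρ θ ^ 2 ≠ 0 := fun θ => pow_ne_zero 2 (by
    simpa using circleMap_ne_center (c := 0) hρ0.ne' (θ := θ))
  refine differentiableAt_intervalIntegral_of_continuousOn (r := r / 4) (by positivity) ?_ ?_
  · have hc : Continuous (circleMap 0 ρ) := continuous_circleMap 0 ρ
    simp only [Function.uncurry_def, deriv_circleMap]
    refine continuousOn_const.mul (ContinuousOn.mul (by fun_prop) (ContinuousOn.mul ?_ ?_))
    · exact ContinuousOn.inv₀ (by fun_prop) fun x _ => hne x.2
    · exact hf.continuousOn.comp (by fun_prop) fun x hx => hin x.1 hx.1 _ (hmem _)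
  · intro θ _
    refine DifferentiableOn.const_mul (DifferentiableOn.const_mul (DifferentiableOn.const_mul ?_ _) _) _
    exact hf.comp (by fun_prop) fun z hz => hin z (ball_subset_closedBall hz) _ (hmem _)

/-- A continuous function which is holomorphic off the zero set of a holomorphic function
with nowhere dense zero set is holomorphic. -/
theorem ContinuousOn.differentiableOn_of_off_zeros [ProperSpace E] {f e : E → ℂ} {U : Set E}
    (hU : IsOpen U) (hf : ContinuousOn f U) (he : DifferentiableOn ℂ e U)
    (hfe : ∀ z ∈ U, e z ≠ 0 → DifferentiableAt ℂ f z)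
    (hdense : ∀ V ⊆ U, IsOpen V → V.Nonempty → ∃ z ∈ V, e z ≠ 0) :
    DifferentiableOn ℂ f U := by
  intro a ha
  refine DifferentiableAt.differentiableWithinAt ?_
  obtain ⟨r, hr, hball⟩ := Metric.isOpen_iff.mp hU a ha
  -- On the complex line through a and b the function e is not identically zero, since it is
  -- non-zero at ζ = 1. Its zeros there are isolated, so some circle around a avoids them.
  obtain ⟨b, hb, hbe⟩ := hdense (ball a (r / 4)) ((ball_subset_ball (by linarith)).trans hball)
    isOpen_ball ⟨a, mem_ball_self (by positivity)⟩
  set v := b - a with hv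
  have hvr : ‖v‖ < r / 4 := by rwa [hv, ← dist_eq_norm]
  have hin : ∀ z ∈ ball a (r / 4), ∀ ζ ∈ ball (0 : ℂ) 2, z + ζ • v ∈ U := by
    intro z hz ζ hζ
    apply hball
    rw [mem_ball, dist_eq_norm] at hz ⊢
    rw [mem_ball_zero_iff] at hζ
    calc ‖z + ζ • v - a‖ = ‖(z - a) + ζ • v‖ := by congr 1; abel
      _ ≤ ‖z - a‖ + ‖ζ‖ * ‖v‖ := (norm_add_le _ _).trans_eq (by rw [norm_smul])
      _ < r := by nlinarith [norm_nonneg ζ, norm_nonneg v]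
  have hanal : ∀ z ∈ ball a (r / 4), AnalyticOnNhd ℂ (fun ζ : ℂ => e (z + ζ • v)) (ball 0 2) :=
    fun z hz => DifferentiableOn.analyticOnNhd
      (he.comp (by fun_prop) fun ζ hζ => hin z hz ζ hζ) isOpen_ball
  have ha' : a ∈ ball a (r / 4) := mem_ball_self (by positivity)
  have hpre : IsPreconnected (ball (0 : ℂ) 2) := (convex_ball (0 : ℂ) 2).isPreconnected
  obtain ⟨ρ, hρ0, hρ2, hρ⟩ : ∃ ρ : ℝ, 0 < ρ ∧ ρ < 2 ∧
      ∀ ζ ∈ sphere (0 : ℂ) ρ, e (a + ζ • v) ≠ 0 := by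
    rcases (hanal a ha' 0 (by simp)).eventually_eq_zero_or_eventually_ne_zero with h | h
    · exfalso
      have := (hanal a ha').eqOn_zero_of_preconnected_of_eventuallyEq_zero hpre (by simp) h
        (show (1 : ℂ) ∈ ball (0 : ℂ) 2 by simp)
      apply hbe
      simpa [hv] using this
    · rw [eventually_nhdsWithin_iff, Metric.eventually_nhds_iff] at h
      obtain ⟨δ, hδ, h⟩ := h
      refine ⟨min (δ / 2) 1, by positivity, by
        have := min_le_right (δ / 2) 1; linarith, fun ζ hζ => h ?_ ?_⟩
      · rw [mem_sphere] at hζ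
        rw [hζ]
        have := min_le_left (δ / 2) 1
        linarith
      · exact ne_of_mem_sphere hζ (by positivity)
  have hcompact : IsCompact (sphere (0 : ℂ) ρ) := isCompact_sphere _ _
  -- By compactness the same circle avoids the zeros of e on all parallel lines through points near
  -- a.
  obtain ⟨s, hs, hs4, hse⟩ : ∃ s : ℝ, 0 < s ∧ s < r / 4 ∧ ∀ z ∈ closedBall a s,
      ∀ ζ ∈ sphere (0 : ℂ) ρ, e (z + ζ • v) ≠ 0 := by
    have hev : ∀ᶠ z in 𝓝 a, ∀ ζ ∈ sphere (0 : ℂ) ρ, e (z + ζ • v) ≠ 0 := by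
      refine hcompact.eventually_forall_of_forall_eventually fun ζ hζ => ?_
      have hmem : a + ζ • v ∈ U := hin a ha' ζ (by
        rw [mem_ball]; rw [mem_sphere] at hζ; linarith)
      have hc : ContinuousAt (fun x : E × ℂ => e (x.1 + x.2 • v)) (a, ζ) :=
        ContinuousAt.comp (f := fun x : E × ℂ => x.1 + x.2 • v) (g := e)
          (he.continuousOn.continuousAt (hU.mem_nhds hmem)) (by fun_prop)
      have := hc.eventually_ne (hρ ζ hζ)
      exact this
    obtain ⟨s, hs, h⟩ := Metric.eventually_nhds_iff_ball.mp hev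
    refine ⟨min s (r / 4) / 2, by positivity, ?_, fun z hz => h z ?_⟩
    · have := min_le_right s (r / 4)
      have : 0 < min s (r / 4) := by positivity
      linarith
    · have := min_le_left s (r / 4)
      have : 0 < min s (r / 4) := by positivity
      rw [mem_closedBall] at hz
      rw [mem_ball]; linarith
  have hclosed : closedBall (0 : ℂ) ρ ⊆ ball 0 2 := closedBall_subset_ball hρ2
  have hzin : ∀ z ∈ closedBall a s, z ∈ ball a (r / 4) := fun z hz =>
    closedBall_subset_ball hs4 hz
  have key : ∀ z ∈ ball a s, f z = ∫ θ in (0 : ℝ)..2 * Real.pi,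
      (2 * Real.pi * Complex.I : ℂ)⁻¹ * (_root_.deriv (circleMap 0 ρ) θ *
        ((circleMap 0 ρ θ)⁻¹ * f (z + circleMap 0 ρ θ • v))) := by
    intro z hz
    have hz' := hzin z (ball_subset_closedBall hz)
    -- An accumulation point of zeros would make e vanish on the circle as well. So the exceptional
    -- set is finite, and Cauchy's formula holds for f, which is merely continuous there.
    have hcount : ({ζ | e (z + ζ • v) = 0} ∩ closedBall (0 : ℂ) ρ).Countable := by
      refine Set.Finite.countable (by_contra fun hinf => ?_)
      obtain ⟨x, hx, hacc⟩ := Set.Infinite.exists_accPt_of_subset_isCompact hinf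
        (isCompact_closedBall (0 : ℂ) ρ) inter_subset_right
      have hfreq : ∃ᶠ ζ in 𝓝[≠] x, e (z + ζ • v) = 0 :=
        (accPt_iff_frequently_nhdsNE.mp hacc).mono fun ζ hζ => hζ.1
      have h := (hanal z hz').eqOn_zero_of_preconnected_of_frequently_eq_zero hpre (hclosed hx) hfreq
      have hζ : (ρ : ℂ) ∈ sphere (0 : ℂ) ρ := by simp [abs_of_pos hρ0]
      exact hse z (ball_subset_closedBall hz) _ hζ (h (hclosed (sphere_subset_closedBall hζ)))
    have hcf : ContinuousOn (fun ζ : ℂ => f (z + ζ • v)) (closedBall 0 ρ) :=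
      hf.comp (by fun_prop) fun ζ hζ => hin z hz' ζ (hclosed hζ)
    have h2 := Complex.two_pi_I_inv_smul_circleIntegral_sub_inv_smul_of_differentiable_on_off_countable
      hcount (c := (0 : ℂ)) (w := 0) (R := ρ) (mem_ball_self hρ0) hcf fun ζ hζ => by
        have hζ2 := hclosed (ball_subset_closedBall hζ.1)
        have hne : e (z + ζ • v) ≠ 0 := fun h0 => hζ.2 ⟨h0, ball_subset_closedBall hζ.1⟩
        exact DifferentiableAt.comp (f := fun ζ : ℂ => z + ζ • v) (g := f) ζ
          (hfe _ (hin z hz' ζ hζ2) hne) (by fun_prop)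
    simp only [sub_zero, zero_smul, add_zero] at h2
    rw [← h2, circleIntegral, intervalIntegral.integral_const_mul]
    simp
  have hev := Filter.eventuallyEq_of_mem (ball_mem_nhds a hs) key
  refine DifferentiableAt.congr_of_eventuallyEq ?_ hev
  have hmem : ∀ θ, circleMap 0 ρ θ ∈ sphere (0 : ℂ) ρ := fun θ =>
    circleMap_mem_sphere 0 hρ0.le θ
  have hmem2 : ∀ θ, circleMap 0 ρ θ ∈ ball (0 : ℂ) 2 := fun θ =>
    hclosed (sphere_subset_closedBall (hmem θ))
  have hne : ∀ θ, circleMap 0 ρ θ ≠ 0 := fun θ => by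
    simpa using circleMap_ne_center (c := 0) hρ0.ne' (θ := θ)
  refine differentiableAt_intervalIntegral_of_continuousOn hs ?_ ?_
  · have hc : Continuous (circleMap 0 ρ) := continuous_circleMap 0 ρ
    simp only [Function.uncurry_def, deriv_circleMap]
    refine continuousOn_const.mul (ContinuousOn.mul (by fun_prop) (ContinuousOn.mul ?_ ?_))
    · exact ContinuousOn.inv₀ (by fun_prop) fun x _ => hne x.2
    · exact hf.comp (by fun_prop) fun x hx => hin x.1 (hzin _ hx.1) _ (hmem2 _)
  · intro θ _
    refine DifferentiableOn.const_mul (DifferentiableOn.const_mul (DifferentiableOn.const_mul ?_ _) _) _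
    intro z hz
    refine DifferentiableAt.differentiableWithinAt ?_
    have hz' := ball_subset_closedBall hz
    exact DifferentiableAt.comp (f := fun z => z + circleMap 0 ρ θ • v) (g := f) z
      (hfe _ (hin z (hzin z hz') _ (hmem2 θ)) (hse z hz' _ (hmem θ))) (by fun_prop)

end SeveralVariables

/-! ### Boundary uniqueness on the disc and the polydisc. -/

section BoundaryUniqueness

open Metric Real

/-- A holomorphic function on the unit disc that is continuous up to the boundary and vanishes on
a subset of the unit circle of positive measure is zero. -/
theorem eq_zero_of_volume_zeros_circle_ne_zero {k : ℂ → ℂ}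
    (hc : ContinuousOn k (closedBall 0 1)) (hd : DifferentiableOn ℂ k (ball 0 1))
    (hpos : (volume.restrict (Ioc 0 (2 * π))) {θ : ℝ | k (circleMap 0 1 θ) = 0} ≠ 0) :
    ∀ ζ ∈ closedBall (0 : ℂ) 1, k ζ = 0 := by
  have hanal : AnalyticOnNhd ℂ k (ball 0 1) := hd.analyticOnNhd isOpen_ball
  have hpre : IsPreconnected (ball (0 : ℂ) 1) := (convex_ball (0 : ℂ) 1).isPreconnected
  suffices h0 : ∀ ζ ∈ ball (0 : ℂ) 1, k ζ = 0 by
    intro ζ hζ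
    rw [← closure_ball (0 : ℂ) one_ne_zero] at hζ hc
    exact closure_minimal (s := ball (0 : ℂ) 1) (t := {ζ | ζ ∈ closure (ball (0 : ℂ) 1) ∧ k ζ = 0})
      (fun z hz => ⟨subset_closure hz, h0 z hz⟩)
      (hc.preimage_isClosed_of_isClosed isClosed_closure isClosed_singleton) hζ |>.2
  -- If k is not identically zero, Jensen's formula bounds the circle averages of log |k| from below
  -- as r → 1. Zeros of positive measure on the unit circle force arbitrarily negative upper bounds,
  -- a contradiction.
  rcases hanal.eqOn_zero_or_eventually_ne_zero_of_preconnected hpre with h | hne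
  · exact h
  exfalso
  -- a lower bound for the logarithmic means
  obtain ⟨B, hB⟩ : ∃ B : ℝ, ∀ r ∈ Ioo (1 / 2 : ℝ) 1,
      B ≤ circleAverage (fun z => log ‖k z‖) 0 r := by
    set d : ℝ := ((meromorphicOrderAt k 0).untop₀ : ℝ) with hdd
    have hm : 0 ≤ d := by
      rw [hdd]
      have := (hanal 0 (by simp)).meromorphicOrderAt_nonneg
      exact_mod_cast WithTop.untop₀_nonneg.mpr this
    refine ⟨d * log (1 / 2) + log ‖meromorphicTrailingCoeffAt k 0‖, fun r hr => ?_⟩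
    have hr0 : 0 < r := by linarith [hr.1]
    have hsub : closedBall (0 : ℂ) |r| ⊆ ball 0 1 := by
      rw [abs_of_pos hr0]; exact closedBall_subset_ball hr.2
    have hmer := (hanal.mono hsub).meromorphicOn
    rw [hmer.circleAverage_log_norm hr0.ne', MeromorphicOn.divisor_apply hmer (by simp)]
    have h1 : 0 ≤ ∑ᶠ u, (MeromorphicOn.divisor k (closedBall 0 |r|) u : ℝ)
        * log (r * ‖0 - u‖⁻¹) := by
      refine finsum_nonneg fun u => ?_
      by_cases hu : u ∈ closedBall (0 : ℂ) |r|
      · refine mul_nonneg ?_ ?_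
        · exact_mod_cast MeromorphicOn.AnalyticOnNhd.divisor_nonneg (hanal.mono hsub) u
        -- At u = 0 the conventions 0⁻¹ = 0 and log 0 = 0 make the term vanish; the zero at the
        -- origin is accounted for by d log r.
        · rcases eq_or_ne u 0 with rfl | hu0
          · simp
          · refine log_nonneg ?_
            rw [zero_sub, norm_neg, ← div_eq_mul_inv, one_le_div (norm_pos_iff.mpr hu0)]
            simpa [abs_of_pos hr0] using hu
      · simp [hu]
    have h2 : d * log (1 / 2) ≤ d * log r :=
      mul_le_mul_of_nonneg_left (log_le_log (by norm_num) hr.1.le) hm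
    linarith
  have hmeasZ : MeasurableSet {θ : ℝ | k (circleMap 0 1 θ) = 0} := by
    have : ContinuousOn (fun θ : ℝ => k (circleMap 0 1 θ)) univ :=
      hc.comp (by fun_prop) fun θ _ =>
        sphere_subset_closedBall (circleMap_mem_sphere 0 zero_le_one θ)
    exact (isClosed_singleton.preimage (continuousOn_univ.mp this)).measurableSet
  obtain ⟨M, hM⟩ := (isCompact_closedBall (0 : ℂ) 1).exists_bound_of_continuousOn hc
  set M' := max M 1 with hM'
  have hcm : ∀ r ∈ Icc (0 : ℝ) 1, ∀ θ, circleMap 0 r θ ∈ closedBall (0 : ℂ) 1 := fun r hr θ =>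
    closedBall_subset_closedBall hr.2
      (sphere_subset_closedBall (circleMap_mem_sphere 0 hr.1 θ))
  have hk : ContinuousOn (fun x : ℝ × ℝ => k (circleMap 0 x.1 x.2)) (Icc 0 1 ×ˢ univ) := by
    refine hc.comp ?_ fun x hx => hcm x.1 hx.1 x.2
    simp only [circleMap]
    fun_prop
  -- Truncating the logarithm at -T makes the integrand continuous up to r = 1, so the averages
  -- converge.
  have hupper : ∀ T : ℝ, 0 < T → B ≤ (2 * π)⁻¹ *
      ∫ θ in (0 : ℝ)..2 * π, log (max ‖k (circleMap 0 1 θ)‖ (exp (-T))) := by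
    intro T hT
    have hlogc : ContinuousOn (fun x : ℝ × ℝ => log (max ‖k (circleMap 0 x.1 x.2)‖ (exp (-T))))
        (Icc 0 1 ×ˢ univ) := by
      refine ContinuousOn.log (hk.norm.sup continuousOn_const) fun x _ => ?_
      exact (lt_max_of_lt_right (exp_pos _)).ne'
    have hslice : ∀ r ∈ Icc (0 : ℝ) 1,
        Continuous fun θ => log (max ‖k (circleMap 0 r θ)‖ (exp (-T))) := by
      intro r hr
      rw [← continuousOn_univ]
      exact hlogc.comp (f := fun θ : ℝ => (r, θ)) (by fun_prop) fun θ _ => ⟨hr, mem_univ _⟩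
    obtain ⟨C, hC⟩ := ((isCompact_Icc (a := (0 : ℝ)) (b := 1)).prod
      (isCompact_uIcc (a := 0) (b := 2 * π))).exists_bound_of_continuousOn
      (hlogc.mono (prod_mono_right (subset_univ _)))
    have hlim : Tendsto (fun r : ℝ => (2 * π)⁻¹ * ∫ θ in (0 : ℝ)..2 * π,
        log (max ‖k (circleMap 0 r θ)‖ (exp (-T)))) (𝓝[<] 1) (𝓝 ((2 * π)⁻¹ *
      ∫ θ in (0 : ℝ)..2 * π, log (max ‖k (circleMap 0 1 θ)‖ (exp (-T))))) := by
      refine Tendsto.const_mul _ ?_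
      have hIoo : Ioo (0 : ℝ) 1 ∈ 𝓝[<] (1 : ℝ) := Ioo_mem_nhdsLT one_pos
      refine intervalIntegral.tendsto_integral_filter_of_dominated_convergence (fun _ => C) ?_ ?_
        (by simp) ?_
      · filter_upwards [hIoo] with r hr
        exact (hslice r (Ioo_subset_Icc_self hr)).aestronglyMeasurable
      · filter_upwards [hIoo] with r hr
        exact Eventually.of_forall fun θ hθ =>
          hC (r, θ) ⟨Ioo_subset_Icc_self hr, uIoc_subset_uIcc hθ⟩
      · refine Eventually.of_forall fun θ _ => ?_
        have h1 := (hlogc (1, θ) ⟨by simp, mem_univ _⟩)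
        refine h1.tendsto.comp (f := fun r : ℝ => (r, θ)) ?_
        refine tendsto_nhdsWithin_iff.mpr ⟨?_, ?_⟩
        · exact (Continuous.tendsto (by fun_prop) _).mono_left nhdsWithin_le_nhds
        · filter_upwards [hIoo] with r hr
          exact ⟨Ioo_subset_Icc_self hr, mem_univ _⟩
    refine ge_of_tendsto hlim ?_
    filter_upwards [Ioo_mem_nhdsLT (by norm_num : (1 / 2 : ℝ) < 1)] with r hr
    have hr0 : 0 < r := by linarith [hr.1]
    refine (hB r hr).trans ?_
    have hsub : closedBall (0 : ℂ) |r| ⊆ ball 0 1 := by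
      rw [abs_of_pos hr0]; exact closedBall_subset_ball hr.2
    have hsub' : sphere (0 : ℂ) |r| ⊆ ball 0 1 := sphere_subset_closedBall.trans hsub
    -- Since log 0 = 0 by convention, log |k| exceeds its truncation at the zeros of k. Resetting
    -- the value there to -T repairs the inequality and leaves the average unchanged.
    have hcong : (fun z => log ‖k z‖) =ᶠ[codiscreteWithin (sphere (0 : ℂ) |r|)]
        fun z => if k z = 0 then -T else log ‖k z‖ := by
      filter_upwards [codiscreteWithin_mono hsub' hne] with z hz
      rw [if_neg hz]
    have hint : CircleIntegrable (fun z => log ‖k z‖) 0 r :=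
      (hanal.mono hsub').meromorphicOn.circleIntegrable_log_norm
    rw [Real.circleAverage_congr_codiscreteWithin hcong hr0.ne']
    refine Real.circleAverage_mono (f₂ := fun z => log (max ‖k z‖ (exp (-T))))
      (hint.congr_codiscreteWithin hcong) ?_ fun z _ => ?_
    · exact (hslice r ⟨hr0.le, hr.2.le⟩).intervalIntegrable _ _
    · split_ifs with h
      · simp [h, max_eq_right (exp_pos (-T)).le]
      · exact log_le_log (norm_pos_iff.mpr h) (le_max_left _ _)
  set Z := {θ : ℝ | k (circleMap 0 1 θ) = 0} with hZ
  set c : ℝ := (volume.restrict (Ioc 0 (2 * π))).real Z with hcdef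
  have hcpos : 0 < c := ENNReal.toReal_pos hpos (measure_ne_top _ _)
  have hfinal : ∀ T : ℝ, 0 < T → 2 * π * B ≤ 2 * π * log M' - T * c := by
    intro T hT
    have h1 := hupper T hT
    have h2 : ∫ θ in (0 : ℝ)..2 * π, log (max ‖k (circleMap 0 1 θ)‖ (exp (-T)))
        ≤ ∫ θ in (0 : ℝ)..2 * π, (log M' + Z.indicator (fun _ => -T) θ) := by
      refine intervalIntegral.integral_mono_on (by positivity) ?_ ?_ fun θ _ => ?_
      · refine Continuous.intervalIntegrable ?_ _ _
        refine Continuous.log ?_ fun x => (lt_max_of_lt_right (exp_pos _)).ne'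
        refine Continuous.sup (Continuous.norm ?_) continuous_const
        rw [← continuousOn_univ]
        exact hk.comp (f := fun θ : ℝ => ((1 : ℝ), θ)) (by fun_prop) fun θ _ => by simp
      · rw [intervalIntegrable_iff_integrableOn_Ioc_of_le (by positivity)]
        exact (integrable_const _).add ((integrable_const _).indicator hmeasZ)
      · by_cases hθ : θ ∈ Z
        · have h0 : k (circleMap 0 1 θ) = 0 := hθ
          rw [indicator_of_mem hθ, h0]
          have : 0 ≤ log M' := log_nonneg (le_max_right _ _)
          simp only [norm_zero, max_eq_right (exp_pos (-T)).le, log_exp]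
          linarith
        · rw [indicator_of_notMem hθ, add_zero]
          refine log_le_log (lt_max_of_lt_right (exp_pos _)) (max_le ?_ ?_)
          · exact (hM _ (hcm 1 (by simp) θ)).trans (le_max_left _ _)
          · exact (exp_le_one_iff.mpr (by linarith)).trans (le_max_right _ _)
    have h3 : ∫ θ in (0 : ℝ)..2 * π, (log M' + Z.indicator (fun _ => -T) θ)
        = 2 * π * log M' - T * c := by
      rw [intervalIntegral.integral_of_le (by positivity), integral_add (integrable_const _)
        ((integrable_const _).indicator hmeasZ), integral_indicator_const _ hmeasZ]
      simp only [integral_const, smul_eq_mul, measureReal_restrict_apply_univ, volume_real_Ioc,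
        sub_zero, max_eq_left (by positivity : (0 : ℝ) ≤ 2 * π), hcdef]
      ring
    have h4 : 2 * π * B ≤ ∫ θ in (0 : ℝ)..2 * π, log (max ‖k (circleMap 0 1 θ)‖ (exp (-T))) := by
      have hpi : 0 < 2 * π := by positivity
      have := mul_le_mul_of_nonneg_left h1 hpi.le
      rwa [← mul_assoc, mul_inv_cancel₀ hpi.ne', one_mul] at this
    linarith
  -- With this T the term T c exceeds the difference of the two fixed bounds by at least 1.
  have := hfinal ((|2 * π * log M' - 2 * π * B| + 1) / c) (by positivity)
  rw [div_mul_cancel₀ _ hcpos.ne'] at this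
  linarith [le_abs_self (2 * π * log M' - 2 * π * B)]

/-- A holomorphic function on the unit polydisc that is continuous up to the boundary and vanishes
on a subset of the torus of positive measure is zero. -/
theorem eq_zero_of_volume_zeros_torus_ne_zero {N : ℕ} {k : (Fin N → ℂ) → ℂ}
    (hc : ContinuousOn k (closedBall 0 1)) (hd : DifferentiableOn ℂ k (ball 0 1))
    (hpos : (Measure.pi fun _ : Fin N => volume.restrict (Ioc 0 (2 * π)))
      {θ : Fin N → ℝ | k (fun j => circleMap 0 1 (θ j)) = 0} ≠ 0) :
    ∀ ζ ∈ closedBall (0 : Fin N → ℂ) 1, k ζ = 0 := by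
  induction N with
  | zero =>
    intro ζ _
    obtain ⟨θ, hθ⟩ := nonempty_of_measure_ne_zero hpos
    rw [← hθ]
    congr 1
    exact Subsingleton.elim _ _
  | succ N ih =>
    have hball : ∀ (z : ℂ) (w : Fin N → ℂ), Fin.cons z w ∈ closedBall (0 : Fin (N + 1) → ℂ) 1 ↔
        z ∈ closedBall (0 : ℂ) 1 ∧ w ∈ closedBall (0 : Fin N → ℂ) 1 := by
      intro z w
      simp [pi_norm_le_iff_of_nonneg, Fin.forall_fin_succ]
    have hball' : ∀ (z : ℂ) (w : Fin N → ℂ), Fin.cons z w ∈ ball (0 : Fin (N + 1) → ℂ) 1 ↔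
        z ∈ ball (0 : ℂ) 1 ∧ w ∈ ball (0 : Fin N → ℂ) 1 := by
      intro z w
      simp [pi_norm_lt_iff, Fin.forall_fin_succ]
    have hcons : Continuous fun x : ℂ × (Fin N → ℂ) => (Fin.cons x.1 x.2 : Fin (N + 1) → ℂ) :=
      Continuous.finCons continuous_fst continuous_snd
    have hconsd : ∀ (w : Fin N → ℂ), Differentiable ℂ
        fun z : ℂ => (Fin.cons z w : Fin (N + 1) → ℂ) := fun w => by
      rw [differentiable_pi]
      intro i
      refine Fin.cases ?_ (fun i => ?_) i <;> simp
    have hconsd' : ∀ (z : ℂ), Differentiable ℂ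
        fun w : Fin N → ℂ => (Fin.cons z w : Fin (N + 1) → ℂ) := fun z => by
      rw [differentiable_pi]
      intro i
      refine Fin.cases ?_ (fun i => ?_) i
      · simp
      · simpa using differentiable_apply i
    have htorus : ∀ {m : ℕ} (θ : Fin m → ℝ),
        (fun j => circleMap 0 1 (θ j)) ∈ closedBall (0 : Fin m → ℂ) 1 := fun θ => by
      simp [pi_norm_le_iff_of_nonneg]
    set μ : Measure ℝ := volume.restrict (Ioc 0 (2 * π)) with hμ
    set Z : Set (Fin (N + 1) → ℝ) := {θ | k (fun j => circleMap 0 1 (θ j)) = 0} with hZ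
    have hZmeas : MeasurableSet Z := by
      have : Continuous fun θ : Fin (N + 1) → ℝ => k (fun j => circleMap 0 1 (θ j)) := by
        rw [← continuousOn_univ]
        exact hc.comp (by fun_prop) fun θ _ => htorus θ
      exact (isClosed_singleton.preimage this).measurableSet
    have hmp := (measurePreserving_piFinSuccAbove (fun _ : Fin (N + 1) => μ) 0).symm
    have hprod : (μ.prod (Measure.pi fun _ : Fin N => μ))
        {x : ℝ × (Fin N → ℝ) | Fin.cons x.1 x.2 ∈ Z} ≠ 0 := by
      intro h0
      apply hpos
      rw [← hmp.measure_preimage_equiv]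
      convert h0 using 3
      ext x
      simp [MeasurableEquiv.piFinSuccAbove_symm_apply, Fin.insertNthEquiv]
    have hcons' : Measurable fun x : ℝ × (Fin N → ℝ) => (Fin.cons x.1 x.2 : Fin (N + 1) → ℝ) :=
      (Continuous.finCons continuous_fst continuous_snd).measurable
    -- By Fubini E has positive measure. For θ' in E the disc case makes k vanish on the whole
    -- first-variable disc, so for each z in the open disc the function k(z, ·) vanishes on E and
    -- the induction hypothesis applies.
    set E : Set (Fin N → ℝ) := {θ' | μ {θ₀ | Fin.cons θ₀ θ' ∈ Z} ≠ 0} with hE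
    have hEpos : (Measure.pi fun _ : Fin N => μ) E ≠ 0 := by
      intro h0
      apply hprod
      have hS : MeasurableSet {x : ℝ × (Fin N → ℝ) | (Fin.cons x.1 x.2 : Fin (N + 1) → ℝ) ∈ Z} :=
        hcons' hZmeas
      rw [← Measure.measurePreserving_swap.measure_preimage hS.nullMeasurableSet,
        Measure.measure_prod_null (measurable_swap hS)]
      rw [EventuallyEq, ae_iff]
      exact h0
    have hfib : ∀ θ' ∈ E, ∀ z ∈ closedBall (0 : ℂ) 1,
        k (Fin.cons z fun j => circleMap 0 1 (θ' j)) = 0 := by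
      intro θ' hθ'
      set w : Fin N → ℂ := fun j => circleMap 0 1 (θ' j) with hw
      refine eq_zero_of_volume_zeros_circle_ne_zero ?_ ?_ ?_
      · exact hc.comp (by fun_prop) fun z hz => (hball _ _).mpr ⟨hz, htorus θ'⟩
      · have huc := (isCompact_closedBall (0 : Fin (N + 1) → ℂ) 1).uniformContinuousOn_of_continuous
          hc
        -- The slice through the torus point w is not inside the open polydisc; it is holomorphic as
        -- the uniform limit of the slices through s w as s → 1.
        have hlim : TendstoLocallyUniformlyOn
            (fun (s : ℝ) (z : ℂ) => k (Fin.cons z ((s : ℂ) • w)))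
            (fun z => k (Fin.cons z w)) (𝓝[<] 1) (ball 0 1) := by
          refine TendstoUniformlyOn.tendstoLocallyUniformlyOn ?_
          rw [Metric.tendstoUniformlyOn_iff]
          intro ε hε
          rw [Metric.uniformContinuousOn_iff] at huc
          obtain ⟨δ, hδ, h⟩ := huc ε hε
          have hcont : Tendsto (fun s : ℝ => dist w ((s : ℂ) • w)) (𝓝[<] 1) (𝓝 0) := by
            have : Continuous fun s : ℝ => dist w ((s : ℂ) • w) := by fun_prop
            have h1 := (this.tendsto 1).mono_left (nhdsWithin_le_nhds (s := Iio 1))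
            simpa using h1
          filter_upwards [hcont.eventually_lt_const hδ, Ioo_mem_nhdsLT one_pos] with s hs hs1 z hz
          have hz' := ball_subset_closedBall hz
          refine h _ ((hball _ _).mpr ⟨hz', htorus θ'⟩) _ ((hball _ _).mpr ⟨hz', ?_⟩) ?_
          · have hw1 := htorus θ'
            rw [mem_closedBall_zero_iff] at hw1 ⊢
            rw [norm_smul, Complex.norm_real, Real.norm_of_nonneg hs1.1.le]
            exact mul_le_one₀ hs1.2.le (norm_nonneg _) hw1
          · rw [dist_pi_lt_iff hδ]
            intro i
            refine Fin.cases (by simpa using hδ) (fun i => ?_) i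
            simpa using (dist_le_pi_dist w ((s : ℂ) • w) i).trans_lt hs
        refine hlim.differentiableOn ?_ isOpen_ball
        filter_upwards [Ioo_mem_nhdsLT one_pos] with s hs
        refine hd.comp (hconsd _).differentiableOn fun z hz => (hball' _ _).mpr ⟨hz, ?_⟩
        have hw1 := htorus θ'
        rw [mem_closedBall_zero_iff] at hw1
        rw [mem_ball_zero_iff, norm_smul, Complex.norm_real, Real.norm_of_nonneg hs.1.le]
        exact (mul_le_of_le_one_right hs.1.le hw1).trans_lt hs.2
      · have heq : {θ : ℝ | k (Fin.cons (circleMap 0 1 θ) w) = 0}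
            = {θ₀ | (Fin.cons θ₀ θ' : Fin (N + 1) → ℝ) ∈ Z} := by
          ext θ₀
          change k _ = 0 ↔ k _ = 0
          rw [show (Fin.cons (circleMap 0 1 θ₀) w : Fin (N + 1) → ℂ) =
            fun j => circleMap 0 1 ((Fin.cons θ₀ θ' : Fin (N + 1) → ℝ) j) from ?_]
          ext i
          refine Fin.cases (by simp) (fun i => ?_) i
          simp [hw]
        rw [heq]
        exact hθ'
    have hint : ∀ z ∈ ball (0 : ℂ) 1, ∀ w ∈ closedBall (0 : Fin N → ℂ) 1,
        k (Fin.cons z w) = 0 := by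
      intro z hz
      refine ih (k := fun w => k (Fin.cons z w)) ?_ ?_ ?_
      · exact hc.comp (by fun_prop) fun w hw => (hball _ _).mpr ⟨ball_subset_closedBall hz, hw⟩
      · exact hd.comp (hconsd' _).differentiableOn fun w hw => (hball' _ _).mpr ⟨hz, hw⟩
      · refine fun h0 => hEpos (measure_mono_null (fun θ' hθ' => ?_) h0)
        exact hfib θ' hθ' z (ball_subset_closedBall hz)
    intro ζ hζ
    rw [← closure_ball (0 : Fin (N + 1) → ℂ) one_ne_zero] at hζ hc
    refine (closure_minimal (s := ball (0 : Fin (N + 1) → ℂ) 1)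
      (t := {ζ | ζ ∈ closure (ball (0 : Fin (N + 1) → ℂ) 1) ∧ k ζ = 0})
      (fun z hz => ⟨subset_closure hz, ?_⟩)
      (hc.preimage_isClosed_of_isClosed isClosed_closure isClosed_singleton) hζ).2
    rw [← Fin.cons_self_tail z] at hz ⊢
    have := (hball' _ _).mp hz
    exact hint _ this.1 _ (ball_subset_closedBall this.2)

end BoundaryUniqueness

/-! ### The complex determinant of a real derivative that is complex linear. -/

section ComplexDet

variable {n : ℕ}

/-- The complex matrix of a real linear map of `ℂⁿ` that happens to be complex linear. -/
noncomputable def complexMatrix (L : Cn n →L[ℝ] Cn n) : Matrix (Fin n) (Fin n) ℂ :=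
  Matrix.of fun j k => L (EuclideanSpace.single k 1) j

theorem continuous_complexMatrix : Continuous (complexMatrix (n := n)) := by
  refine continuous_matrix fun j k => ?_
  simp only [complexMatrix, Matrix.of_apply]
  fun_prop

theorem apply_eq_complexMatrix_mulVec {L : Cn n →L[ℝ] Cn n}
    (hL : ∀ (c : ℂ) (v : Cn n), L (c • v) = c • L v) (v : Cn n) :
    L v = WithLp.toLp 2 ((complexMatrix L).mulVec v.ofLp) := by
  have hv : v = ∑ k, v k • EuclideanSpace.single k (1 : ℂ) := by
    ext j
    simp [Finset.sum_apply, Pi.single_apply]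
  ext j
  conv_lhs => rw [hv, map_sum]
  simp only [hL, complexMatrix, Matrix.mulVec, dotProduct, Matrix.of_apply]
  simp [mul_comm]

theorem injective_of_complexMatrix_det_ne_zero {L : Cn n →L[ℝ] Cn n}
    (hL : ∀ (c : ℂ) (v : Cn n), L (c • v) = c • L v) (hdet : (complexMatrix L).det ≠ 0) :
    Function.Injective L := by
  rw [injective_iff_map_eq_zero]
  intro v hv
  rw [apply_eq_complexMatrix_mulVec hL] at hv
  have h0 : (complexMatrix L).mulVec v.ofLp = 0 := congrArg WithLp.ofLp hv
  have := Matrix.eq_zero_of_mulVec_eq_zero hdet h0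
  ext j
  exact congrFun this j

/-- A complex kernel vector is also a real one. This makes the real form of Sard's theorem
applicable to the zeros of the complex Jacobian. -/
theorem det_eq_zero_of_complexMatrix_det_eq_zero {L : Cn n →L[ℝ] Cn n}
    (hL : ∀ (c : ℂ) (v : Cn n), L (c • v) = c • L v) (hdet : (complexMatrix L).det = 0) :
    L.det = 0 := by
  obtain ⟨v, hv, hv0⟩ := Matrix.exists_mulVec_eq_zero_iff.mpr hdet
  by_contra hne
  have hinj : Function.Injective (L : Cn n →ₗ[ℝ] Cn n) :=
    (LinearMap.equivOfDetNeZero (L : Cn n →ₗ[ℝ] Cn n) hne).injective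
  have h1 : L (WithLp.toLp 2 v) = 0 := by
    rw [apply_eq_complexMatrix_mulVec hL]
    simp [hv0]
  have h2 : WithLp.toLp 2 v = (0 : Cn n) := hinj (by simpa using h1)
  exact hv (by simpa using congrArg WithLp.ofLp h2)

/-- Cramer's rule: the adjugate is a substitute for the inverse that stays bounded when the
determinant tends to zero. -/
theorem apply_adjugate_complexMatrix {L : Cn n →L[ℝ] Cn n}
    (hL : ∀ (c : ℂ) (v : Cn n), L (c • v) = c • L v) (v : Cn n) :
    L (Matrix.toEuclideanCLM (𝕜 := ℂ) (complexMatrix L).adjugate v)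
      = (complexMatrix L).det • v := by
  rw [apply_eq_complexMatrix_mulVec hL]
  ext j
  simp [Matrix.ofLp_toEuclideanCLM, Matrix.mul_adjugate, Matrix.smul_mulVec]

theorem complexMatrix_det_restrictScalars (L : Cn n →L[ℂ] Cn n) :
    (complexMatrix (L.restrictScalars ℝ)).det = L.det := by
  have : complexMatrix (L.restrictScalars ℝ)
      = LinearMap.toMatrix (EuclideanSpace.basisFun (Fin n) ℂ).toBasis
        (EuclideanSpace.basisFun (Fin n) ℂ).toBasis (L : Cn n →ₗ[ℂ] Cn n) := by
    ext j k
    simp [complexMatrix, LinearMap.toMatrix_apply]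
  rw [this, LinearMap.det_toMatrix, ContinuousLinearMap.det]

end ComplexDet

/-! ### The quotient map: Jacobian, openness, continuous descent. -/

namespace QuotientQuadruple

variable {n : ℕ} (Q : QuotientQuadruple n)

theorem isOpen_X : IsOpen Q.X := by
  rcases Q.model with ⟨hX, -⟩ | ⟨hX, -⟩
  · have : Q.X = ⋂ j, {z : Cn n | ‖z j‖ < 1} := by
      rw [hX]; ext z; simp [unitPolydisc]
    rw [this]
    exact isOpen_iInter_of_finite fun j => isOpen_lt (by fun_prop) continuous_const
  · exact hX.1

theorem Φ_mem {z : Cn n} (hz : z ∈ Q.X) : Q.Φ z ∈ Q.Ω := by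
  rw [← Q.image_Φ]
  exact mem_image_of_mem _ hz

theorem exists_Φ_eq {w : Cn n} (hw : w ∈ Q.Ω) : ∃ z ∈ Q.X, Q.Φ z = w := by
  rwa [← Q.image_Φ] at hw

theorem Φ_apply {τ : Cn n ≃ₗᵢ[ℂ] Cn n} (hτ : τ ∈ Q.G) {z : Cn n} (hz : z ∈ Q.X) :
    Q.Φ (τ z) = Q.Φ z :=
  (Q.fibre_X z hz _ (Q.invariant_X τ hτ z hz)).mpr ⟨τ, hτ, rfl⟩

theorem Γ_subset_closure : Q.Γ ⊆ closure Q.X := by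
  intro z hz
  have hlim : Tendsto (fun r : ℝ => (r : ℂ) • z) (𝓝[<] 1) (𝓝 z) := by
    have : Continuous fun r : ℝ => (r : ℂ) • z := by fun_prop
    simpa using (this.tendsto 1).mono_left (nhdsWithin_le_nhds (s := Iio 1))
  refine mem_closure_of_tendsto hlim ?_
  filter_upwards [Ioo_mem_nhdsLT one_pos] with r hr using Q.smul_mem hz hr

theorem contDiffAt_Φ {z : Cn n} (hz : z ∈ closure Q.X) : ContDiffAt ℝ ∞ Q.Φ z := by
  obtain ⟨U, hU, hXU, h⟩ := Q.smooth_Φ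
  exact h.contDiffAt (hU.mem_nhds (hXU hz))

theorem differentiableAt_Φ {z : Cn n} (hz : z ∈ Q.X) : DifferentiableAt ℂ Q.Φ z :=
  Q.holomorphic_Φ.differentiableAt (Q.isOpen_X.mem_nhds hz)

theorem fderiv_real_Φ {z : Cn n} (hz : z ∈ Q.X) :
    fderiv ℝ Q.Φ z = (fderiv ℂ Q.Φ z).restrictScalars ℝ :=
  (Q.differentiableAt_Φ hz).fderiv_restrictScalars ℝ

theorem continuousAt_fderiv_Φ {z : Cn n} (hz : z ∈ closure Q.X) :
    ContinuousAt (fderiv ℝ Q.Φ) z :=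
  (Q.contDiffAt_Φ hz).continuousAt_fderiv (by simp)

/-- On X this is holomorphy; it passes to the closure by continuity of the real derivative of the
smooth extension. Thus the complex Jacobian makes sense at boundary points. -/
theorem fderiv_Φ_smul {z : Cn n} (hz : z ∈ closure Q.X) (c : ℂ) (v : Cn n) :
    fderiv ℝ Q.Φ z (c • v) = c • fderiv ℝ Q.Φ z v := by
  have hcl : ContinuousWithinAt (fun z => fderiv ℝ Q.Φ z (c • v) - c • fderiv ℝ Q.Φ z v) Q.X z := by
    have h := (Q.continuousAt_fderiv_Φ hz).continuousWithinAt (s := Q.X)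
    exact (h.clm_apply continuousWithinAt_const).sub
      ((h.clm_apply continuousWithinAt_const).const_smul c)
  have hmem := hcl.mem_closure (t := {0}) hz fun y hy => by
    simp [Q.fderiv_real_Φ hy]
  simpa [sub_eq_zero] using hmem

/-- The complex Jacobian determinant of `Φ`. -/
noncomputable def jac (z : Cn n) : ℂ := (complexMatrix (fderiv ℝ Q.Φ z)).det

theorem continuousAt_jac {z : Cn n} (hz : z ∈ closure Q.X) : ContinuousAt Q.jac z :=
  ContinuousAt.comp (g := fun L => (complexMatrix L).det)
    (continuous_complexMatrix.matrix_det).continuousAt (Q.continuousAt_fderiv_Φ hz)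

theorem jac_eq_det {z : Cn n} (hz : z ∈ Q.X) : Q.jac z = (fderiv ℂ Q.Φ z).det := by
  rw [jac, Q.fderiv_real_Φ hz, complexMatrix_det_restrictScalars]

theorem differentiableOn_jac : DifferentiableOn ℂ Q.jac Q.X := by
  have hcomp : ∀ j k, DifferentiableOn ℂ
      (fun z => complexMatrix (fderiv ℝ Q.Φ z) j k) Q.X := by
    intro j k
    have hΦj : DifferentiableOn ℂ (fun z => Q.Φ z j) Q.X := fun z hz =>
      ((EuclideanSpace.proj (𝕜 := ℂ) j).differentiableAt.comp z
        (Q.differentiableAt_Φ hz)).differentiableWithinAt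
    refine (hΦj.fderiv_apply_of_isOpen Q.isOpen_X (EuclideanSpace.single k 1)).congr fun z hz => ?_
    have hd := ((EuclideanSpace.proj (𝕜 := ℂ) j).hasFDerivAt.comp z
        (Q.differentiableAt_Φ hz).hasFDerivAt)
    rw [show (fun z => Q.Φ z j) = (EuclideanSpace.proj (𝕜 := ℂ) j) ∘ Q.Φ from rfl, hd.fderiv]
    simp [complexMatrix, Q.fderiv_real_Φ hz]
  have : Q.jac = fun z => ∑ σ : Equiv.Perm (Fin n), Equiv.Perm.sign σ •
      ∏ i, complexMatrix (fderiv ℝ Q.Φ z) (σ i) i := by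
    funext z
    rw [jac, Matrix.det_apply]
  rw [this]
  refine DifferentiableOn.fun_sum fun σ _ => ?_
  refine DifferentiableOn.const_smul ?_ _
  have hprod : ∀ s : Finset (Fin n), DifferentiableOn ℂ
      (fun z => ∏ i ∈ s, complexMatrix (fderiv ℝ Q.Φ z) (σ i) i) Q.X := by
    intro s
    induction s using Finset.induction_on with
    | empty => simp
    | insert a s ha ih =>
      simp only [Finset.prod_insert ha]
      exact (hcomp _ _).mul ih
  exact hprod _

/-- The determinant on unitary maps, as a homomorphism. -/
noncomputable def detHom : (Cn n ≃ₗᵢ[ℂ] Cn n) →* ℂ where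
  toFun τ := LinearMap.det (τ.toLinearEquiv : Cn n →ₗ[ℂ] Cn n)
  map_one' := LinearMap.det_id
  map_mul' σ τ := by
    rw [← LinearMap.det_comp]
    rfl

/-- The chain rule for Φ ∘ τ = Φ gives jac z = jac (τ z) · det τ, and det τ is a |G|-th root of
unity. -/
theorem jac_pow_card {τ : Cn n ≃ₗᵢ[ℂ] Cn n} (hτ : τ ∈ Q.G) {z : Cn n} (hz : z ∈ Q.X) :
    Q.jac (τ z) ^ Nat.card Q.G = Q.jac z ^ Nat.card Q.G := by
  have hτz := Q.invariant_X τ hτ z hz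
  have h1 : fderiv ℂ Q.Φ z = (fderiv ℂ Q.Φ (τ z)).comp (τ.toContinuousLinearEquiv : Cn n →L[ℂ] Cn n) := by
    have hev : Q.Φ =ᶠ[𝓝 z] Q.Φ ∘ τ := by
      filter_upwards [Q.isOpen_X.mem_nhds hz] with y hy
      exact (Q.Φ_apply hτ hy).symm
    rw [hev.fderiv_eq]
    exact ((Q.differentiableAt_Φ hτz).hasFDerivAt.comp z
      (τ.toContinuousLinearEquiv : Cn n →L[ℂ] Cn n).hasFDerivAt).fderiv
  have h2 : Q.jac z = Q.jac (τ z) * detHom τ := by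
    rw [Q.jac_eq_det hz, Q.jac_eq_det hτz, h1, ContinuousLinearMap.det, ContinuousLinearMap.det,
      detHom]
    exact LinearMap.det_comp _ _
  have h3 : τ ^ Nat.card Q.G = 1 := by
    have := pow_card_eq_one' (x := (⟨τ, hτ⟩ : Q.G))
    rw [Subtype.ext_iff] at this
    exact this
  rw [h2, mul_pow, ← map_pow, h3, map_one, mul_one]

theorem card_pos : 0 < Nat.card Q.G := by
  have := Q.finite_G
  exact Nat.card_pos

theorem norm_jac_apply {τ : Cn n ≃ₗᵢ[ℂ] Cn n} (hτ : τ ∈ Q.G) {z : Cn n} (hz : z ∈ Q.X) :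
    ‖Q.jac (τ z)‖ = ‖Q.jac z‖ := by
  have := congrArg norm (Q.jac_pow_card hτ hz)
  rw [norm_pow, norm_pow] at this
  exact (pow_left_inj₀ (norm_nonneg _) (norm_nonneg _) Q.card_pos.ne').mp this

/-- `Φ` is an open map on `X`. -/
theorem image_mem_nhds {z : Cn n} (hz : z ∈ Q.X) {V : Set (Cn n)} (hV : V ∈ 𝓝 z) :
    Q.Φ '' V ∈ 𝓝 (Q.Φ z) := by
  obtain ⟨V', hV', hopen, hzV⟩ := mem_nhds_iff.mp (inter_mem hV (Q.isOpen_X.mem_nhds hz))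
  obtain ⟨ρ, hρ, hball⟩ := Metric.nhds_basis_closedBall.mem_iff.mp
    (Q.isOpen_Ω.mem_nhds (Q.Φ_mem hz))
  set W : Set (Cn n) := ⋃ τ ∈ Q.G, τ ⁻¹' V' with hW
  have hWo : IsOpen W := isOpen_biUnion fun τ _ => hopen.preimage τ.continuous
  -- W is the saturation of V' under G. By properness, what lies outside W over a closed ball is
  -- compact, and its image misses Φ z because the fibre of z is an orbit. Values near Φ z are
  -- therefore attained in W, and G moves the preimages into V'.
  have hC := (Q.proper_Φ _ hball (isCompact_closedBall _ _)).diff hWo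
  have himg : IsCompact (Q.Φ '' ((Q.X ∩ Q.Φ ⁻¹' Metric.closedBall (Q.Φ z) ρ) \ W)) :=
    hC.image_of_continuousOn (Q.holomorphic_Φ.continuousOn.mono fun y hy => hy.1.1)
  have hnot : Q.Φ z ∉ Q.Φ '' ((Q.X ∩ Q.Φ ⁻¹' Metric.closedBall (Q.Φ z) ρ) \ W) := by
    rintro ⟨y, ⟨⟨hyX, -⟩, hyW⟩, hy⟩
    obtain ⟨τ, hτ, h⟩ := (Q.fibre_X y hyX z hz).mp hy.symm
    exact hyW (mem_biUnion hτ (by rwa [mem_preimage, h]))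
  filter_upwards [himg.isClosed.isOpen_compl.mem_nhds hnot, Metric.closedBall_mem_nhds _ hρ]
    with w hw hwb
  obtain ⟨y, hy, rfl⟩ := Q.exists_Φ_eq (hball hwb)
  have hyW : y ∈ W := by
    by_contra h
    exact hw ⟨y, ⟨⟨hy, hwb⟩, h⟩, rfl⟩
  obtain ⟨τ, hτ, hyτ⟩ := mem_iUnion₂.mp hyW
  exact ⟨τ y, (hV' hyτ).1, Q.Φ_apply hτ hy⟩

/-- The Jacobian of `Φ` does not vanish identically on any open set. -/
theorem exists_jac_ne_zero {V : Set (Cn n)} (hVX : V ⊆ Q.X) (hV : IsOpen V) (hne : V.Nonempty) :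
    ∃ z ∈ V, Q.jac z ≠ 0 := by
  by_contra! h
  obtain ⟨z, hz⟩ := hne
  -- Sard's theorem; it contradicts the openness of Φ.
  have himg : Measure.addHaar (Q.Φ '' V) = 0 := by
    refine addHaar_image_eq_zero_of_det_fderivWithin_eq_zero _
      (f' := fun y => fderiv ℝ Q.Φ y) (fun y hy => ?_) fun y hy => ?_
    · exact (((Q.contDiffAt_Φ (subset_closure (hVX hy))).differentiableAt
        (by simp)).hasFDerivAt).hasFDerivWithinAt
    · exact det_eq_zero_of_complexMatrix_det_eq_zero
        (Q.fderiv_Φ_smul (subset_closure (hVX hy))) (h y hy)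
  exact (Measure.measure_pos_of_mem_nhds _ (Q.image_mem_nhds (hVX hz) (hV.mem_nhds hz))).ne' himg

/-- An open surjection is a quotient map. -/
theorem continuousOn_of_comp_Φ {Y : Type*} [TopologicalSpace Y] {f F : Cn n → Y}
    (hF : ContinuousOn F Q.X) (h : ∀ z ∈ Q.X, f (Q.Φ z) = F z) : ContinuousOn f Q.Ω := by
  intro w hw
  obtain ⟨z, hz, rfl⟩ := Q.exists_Φ_eq hw
  refine ContinuousAt.continuousWithinAt fun N hN => ?_
  rw [h z hz] at hN
  have hX := Q.isOpen_X.mem_nhds hz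
  rw [mem_map]
  refine mem_of_superset (Q.image_mem_nhds hz (inter_mem (hF.continuousAt hX hN) hX)) ?_
  rintro _ ⟨y, ⟨hyN, hy⟩, rfl⟩
  rw [mem_preimage, h y hy]
  exact hyN

/-- A function on `X` that is constant on the fibres of `Φ`, regarded as a function on `Ω`. -/
noncomputable def descend {Y : Type*} [Inhabited Y] (F : Cn n → Y) (w : Cn n) : Y :=
  open Classical in if h : ∃ z ∈ Q.X, Q.Φ z = w then F h.choose else default

theorem descend_Φ {Y : Type*} [Inhabited Y] {F : Cn n → Y}
    (hF : ∀ τ ∈ Q.G, ∀ z ∈ Q.X, F (τ z) = F z) {z : Cn n} (hz : z ∈ Q.X) :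
    Q.descend F (Q.Φ z) = F z := by
  have h : ∃ y ∈ Q.X, Q.Φ y = Q.Φ z := ⟨z, hz, rfl⟩
  rw [descend, dif_pos h]
  obtain ⟨τ, hτ, hy⟩ := (Q.fibre_X z hz _ h.choose_spec.1).mp h.choose_spec.2
  rw [← hy, hF τ hτ z hz]

end QuotientQuadruple

/-! ### Holomorphic descent across the critical values. -/

/-- A continuous function on a segment whose derivative is bounded by `C` off its zero set grows at
most linearly from a zero. -/
theorem norm_le_of_norm_deriv_le_off_zeros {f : ℝ → ℂ} {A : Set ℝ} {C : ℝ} (hC : 0 ≤ C)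
    (hf : ContinuousOn f (Icc 0 1)) (hA : IsClosed (A ∩ Icc 0 1)) (h0 : (0 : ℝ) ∈ A)
    (hfA : ∀ t ∈ A ∩ Icc 0 1, f t = 0)
    (hd : ∀ t ∈ Icc (0 : ℝ) 1, t ∉ A → ∃ f', HasDerivAt f f' t ∧ ‖f'‖ ≤ C) : ‖f 1‖ ≤ C := by
  have hcomp : IsCompact (A ∩ Icc (0 : ℝ) 1) := isCompact_Icc.of_isClosed_subset hA inter_subset_right
  -- After the last point s of A, the mean value inequality holds on every [t, 1] with t > s; then t
  -- tends to s, where f vanishes.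
  obtain ⟨s, ⟨hsA, hs⟩, hmax⟩ := hcomp.exists_isGreatest ⟨0, h0, by simp⟩
  rcases eq_or_lt_of_le hs.2 with rfl | hs1
  · rw [hfA _ ⟨hsA, hs⟩]
    simpa using hC
  have hne : ∀ t ∈ Ioc s 1, t ∉ A := fun t ht hA => by
    have := hmax ⟨hA, hs.1.trans ht.1.le, ht.2⟩
    exact absurd ht.1 (not_lt.mpr this)
  choose! f' hf' using hd
  have hmid : ∀ t ∈ Ioc s 1, ‖f 1 - f t‖ ≤ C := by
    intro t ht
    have ht0 : ∀ u ∈ Icc t 1, u ∈ Icc (0 : ℝ) 1 ∧ u ∉ A := fun u hu =>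
      ⟨⟨hs.1.trans (ht.1.le.trans hu.1), hu.2⟩, hne u ⟨ht.1.trans_le hu.1, hu.2⟩⟩
    have := norm_image_sub_le_of_norm_deriv_le_segment' (f := f) (f' := f') (C := C) (a := t) (b := 1)
      (fun u hu => ((hf' u (ht0 u hu).1 (ht0 u hu).2).1).hasDerivWithinAt)
      (fun u hu => (hf' u (ht0 u (Ico_subset_Icc_self hu)).1 (ht0 u (Ico_subset_Icc_self hu)).2).2)
      1 (by simp [ht.2])
    refine this.trans (mul_le_of_le_one_right hC ?_)
    linarith [hs.1, ht.1]
  have hlim : Tendsto (fun t => ‖f 1 - f t‖) (𝓝[Ioc s 1] s) (𝓝 ‖f 1 - f s‖) := by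
    have := (hf s hs).mono (Ioc_subset_Icc_self.trans (Icc_subset_Icc_left hs.1))
    exact (tendsto_const_nhds.sub this).norm
  have hneBot : (𝓝[Ioc s 1] s).NeBot := by
    rw [nhdsWithin_Ioc_eq_nhdsGT hs1]
    infer_instance
  have := le_of_tendsto hlim (eventually_mem_nhdsWithin.mono hmid)
  rwa [hfA s ⟨hsA, hs⟩, sub_zero] at this

namespace QuotientQuadruple

variable {n : ℕ} (Q : QuotientQuadruple n)

theorem hasStrictFDerivAt_Φ {z : Cn n} (hz : z ∈ Q.X) :
    HasStrictFDerivAt Q.Φ (fderiv ℂ Q.Φ z) z := by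
  have h := (Q.contDiffAt_Φ (subset_closure hz)).hasStrictFDerivAt (by simp)
  rw [Q.fderiv_real_Φ hz] at h
  exact HasStrictFDerivAt.of_isLittleO h.isLittleO

/-- A function on `Ω` is holomorphic at the regular values of `Φ` if its pull-back to `X` is. -/
theorem differentiableAt_of_comp_Φ {f F : Cn n → ℂ} (hF : DifferentiableOn ℂ F Q.X)
    (h : ∀ z ∈ Q.X, f (Q.Φ z) = F z) {z : Cn n} (hz : z ∈ Q.X) (hJ : Q.jac z ≠ 0) :
    DifferentiableAt ℂ f (Q.Φ z) := by
  have hinj : Function.Injective (fderiv ℂ Q.Φ z) := by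
    have := injective_of_complexMatrix_det_ne_zero (Q.fderiv_Φ_smul (subset_closure hz)) hJ
    rwa [Q.fderiv_real_Φ hz] at this
  set e : Cn n ≃L[ℂ] Cn n := (LinearEquiv.ofInjectiveEndo
    (fderiv ℂ Q.Φ z : Cn n →ₗ[ℂ] Cn n) hinj).toContinuousLinearEquiv with he
  have hs : HasStrictFDerivAt Q.Φ (e : Cn n →L[ℂ] Cn n) z := by
    have heq : (e : Cn n →L[ℂ] Cn n) = fderiv ℂ Q.Φ z := ContinuousLinearMap.ext fun v => rfl
    rw [heq]
    exact Q.hasStrictFDerivAt_Φ hz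
  have hloc := hs.to_localInverse.hasFDerivAt.differentiableAt
  have himg : hs.localInverse Q.Φ e z (Q.Φ z) = z := hs.localInverse_apply_image
  have hev : f =ᶠ[𝓝 (Q.Φ z)] F ∘ hs.localInverse Q.Φ e z := by
    filter_upwards [hs.eventually_right_inverse,
      hs.localInverse_tendsto (Q.isOpen_X.mem_nhds hz)] with w hw hwX
    conv_lhs => rw [← hw]
    exact h _ hwX
  refine DifferentiableAt.congr_of_eventuallyEq ?_ hev
  refine DifferentiableAt.comp _ ?_ hloc
  rw [himg]
  exact hF.differentiableAt (Q.isOpen_X.mem_nhds hz)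

/-- A function on `Ω` whose pull-back to `X` is a holomorphic function multiplied by the cube of the
Jacobian is holomorphic. -/
theorem differentiableOn_of_comp_Φ_eq_mul_jac {k H : Cn n → ℂ} (hH : DifferentiableOn ℂ H Q.X)
    (hk : ∀ z ∈ Q.X, k (Q.Φ z) = H z * Q.jac z ^ 3) : DifferentiableOn ℂ k Q.Ω := by
  have hJd := Q.differentiableOn_jac
  have hHJ : DifferentiableOn ℂ (fun z => H z * Q.jac z ^ 3) Q.X := hH.mul (hJd.pow 3)
  have hkc : ContinuousOn k Q.Ω := Q.continuousOn_of_comp_Φ hHJ.continuousOn hk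
  intro a ha
  obtain ⟨z₀, hz₀, rfl⟩ := Q.exists_Φ_eq ha
  refine DifferentiableAt.differentiableWithinAt ?_
  by_cases hJ₀ : Q.jac z₀ ≠ 0
  · exact Q.differentiableAt_of_comp_Φ hHJ hk hz₀ hJ₀
  rw [not_not] at hJ₀
  set a := Q.Φ z₀ with hadef
  obtain ⟨ρ, hρ, hball⟩ := Metric.nhds_basis_closedBall.mem_iff.mp (Q.isOpen_Ω.mem_nhds ha)
  set C := Q.X ∩ Q.Φ ⁻¹' Metric.closedBall a ρ with hCdef
  have hC : IsCompact C := Q.proper_Φ _ hball (isCompact_closedBall _ _)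
  have hfd : ∀ {F : Cn n → ℂ}, DifferentiableOn ℂ F Q.X → ContinuousOn (fderiv ℂ F) Q.X := by
    intro F hF
    rw [continuousOn_clm_apply]
    exact fun v => (hF.fderiv_apply_of_isOpen Q.isOpen_X v).continuousOn
  set adj : Cn n → (Cn n →L[ℂ] Cn n) := fun z =>
    Matrix.toEuclideanCLM (𝕜 := ℂ) (complexMatrix (fderiv ℝ Q.Φ z)).adjugate with hadj
  have hadjc : ContinuousOn adj Q.X := by
    have h1 : Continuous fun M : Matrix (Fin n) (Fin n) ℂ =>
        (Matrix.toEuclideanCLM (𝕜 := ℂ) M : Cn n →L[ℂ] Cn n) :=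
      LinearMap.continuous_of_finiteDimensional
        ((Matrix.toEuclideanCLM (n := Fin n) (𝕜 := ℂ)).toAlgEquiv.toLinearMap)
    intro z hz
    refine ContinuousAt.continuousWithinAt ?_
    exact ContinuousAt.comp (g := fun L => (Matrix.toEuclideanCLM (𝕜 := ℂ)
      (complexMatrix L).adjugate : Cn n →L[ℂ] Cn n))
      (h1.comp continuous_complexMatrix.matrix_adjugate).continuousAt
      (Q.continuousAt_fderiv_Φ (subset_closure hz))
  obtain ⟨B, hB⟩ := hC.exists_bound_of_continuousOn (f := fun z =>
    (‖Q.jac z‖ * ‖fderiv ℂ H z‖ + 3 * ‖H z‖ * ‖fderiv ℂ Q.jac z‖) * ‖adj z‖) (by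
      have h1 := hJd.continuousOn.norm
      have h2 := (hfd hH).norm
      have h3 := hH.continuousOn.norm
      have h4 := (hfd hJd).norm
      have h5 := hadjc.norm
      exact ((((h1.mul h2).add ((continuousOn_const.mul h3).mul h4))).mul h5).mono inter_subset_left)
  -- Only the modulus of the Jacobian descends: the Jacobian itself is invariant up to roots of
  -- unity.
  set J' := Q.descend (fun z => ‖Q.jac z‖) with hJ'
  have hJ'Φ : ∀ z ∈ Q.X, J' (Q.Φ z) = ‖Q.jac z‖ := fun z hz =>
    Q.descend_Φ (fun τ hτ z hz => Q.norm_jac_apply hτ hz) hz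
  have hJ'c : ContinuousOn J' Q.Ω := Q.continuousOn_of_comp_Φ hJd.continuousOn.norm hJ'Φ
  have hB0 : 0 ≤ B := (norm_nonneg _).trans (hB z₀ ⟨hz₀, by simp [hadef, hρ.le]⟩)
  -- the derivative of `k` at regular values
  have hderiv : ∀ w ∈ Metric.closedBall a ρ, J' w ≠ 0 →
      DifferentiableAt ℂ k w ∧ ‖fderiv ℂ k w‖ ≤ B * J' w := by
    intro w hw hw0
    obtain ⟨z, hz, rfl⟩ := Q.exists_Φ_eq (hball hw)
    rw [hJ'Φ z hz] at hw0 ⊢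
    have hJz : Q.jac z ≠ 0 := norm_ne_zero_iff.mp hw0
    have hkd := Q.differentiableAt_of_comp_Φ hHJ hk hz hJz
    refine ⟨hkd, ContinuousLinearMap.opNorm_le_bound _ (by positivity) fun v => ?_⟩
    have hX := Q.isOpen_X.mem_nhds hz
    have hchain : (fderiv ℂ k (Q.Φ z)).comp (fderiv ℂ Q.Φ z)
        = H z • (3 * Q.jac z ^ 2) • fderiv ℂ Q.jac z + Q.jac z ^ 3 • fderiv ℂ H z := by
      have h1 := hkd.hasFDerivAt.comp z (Q.differentiableAt_Φ hz).hasFDerivAt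
      have h2 := (hH.differentiableAt hX).hasFDerivAt.mul
        ((hJd.differentiableAt hX).hasFDerivAt.pow 3)
      have hev : k ∘ Q.Φ =ᶠ[𝓝 z] fun z => H z * Q.jac z ^ 3 := by
        filter_upwards [hX] with y hy using hk y hy
      have := (h2.congr_of_eventuallyEq hev).unique h1
      rw [← this]
      simp
    have hadjv := apply_adjugate_complexMatrix (Q.fderiv_Φ_smul (subset_closure hz)) v
    have h3 : Q.jac z * fderiv ℂ k (Q.Φ z) v
        = H z * (3 * Q.jac z ^ 2 * fderiv ℂ Q.jac z (adj z v))
          + Q.jac z ^ 3 * fderiv ℂ H z (adj z v) := by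
      have h4 := congrArg (fun L => L (adj z v)) hchain
      simp only [ContinuousLinearMap.comp_apply, _root_.add_apply,
        _root_.smul_apply, smul_eq_mul] at h4
      rw [← h4]
      have h5 : fderiv ℂ Q.Φ z (adj z v) = Q.jac z • v := by
        rw [jac, ← hadjv, Q.fderiv_real_Φ hz]
        simp [hadj, Q.fderiv_real_Φ hz]
      rw [h5, map_smul, smul_eq_mul]
    -- This is why the cube is used: differentiating it leaves two factors of the Jacobian,
    -- inverting the derivative of Φ costs one, and the remaining one makes the derivative of k tend
    -- to zero at critical values.
    have h6 : fderiv ℂ k (Q.Φ z) v = Q.jac z * (3 * H z * fderiv ℂ Q.jac z (adj z v)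
          + Q.jac z * fderiv ℂ H z (adj z v)) := by
      apply mul_left_cancel₀ hJz
      rw [h3]; ring
    have h7 : ‖fderiv ℂ Q.jac z (adj z v)‖ ≤ ‖fderiv ℂ Q.jac z‖ * (‖adj z‖ * ‖v‖) :=
      ContinuousLinearMap.le_opNorm_of_le _ ((adj z).le_opNorm v)
    have h8 : ‖fderiv ℂ H z (adj z v)‖ ≤ ‖fderiv ℂ H z‖ * (‖adj z‖ * ‖v‖) :=
      ContinuousLinearMap.le_opNorm_of_le _ ((adj z).le_opNorm v)
    have h9 := hB z ⟨hz, hw⟩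
    rw [Real.norm_of_nonneg (by positivity)] at h9
    rw [h6, norm_mul]
    calc ‖Q.jac z‖ * ‖3 * H z * fderiv ℂ Q.jac z (adj z v)
          + Q.jac z * fderiv ℂ H z (adj z v)‖
        ≤ ‖Q.jac z‖ * (3 * ‖H z‖ * (‖fderiv ℂ Q.jac z‖ * (‖adj z‖ * ‖v‖))
          + ‖Q.jac z‖ * (‖fderiv ℂ H z‖ * (‖adj z‖ * ‖v‖))) := by
          gcongr
          refine (norm_add_le _ _).trans ?_
          rw [norm_mul, norm_mul, norm_mul]
          simp only [Complex.norm_ofNat]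
          gcongr
      _ = ‖Q.jac z‖ * (((‖Q.jac z‖ * ‖fderiv ℂ H z‖ + 3 * ‖H z‖ * ‖fderiv ℂ Q.jac z‖)
          * ‖adj z‖) * ‖v‖) := by ring
      _ ≤ ‖Q.jac z‖ * (B * ‖v‖) := by gcongr
      _ = B * ‖Q.jac z‖ * ‖v‖ := by ring
  have hk0 : ∀ w ∈ Q.Ω, J' w = 0 → k w = 0 := by
    intro w hw h0
    obtain ⟨z, hz, rfl⟩ := Q.exists_Φ_eq hw
    rw [hJ'Φ z hz, norm_eq_zero] at h0
    rw [hk z hz, h0]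
    simp
  have hJ'a : J' a = 0 := by rw [hadef, hJ'Φ z₀ hz₀, hJ₀, norm_zero]
  refine HasFDerivAt.differentiableAt (f' := 0) ?_
  rw [hasFDerivAt_iff_isLittleO_nhds_zero, Asymptotics.isLittleO_iff]
  intro ε hε
  have hsmall : ∀ᶠ w in 𝓝 a, B * J' w ≤ ε := by
    have hcont : ContinuousAt (fun w => B * J' w) a :=
      continuousAt_const.mul (hJ'c.continuousAt (Q.isOpen_Ω.mem_nhds ha))
    have h0 : B * J' a < ε := by rw [hJ'a, mul_zero]; exact hε
    exact (hcont.eventually_lt_const h0).mono fun w hw => hw.le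
  obtain ⟨δ, hδ, hδs⟩ := Metric.eventually_nhds_iff_ball.mp hsmall
  filter_upwards [Metric.ball_mem_nhds (0 : Cn n) (lt_min hδ hρ)] with v hv
  rw [mem_ball_zero_iff] at hv
  have hseg : ∀ t ∈ Icc (0 : ℝ) 1, a + (t : ℂ) • v ∈ Metric.ball a δ ∩ Metric.closedBall a ρ := by
    intro t ht
    have : ‖(t : ℂ) • v‖ ≤ ‖v‖ := by
      rw [norm_smul, Complex.norm_real, Real.norm_of_nonneg ht.1]
      exact mul_le_of_le_one_left (norm_nonneg _) ht.2
    constructor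
    · rw [mem_ball_iff_norm, add_sub_cancel_left]
      exact this.trans_lt (hv.trans_le (min_le_left _ _))
    · rw [mem_closedBall_iff_norm, add_sub_cancel_left]
      exact this.trans (hv.trans_le (min_le_right _ _)).le
  have hsegΩ : ∀ t ∈ Icc (0 : ℝ) 1, a + (t : ℂ) • v ∈ Q.Ω := fun t ht => hball (hseg t ht).2
  -- On the segment from a to a + v, k vanishes at critical values and has derivative at most ε ‖v‖
  -- elsewhere. So |k(a + v)| ≤ ε ‖v‖, that is, k has derivative 0 at a.
  have hmain := norm_le_of_norm_deriv_le_off_zeros (f := fun t : ℝ => k (a + (t : ℂ) • v))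
    (A := {t | J' (a + (t : ℂ) • v) = 0}) (C := ε * ‖v‖) (by positivity) ?_ ?_ ?_ ?_ ?_
  · have hka : k a = 0 := hk0 a ha hJ'a
    simpa [hka] using hmain
  · exact hkc.comp (by fun_prop) hsegΩ
  · have : ContinuousOn (fun t : ℝ => J' (a + (t : ℂ) • v)) (Icc 0 1) :=
      hJ'c.comp (by fun_prop) hsegΩ
    have h1 := this.preimage_isClosed_of_isClosed isClosed_Icc (isClosed_singleton (x := (0 : ℝ)))
    rw [inter_comm]
    exact h1
  · simpa using hJ'a
  · exact fun t ht => hk0 _ (hsegΩ t ht.2) ht.1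
  · intro t ht htA
    obtain ⟨hd, hb⟩ := hderiv _ (hseg t ht).2 htA
    refine ⟨fderiv ℂ k (a + (t : ℂ) • v) v, ?_, ?_⟩
    · have hl : HasDerivAt (fun t : ℝ => a + (t : ℂ) • v) v t := by
        have := ((Complex.ofRealCLM.hasDerivAt (x := t)).smul_const v).const_add a
        simpa using this
      exact (hd.hasFDerivAt.restrictScalars ℝ).comp_hasDerivAt t hl
    · refine (ContinuousLinearMap.le_opNorm _ _).trans ?_
      gcongr
      exact hb.trans (hδs _ (hseg t ht).1)

/-- Every `G`-invariant holomorphic function on `X` descends to a holomorphic function on `Ω`. -/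
theorem differentiableOn_descend {F : Cn n → ℂ} (hF : DifferentiableOn ℂ F Q.X)
    (hinv : ∀ τ ∈ Q.G, ∀ z ∈ Q.X, F (τ z) = F z) : DifferentiableOn ℂ (Q.descend F) Q.Ω := by
  have hf : ∀ z ∈ Q.X, Q.descend F (Q.Φ z) = F z := fun z hz => Q.descend_Φ hinv hz
  have hJd := Q.differentiableOn_jac
  set N := Nat.card Q.G with hN
  have hN1 : 3 ≤ 3 * N := by have := Q.card_pos; omega
  -- The factor N makes the power invariant under G, and the factor 3 leaves a cube to split off.
  set e := Q.descend (fun z => Q.jac z ^ (3 * N)) with he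
  have heΦ : ∀ z ∈ Q.X, e (Q.Φ z) = Q.jac z ^ (3 * N) := fun z hz =>
    Q.descend_Φ (fun τ hτ z hz => by
      rw [mul_comm 3 N, pow_mul, pow_mul, Q.jac_pow_card hτ hz]) hz
  have hed : DifferentiableOn ℂ e Q.Ω := by
    refine Q.differentiableOn_of_comp_Φ_eq_mul_jac (H := fun z => Q.jac z ^ (3 * N - 3))
      (hJd.pow _) fun z hz => ?_
    rw [heΦ z hz, ← pow_add, Nat.sub_add_cancel hN1]
  refine (Q.continuousOn_of_comp_Φ hF.continuousOn hf).differentiableOn_of_off_zeros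
    Q.isOpen_Ω hed (fun w hw hew => ?_) fun V hVΩ hV hne => ?_
  · obtain ⟨z, hz, rfl⟩ := Q.exists_Φ_eq hw
    rw [heΦ z hz] at hew
    exact Q.differentiableAt_of_comp_Φ hF hf hz fun h0 => hew (by
      rw [h0, zero_pow (by have := Q.card_pos; omega)])
  · obtain ⟨w, hw⟩ := hne
    obtain ⟨z, hz, rfl⟩ := Q.exists_Φ_eq (hVΩ hw)
    obtain ⟨y, hy, hJy⟩ := Q.exists_jac_ne_zero (V := Q.X ∩ Q.Φ ⁻¹' V) inter_subset_left
      (Q.holomorphic_Φ.continuousOn.isOpen_inter_preimage Q.isOpen_X hV) ⟨z, hz, hw⟩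
    exact ⟨Q.Φ y, hy.2, by rw [heΦ y hy.1]; exact pow_ne_zero _ hJy⟩

end QuotientQuadruple

/-! ### Hausdorff measure of Lipschitz images. -/

section HausdorffMeasure

open Measure

variable {E F : Type*} [EMetricSpace E] [MeasurableSpace E] [BorelSpace E]
  [EMetricSpace F] [MeasurableSpace F] [BorelSpace F]

theorem LipschitzOnWith.euclideanHausdorffMeasure_image_le {K : ℝ≥0} {f : E → F} {s : Set E}
    (h : LipschitzOnWith K f s) (d : ℕ) : μHE[d] (f '' s) ≤ (K : ℝ≥0∞) ^ d * μHE[d] s := by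
  simp only [euclideanHausdorffMeasure_def, Measure.smul_apply, ENNReal.smul_def, smul_eq_mul]
  rw [mul_left_comm]
  gcongr
  simpa using h.hausdorffMeasure_image_le (d := (d : ℝ)) (by positivity)

/-- A locally Lipschitz image of a compact set of finite Hausdorff measure has finite measure. -/
theorem IsCompact.euclideanHausdorffMeasure_image_lt_top {d : ℕ} {f : E → F} {s : Set E}
    (hs : IsCompact s) (hf : ∀ x ∈ s, ∃ K : ℝ≥0, ∃ t ∈ 𝓝 x, LipschitzOnWith K f t)
    (hfin : μHE[d] s < ⊤) : μHE[d] (f '' s) < ⊤ := by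
  choose! K t ht hK using hf
  obtain ⟨u, hu, hsu⟩ := hs.elim_nhds_subcover t ht
  refine (measure_mono (t := ⋃ x ∈ u, f '' (s ∩ t x)) ?_).trans_lt ?_
  · rintro _ ⟨x, hx, rfl⟩
    obtain ⟨y, hy, hxy⟩ := mem_iUnion₂.mp (hsu hx)
    exact mem_biUnion hy ⟨x, ⟨hx, hxy⟩, rfl⟩
  · refine (measure_biUnion_finset_le _ _).trans_lt (ENNReal.sum_lt_top.mpr fun x hx => ?_)
    refine (((hK x (hu x hx)).mono inter_subset_right).euclideanHausdorffMeasure_image_le d).trans_lt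
      (ENNReal.mul_lt_top (by finiteness) ?_)
    exact (measure_mono inter_subset_left).trans_lt hfin

end HausdorffMeasure

/-! ### Hausdorff measure of hypersurfaces, tori and coordinate hyperplanes. -/

section Hypersurface

open Measure

/-- The zero set of a function that is strictly differentiable with non-zero differential at a point
has finite codimension one Hausdorff measure near this point. -/
theorem exists_nhds_euclideanHausdorffMeasure_zeros_lt_top {E : Type*} [NormedAddCommGroup E]
    [NormedSpace ℝ E] [FiniteDimensional ℝ E] [MeasurableSpace E] [BorelSpace E]
    {ρ : E → ℝ} {L : E →L[ℝ] ℝ} {q : E} (hρ : HasStrictFDerivAt ρ L q) (hL : L ≠ 0)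
    (hq : ρ q = 0) :
    ∃ V ∈ 𝓝 q, μHE[Module.finrank ℝ E - 1] (V ∩ {x | ρ x = 0}) < ⊤ := by
  have hsurj : L.range = ⊤ := LinearMap.range_eq_top.mpr (LinearMap.surjective (by
    intro h; exact hL (by ext x; exact congrArg (fun l : E →ₗ[ℝ] ℝ => l x) h)))
  have hrank : Module.finrank ℝ L.ker = Module.finrank ℝ E - 1 := by
    have h1 := LinearMap.finrank_range_add_finrank_ker (L : E →ₗ[ℝ] ℝ)
    have h2 : Module.finrank ℝ (LinearMap.range (L : E →ₗ[ℝ] ℝ)) = 1 := by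
      rw [show LinearMap.range (L : E →ₗ[ℝ] ℝ) = ⊤ from hsurj]
      simp
    have h3 : Module.finrank ℝ L.ker = Module.finrank ℝ (LinearMap.ker (L : E →ₗ[ℝ] ℝ)) := rfl
    omega
  have := FiniteDimensional.complete ℝ E
  -- The implicit function parametrises the zero set near q by the kernel of L. Strict
  -- differentiability makes it Lipschitz near 0, so a small ball has an image of finite measure.
  set ψ := hρ.implicitFunction ρ L hsurj (ρ q) with hψ
  obtain ⟨K, t, ht, hK⟩ := (hρ.to_implicitFunction hsurj).exists_lipschitzOnWith
  obtain ⟨ε, hε, hball⟩ := Metric.nhds_basis_closedBall.mem_iff.mp ht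
  have hφ : Tendsto (fun x => (hρ.implicitToOpenPartialHomeomorph ρ L hsurj x).2) (𝓝 q) (𝓝 0) := by
    have h1 := (hρ.implicitToOpenPartialHomeomorph ρ L hsurj).continuousAt
      (hρ.mem_implicitToOpenPartialHomeomorph_source hsurj)
    have h2 := continuous_snd.continuousAt.tendsto.comp h1.tendsto
    rw [hρ.implicitToOpenPartialHomeomorph_self hsurj] at h2
    exact h2
  refine ⟨_, inter_mem (hρ.eq_implicitFunction hsurj)
    (hφ (Metric.closedBall_mem_nhds 0 hε)), ?_⟩
  refine (measure_mono (t := ψ '' Metric.closedBall 0 ε) ?_).trans_lt ?_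
  · rintro x ⟨⟨hx1, hx2⟩, hx3⟩
    refine ⟨_, hx2, ?_⟩
    have hx1' : hρ.implicitFunction ρ L hsurj (ρ x)
      (hρ.implicitToOpenPartialHomeomorph ρ L hsurj x).2 = x := hx1
    have hx3' : ρ x = 0 := hx3
    rwa [hx3', ← hq] at hx1'
  · refine ((hK.mono hball).euclideanHausdorffMeasure_image_le _).trans_lt
      (ENNReal.mul_lt_top (by finiteness) ?_)
    rw [← hrank]
    exact (isCompact_closedBall _ _).measure_lt_top

/-- The torus is covered by the image of the cube [-π, π]ⁿ under the smooth map θ ↦ (exp(i θ_j)). -/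
theorem euclideanHausdorffMeasure_torus_lt_top (n : ℕ) : μHE[n] (unitTorus n) < ⊤ := by
  set f : EuclideanSpace ℝ (Fin n) → Cn n := fun θ =>
    WithLp.toLp 2 fun j => Complex.exp (θ j * Complex.I) with hf
  set s : Set (EuclideanSpace ℝ (Fin n)) :=
    WithLp.toLp 2 '' (univ.pi fun _ : Fin n => Icc (-Real.pi) Real.pi) with hs
  have hscomp : IsCompact s :=
    (isCompact_univ_pi fun _ => isCompact_Icc).image (PiLp.continuous_toLp 2 _)
  have hfs : unitTorus n ⊆ f '' s := by
    intro z hz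
    refine ⟨WithLp.toLp 2 fun j => (z j).arg, ⟨_, fun j _ => ?_, rfl⟩, ?_⟩
    · exact ⟨(Complex.neg_pi_lt_arg _).le, Complex.arg_le_pi _⟩
    · ext j
      have := Complex.norm_mul_exp_arg_mul_I (z j)
      rw [hz j] at this
      simpa [hf] using this
  have hsm : ContDiff ℝ 1 f := by
    refine (contDiff_piLp 2).mpr fun j => ?_
    change ContDiff ℝ 1 fun θ : EuclideanSpace ℝ (Fin n) => Complex.exp (θ j * Complex.I)
    have : ContDiff ℝ 1 fun θ : EuclideanSpace ℝ (Fin n) => (θ j : ℂ) :=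
      Complex.ofRealCLM.contDiff.comp (EuclideanSpace.proj (𝕜 := ℝ) j).contDiff
    fun_prop
  refine (measure_mono hfs).trans_lt (hscomp.euclideanHausdorffMeasure_image_lt_top
    (fun x _ => hsm.contDiffAt.exists_lipschitzOnWith) ?_)
  rw [EuclideanSpace.euclideanHausdorffMeasure_eq_volume]
  exact hscomp.measure_lt_top

theorem finrank_real_Cn (n : ℕ) : Module.finrank ℝ (Cn n) = 2 * n := by
  rw [finrank_real_of_complex, finrank_euclideanSpace_fin]

/-- Locally the boundary lies in the zero set of a defining function; compactness makes the local
bounds global. -/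
theorem euclideanHausdorffMeasure_frontier_lt_top {n : ℕ} {X : Set (Cn n)}
    (hXo : IsOpen X) (hXb : Bornology.IsBounded X)
    (hX : HasC2Boundary X) : μHE[2 * n - 1] (frontier X) < ⊤ := by
  have hcomp : IsCompact (frontier X) :=
    hXb.isCompact_closure.of_isClosed_subset isClosed_frontier frontier_subset_closure
  refine hcomp.measure_lt_top_of_nhdsWithin fun q hq => ?_
  obtain ⟨U, hU, hqU, ρ, hρ, hdρ, hXU⟩ := hX q hq
  have hzero : ∀ x ∈ frontier X ∩ U, ρ x = 0 := by
    rintro x ⟨hx, hxU⟩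
    apply le_antisymm
    · have hcl : x ∈ closure (X ∩ U) := by
        rw [mem_closure_iff_nhds]
        intro t ht
        obtain ⟨y, hy, hyX⟩ := mem_closure_iff_nhds.mp (frontier_subset_closure hx) _
          (inter_mem ht (hU.mem_nhds hxU))
        exact ⟨y, hy.1, hyX, hy.2⟩
      have hc : ContinuousWithinAt ρ (X ∩ U) x :=
        (hρ.continuousOn x hxU).mono inter_subset_right
      have := hc.mem_closure (t := Iic 0) hcl fun y hy => by
        rw [hXU] at hy
        exact hy.2.le
      simpa using this
    · by_contra! hneg
      have : x ∈ X ∩ U := by rw [hXU]; exact ⟨hxU, hneg⟩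
      rw [hXo.frontier_eq] at hx
      exact hx.2 this.1
  have hstrict := (hρ.contDiffAt (hU.mem_nhds hqU)).hasStrictFDerivAt (by simp)
  obtain ⟨V, hV, hfin⟩ := exists_nhds_euclideanHausdorffMeasure_zeros_lt_top hstrict hdρ
    (hzero q ⟨hq, hqU⟩)
  rw [finrank_real_Cn] at hfin
  refine ⟨frontier X ∩ (V ∩ U), inter_mem_nhdsWithin _ (inter_mem hV (hU.mem_nhds hqU)), ?_⟩
  refine (measure_mono ?_).trans_lt hfin
  exact fun x hx => ⟨hx.2.1, hzero x ⟨hx.1, hx.2.2⟩⟩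

/-- The hyperplane has real dimension 2n - 2. Boundary points with a zero coordinate, whose torus
orbits degenerate, are thereby negligible. -/
theorem euclideanHausdorffMeasure_coordinate_hyperplane {n : ℕ} (hn : 0 < n) (j : Fin n) :
    μHE[2 * n - 1] {z : Cn n | z j = 0} = 0 := by
  set S : Submodule ℂ (Cn n) := (EuclideanSpace.proj j : Cn n →L[ℂ] ℂ).ker with hS
  have hrank : Module.finrank ℝ S = 2 * n - 2 := by
    have h1 := LinearMap.finrank_range_add_finrank_ker
      ((EuclideanSpace.proj j : Cn n →L[ℂ] ℂ) : Cn n →ₗ[ℂ] ℂ)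
    have h2 : LinearMap.range ((EuclideanSpace.proj j : Cn n →L[ℂ] ℂ) : Cn n →ₗ[ℂ] ℂ) = ⊤ := by
      refine LinearMap.range_eq_top.mpr fun c => ⟨EuclideanSpace.single j c, by simp⟩
    rw [h2, finrank_top, Module.finrank_self, finrank_euclideanSpace_fin] at h1
    rw [finrank_real_of_complex]
    have h3 : Module.finrank ℂ S = Module.finrank ℂ (LinearMap.ker
      ((EuclideanSpace.proj j : Cn n →L[ℂ] ℂ) : Cn n →ₗ[ℂ] ℂ)) := rfl
    omega
  have hset : {z : Cn n | z j = 0} = (fun x : S => (x : Cn n)) '' univ := by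
    ext z
    simp [hS]
  have hiso : Isometry (fun x : S => (x : Cn n)) := isometry_subtype_coe
  have h0 : (μH[((2 * n - 1 : ℕ) : ℝ)] : Measure S) = 0 := by
    refine Real.hausdorffMeasure_of_finrank_lt ?_
    rw [hrank]
    norm_cast
    omega
  rw [hset, hiso.euclideanHausdorffMeasure_image, euclideanHausdorffMeasure_def,
    Measure.smul_apply, h0]
  simp

end Hypersurface

/-- The action of the torus on `ℂⁿ` by rotation of the coordinates. -/
noncomputable def coordinateRotation {n : ℕ} (θ : Fin n → ℝ) : Cn n ≃ₗᵢ[ℝ] Cn n :=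
  LinearIsometryEquiv.piLpCongrRight 2 fun j => rotation (Circle.exp (θ j))

theorem coordinateRotation_apply {n : ℕ} (θ : Fin n → ℝ) (z : Cn n) (j : Fin n) :
    coordinateRotation θ z j = circleMap 0 1 (θ j) * z j := by
  simp [coordinateRotation, circleMap]

theorem norm_coordinateRotation_apply {n : ℕ} (θ : Fin n → ℝ) (z : Cn n) (j : Fin n) :
    ‖coordinateRotation θ z j‖ = ‖z j‖ := by
  simp [coordinateRotation_apply]

/-! ### Measures on the boundary and positivity of the density. -/

namespace QuotientQuadruple

variable {n : ℕ} (Q : QuotientQuadruple n)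

theorem isBounded_X : Bornology.IsBounded Q.X := by
  rcases Q.model with ⟨hX, -⟩ | ⟨-, hX, -⟩
  · rw [hX]
    refine ((EuclideanSpace.equiv (Fin n) ℂ).antilipschitz.isBounded_preimage
      (Metric.isBounded_ball (x := (0 : Fin n → ℂ)) (r := 1))).subset fun z hz => ?_
    rw [mem_preimage, mem_ball_zero_iff, pi_norm_lt_iff one_pos]
    exact hz
  · exact hX

theorem mem_X_of_norm_le {z z' : Cn n} (hz : z ∈ Q.X) (h : ∀ j, ‖z' j‖ ≤ ‖z j‖) : z' ∈ Q.X := by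
  rcases Q.model with ⟨hX, -⟩ | ⟨hX, -⟩
  · rw [hX] at hz ⊢
    exact fun j => (h j).trans_lt (hz j)
  · exact hX.2.2 z hz z' h

theorem isClosed_Γ : IsClosed Q.Γ := by
  rcases Q.model with ⟨-, hΓ, -⟩ | ⟨-, -, -, hΓ, -⟩
  · have : Q.Γ = ⋂ j, {z : Cn n | ‖z j‖ = 1} := by
      rw [hΓ]; ext z; simp [unitTorus]
    rw [this]
    exact isClosed_iInter fun j => isClosed_eq (by fun_prop) continuous_const
  · rw [hΓ]; exact isClosed_frontier

theorem isCompact_Γ : IsCompact Q.Γ :=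
  Q.isBounded_X.isCompact_closure.of_isClosed_subset Q.isClosed_Γ Q.Γ_subset_closure

theorem coordinateRotation_mem_Γ_iff (θ : Fin n → ℝ) (z : Cn n) :
    coordinateRotation θ z ∈ Q.Γ ↔ z ∈ Q.Γ := by
  rcases Q.model with ⟨-, hΓ, -⟩ | ⟨hX, -, -, hΓ, -⟩
  · rw [hΓ]
    exact forall_congr' fun j => by rw [norm_coordinateRotation_apply]
  · have hpre : (coordinateRotation θ).toHomeomorph ⁻¹' Q.X = Q.X := by
      ext y
      exact ⟨fun hy => Q.mem_X_of_norm_le (z := coordinateRotation θ y) hy fun j =>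
          (norm_coordinateRotation_apply θ y j).ge,
        fun hy => Q.mem_X_of_norm_le hy fun j => (norm_coordinateRotation_apply θ y j).le⟩
    have := (coordinateRotation θ).toHomeomorph.preimage_frontier Q.X
    rw [hpre] at this
    rw [hΓ]
    conv_rhs => rw [← this]
    rfl

theorem mem_Γ_iff {τ : Cn n ≃ₗᵢ[ℂ] Cn n} (hτ : τ ∈ Q.G) (z : Cn n) : τ z ∈ Q.Γ ↔ z ∈ Q.Γ := by
  refine ⟨fun h => ?_, fun h => Q.invariant_Γ τ hτ z h⟩
  have := Q.invariant_Γ τ⁻¹ (Q.G.inv_mem hτ) _ h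
  rwa [show τ⁻¹ (τ z) = z from τ.symm_apply_apply z] at this

theorem measurePreserving_of_mem_Γ_iff (e : Cn n ≃ᵢ Cn n) (he : ∀ z, e z ∈ Q.Γ ↔ z ∈ Q.Γ) :
    MeasurePreserving e Q.σ Q.σ := by
  have h := (e.measurePreserving_euclideanHausdorffMeasure Q.d).restrict_preimage Q.measurableSet_Γ
  rwa [show e ⁻¹' Q.Γ = Q.Γ from Set.ext he] at h

theorem measurePreserving_G {τ : Cn n ≃ₗᵢ[ℂ] Cn n} (hτ : τ ∈ Q.G) :
    MeasurePreserving τ Q.σ Q.σ :=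
  Q.measurePreserving_of_mem_Γ_iff τ.toIsometryEquiv (Q.mem_Γ_iff hτ)

theorem measurePreserving_coordinateRotation (θ : Fin n → ℝ) :
    MeasurePreserving (coordinateRotation θ) Q.σ Q.σ :=
  Q.measurePreserving_of_mem_Γ_iff (coordinateRotation θ).toIsometryEquiv
    (Q.coordinateRotation_mem_Γ_iff θ)

theorem euclideanHausdorffMeasure_Γ_lt_top : μHE[Q.d] Q.Γ < ⊤ := by
  rcases Q.model with ⟨-, hΓ, hd⟩ | ⟨hX, hb, h2, hΓ, hd⟩
  · rw [hΓ, hd]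
    exact euclideanHausdorffMeasure_torus_lt_top n
  · rw [hΓ, hd]
    exact euclideanHausdorffMeasure_frontier_lt_top hX.1 hb h2

instance isFiniteMeasure_σ : IsFiniteMeasure Q.σ :=
  ⟨by rw [σ, inducedMeasure, Measure.restrict_apply_univ]
      exact Q.euclideanHausdorffMeasure_Γ_lt_top⟩

theorem continuousOn_Φ : ContinuousOn Q.Φ (closure Q.X) := fun _ hz =>
  (Q.contDiffAt_Φ hz).continuousAt.continuousWithinAt

theorem exists_lipschitzOnWith_Φ {z : Cn n} (hz : z ∈ closure Q.X) :
    ∃ K : ℝ≥0, ∃ t ∈ 𝓝 z, LipschitzOnWith K Q.Φ t :=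
  ((Q.contDiffAt_Φ hz).of_le (by simp)).exists_lipschitzOnWith

instance isFiniteMeasure_m : IsFiniteMeasure Q.m :=
  ⟨by rw [m, inducedMeasure, Measure.restrict_apply_univ]
      exact Q.isCompact_Γ.euclideanHausdorffMeasure_image_lt_top
        (fun z hz => Q.exists_lipschitzOnWith_Φ (Q.Γ_subset_closure hz))
        Q.euclideanHausdorffMeasure_Γ_lt_top⟩

theorem ae_mem_Γ : ∀ᵐ z ∂Q.σ, z ∈ Q.Γ := ae_restrict_mem Q.measurableSet_Γ

theorem ae_coord_ne_zero (hn : 0 < n) : ∀ᵐ z ∂Q.σ, ∀ j, z j ≠ 0 := by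
  rw [ae_all_iff]
  intro j
  rcases Q.model with ⟨-, hΓ, -⟩ | ⟨-, -, -, -, hd⟩
  · filter_upwards [Q.ae_mem_Γ] with z hz h0
    rw [hΓ] at hz
    have := hz j
    simp [h0] at this
  · rw [ae_iff]
    simp only [not_not]
    refine Measure.absolutelyContinuous_of_le Measure.restrict_le_self ?_
    rw [hd]
    exact euclideanHausdorffMeasure_coordinate_hyperplane hn j

/-- Multiplying the coordinates of a boundary point by a point of the open polydisc leads into `X`. -/
theorem toLp_mul_mem_X {z : Cn n} (hz : z ∈ Q.Γ) {ζ : Fin n → ℂ} (hζ : ζ ∈ Metric.ball 0 1) :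
    WithLp.toLp 2 (fun j => ζ j * z j) ∈ Q.X := by
  rw [mem_ball_zero_iff] at hζ
  have hc : max ‖ζ‖ (1 / 2) ∈ Ioo (0 : ℝ) 1 :=
    ⟨lt_max_of_lt_right (by norm_num), max_lt hζ (by norm_num)⟩
  refine Q.mem_X_of_norm_le (Q.smul_mem hz hc) fun j => ?_
  simp only [norm_mul, PiLp.smul_apply, smul_eq_mul, Complex.norm_real, Real.norm_of_nonneg hc.1.le]
  gcongr
  exact (norm_le_pi_norm ζ j).trans (le_max_left _ _)

/-- The map ζ ↦ (ζ_j z_j) takes the closed polydisc into the closure of X. By boundary uniqueness,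
zeros of positive measure on the torus would make the Jacobian vanish on the polydisc |y_j| < |z_j|,
which is open and non-empty since no z_j is zero. -/
theorem volume_zeros_jac_torus_eq_zero {z : Cn n} (hz : z ∈ Q.Γ) (hz0 : ∀ j, z j ≠ 0) :
    (Measure.pi fun _ : Fin n => volume.restrict (Ioc 0 (2 * Real.pi)))
      {θ : Fin n → ℝ | Q.jac (coordinateRotation θ z) = 0} = 0 := by
  by_contra hpos
  set T : (Fin n → ℂ) → Cn n := fun ζ => WithLp.toLp 2 fun j => ζ j * z j with hT
  have hTd : Differentiable ℂ T := by
    refine (differentiable_piLp 2).mpr fun j => ?_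
    change Differentiable ℂ fun ζ : Fin n → ℂ => ζ j * z j
    fun_prop
  have hmaps : MapsTo T (Metric.closedBall 0 1) (closure Q.X) := by
    rw [← closure_ball (0 : Fin n → ℂ) one_ne_zero]
    exact MapsTo.closure (fun ζ hζ => Q.toLp_mul_mem_X hz hζ) hTd.continuous
  have hk := eq_zero_of_volume_zeros_torus_ne_zero (k := Q.jac ∘ T)
    (ContinuousOn.comp (fun y hy => (Q.continuousAt_jac hy).continuousWithinAt)
      hTd.continuous.continuousOn hmaps)
    (Q.differentiableOn_jac.comp hTd.differentiableOn fun ζ hζ => Q.toLp_mul_mem_X hz hζ) (by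
      have heq : ∀ θ : Fin n → ℝ,
          T (fun j => circleMap 0 1 (θ j)) = coordinateRotation θ z := fun θ => by
        ext j
        simp [hT, coordinateRotation_apply]
      simpa only [Function.comp_apply, heq] using hpos)
  have hVo : IsOpen {y : Cn n | ∀ j, ‖y j‖ < ‖z j‖} := by
    rw [show {y : Cn n | ∀ j, ‖y j‖ < ‖z j‖} = ⋂ j, {y : Cn n | ‖y j‖ < ‖z j‖} by ext y; simp]
    exact isOpen_iInter_of_finite fun j => isOpen_lt (by fun_prop) continuous_const
  have hV : ∀ y : Cn n, (∀ j, ‖y j‖ < ‖z j‖) → ∃ ζ ∈ Metric.ball (0 : Fin n → ℂ) 1, T ζ = y := by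
    intro y hy
    refine ⟨fun j => y j / z j, ?_, ?_⟩
    · rw [mem_ball_zero_iff, pi_norm_lt_iff one_pos]
      intro j
      rw [norm_div, div_lt_one (norm_pos_iff.mpr (hz0 j))]
      exact hy j
    · ext j
      simp [hT, div_mul_cancel₀ _ (hz0 j)]
  obtain ⟨y, hy, hJ⟩ := Q.exists_jac_ne_zero (V := {y : Cn n | ∀ j, ‖y j‖ < ‖z j‖})
    (fun y hy => by
      obtain ⟨ζ, hζ, rfl⟩ := hV y hy
      exact Q.toLp_mul_mem_X hz hζ) hVo ⟨0, fun j => by simpa using hz0 j⟩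
  obtain ⟨ζ, hζ, rfl⟩ := hV y hy
  exact hJ (hk ζ (Metric.ball_subset_closedBall hζ))

theorem isClosed_zeros_jac : IsClosed (Q.Γ ∩ {z | Q.jac z = 0}) :=
  ContinuousOn.preimage_isClosed_of_isClosed (t := {0})
    (fun _ hz => (Q.continuousAt_jac (Q.Γ_subset_closure hz)).continuousWithinAt)
    Q.isClosed_Γ isClosed_singleton

/-- The Jacobian of `Φ` is different from zero almost everywhere on the boundary. -/
theorem ae_jac_ne_zero (hn : 0 < n) : ∀ᵐ z ∂Q.σ, Q.jac z ≠ 0 := by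
  set Z := Q.Γ ∩ {z | Q.jac z = 0} with hZ
  suffices h : Q.σ Z = 0 by
    filter_upwards [Q.ae_mem_Γ, measure_eq_zero_iff_ae_notMem.mp h] with z hz hzZ h0
    exact hzZ ⟨hz, h0⟩
  set μ : Measure (Fin n → ℝ) :=
    Measure.pi fun _ : Fin n => volume.restrict (Ioc 0 (2 * Real.pi)) with hμ
  have hact : Continuous fun x : Cn n × (Fin n → ℝ) => coordinateRotation x.2 x.1 := by
    have h1 : Continuous fun x : Cn n × (Fin n → ℝ) => fun j => circleMap 0 1 (x.2 j) * x.1 j := by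
      refine continuous_pi fun j => ?_
      have := continuous_circleMap 0 1
      fun_prop
    convert (PiLp.continuous_toLp 2 _).comp h1 using 2 with x
    ext j
    simp [coordinateRotation_apply]
  set S : Set (Cn n × (Fin n → ℝ)) := {x | coordinateRotation x.2 x.1 ∈ Z} with hS
  have hSm : MeasurableSet S := (Q.isClosed_zeros_jac.preimage hact).measurableSet
  -- Fubini on Γ × torus: the slices over z are null, hence so is the slice at some θ. As rotation
  -- by θ preserves σ, the set Z is null.
  have h1 : (Q.σ.prod μ) S = 0 := by
    rw [Measure.measure_prod_null hSm]
    filter_upwards [Q.ae_mem_Γ, Q.ae_coord_ne_zero hn] with _ hz hz0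
    exact measure_mono_null (fun θ hθ => hθ.2) (Q.volume_zeros_jac_torus_eq_zero hz hz0)
  rw [← Measure.measurePreserving_swap.measure_preimage hSm.nullMeasurableSet,
    Measure.measure_prod_null (measurable_swap hSm)] at h1
  have hμ0 : μ ≠ 0 := by
    rw [← Measure.measure_univ_ne_zero, hμ, Measure.pi_univ]
    simp [Real.pi_pos.not_ge]
  have : (ae μ).NeBot := ae_neBot.mpr hμ0
  obtain ⟨θ, hθ⟩ := h1.exists
  change Q.σ _ = 0 at hθ
  rwa [show Prod.mk θ ⁻¹' (Prod.swap ⁻¹' S) = coordinateRotation θ ⁻¹' Z from rfl,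
    (Q.measurePreserving_coordinateRotation θ).measure_preimage
      Q.isClosed_zeros_jac.measurableSet.nullMeasurableSet] at hθ

/-- Almost every point with `Φ z ∈ Φ(K)` is mapped to `K` by an element of `G`. -/
theorem ae_exists_apply_mem {K : Set (Cn n)} (hK : K ⊆ Q.Γ) :
    ∀ᵐ z ∂Q.σ, Q.Φ z ∈ Q.Φ '' K → ∃ τ ∈ Q.G, τ z ∈ K := by
  filter_upwards [show ∀ᵐ z ∂Q.σ, _ from Q.fibre_Γ] with z hz h
  obtain ⟨y, hy, hyz⟩ := h
  obtain ⟨τ, hτ, rfl⟩ := hz y (hK hy) hyz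
  exact ⟨τ, hτ, hy⟩

/-- Where the Jacobian is non-zero, Φ has local inverses that are Lipschitz, and these carry null
sets to null sets. -/
theorem euclideanHausdorffMeasure_eq_zero_of_image {K : Set (Cn n)} (hK : K ⊆ closure Q.X)
    (hJ : ∀ z ∈ K, Q.jac z ≠ 0) (h : μHE[Q.d] (Q.Φ '' K) = 0) : μHE[Q.d] K = 0 := by
  refine measure_null_of_locally_null K fun z hz => ?_
  have hinj := injective_of_complexMatrix_det_ne_zero (Q.fderiv_Φ_smul (hK hz)) (hJ z hz)
  set e : Cn n ≃L[ℝ] Cn n := (LinearEquiv.ofInjectiveEndo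
    (fderiv ℝ Q.Φ z : Cn n →ₗ[ℝ] Cn n) hinj).toContinuousLinearEquiv with he
  have hs : HasStrictFDerivAt Q.Φ (e : Cn n →L[ℝ] Cn n) z := by
    have heq : (e : Cn n →L[ℝ] Cn n) = fderiv ℝ Q.Φ z := ContinuousLinearMap.ext fun v => rfl
    rw [heq]
    exact (Q.contDiffAt_Φ (hK hz)).hasStrictFDerivAt (by simp)
  obtain ⟨C, t, ht, hC⟩ := hs.to_localInverse.exists_lipschitzOnWith
  have hcont : ContinuousAt Q.Φ z := hs.hasFDerivAt.continuousAt
  refine ⟨K ∩ ({y | hs.localInverse Q.Φ e z (Q.Φ y) = y} ∩ Q.Φ ⁻¹' t),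
    inter_mem_nhdsWithin _ (inter_mem hs.eventually_left_inverse (hcont ht)), ?_⟩
  refine measure_mono_null (t := hs.localInverse Q.Φ e z '' (Q.Φ '' K ∩ t)) ?_ ?_
  · rintro y ⟨hyK, hy1, hy2⟩
    exact ⟨Q.Φ y, ⟨⟨y, hyK, rfl⟩, hy2⟩, hy1⟩
  · refine le_antisymm (((hC.mono inter_subset_right).euclideanHausdorffMeasure_image_le
      Q.d).trans_eq ?_) zero_le
    rw [measure_mono_null inter_subset_left h, mul_zero]

/-- The restriction of `Φ` to `Γ`, extended by zero. -/
noncomputable def boundaryMap : Cn n → Cn n := Q.Γ.indicator Q.Φ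

theorem boundaryMap_eq {z : Cn n} (hz : z ∈ Q.Γ) : Q.boundaryMap z = Q.Φ z :=
  indicator_of_mem hz _

theorem measurable_boundaryMap : Measurable Q.boundaryMap := by
  classical
  rw [boundaryMap, ← piecewise_eq_indicator]
  exact (Q.continuousOn_Φ.mono Q.Γ_subset_closure).measurable_piecewise continuousOn_const
    Q.measurableSet_Γ

/-- The pulled-back surface measure `|G|⁻¹ w dσ`. -/
noncomputable def pullbackMeasure (w : Cn n → ℝ) : Measure (Cn n) :=
  (Nat.card Q.G : ℝ≥0∞)⁻¹ • Q.σ.withDensity fun z => ENNReal.ofReal (w z)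

theorem measurePreserving_boundaryMap {w : Cn n → ℝ} (hw : Q.IsPullbackDensity w) :
    MeasurePreserving Q.boundaryMap (Q.pullbackMeasure w) Q.m := by
  refine ⟨Q.measurable_boundaryMap, Measure.ext fun S hS => ?_⟩
  have hpre := Q.measurable_boundaryMap hS
  have hset : Q.Γ ∩ Q.Φ ⁻¹' S = Q.boundaryMap ⁻¹' S ∩ Q.Γ := by
    ext z
    exact ⟨fun h => ⟨by rw [mem_preimage, Q.boundaryMap_eq h.1]; exact h.2, h.1⟩,
      fun h => ⟨h.2, by rw [mem_preimage, ← Q.boundaryMap_eq h.2]; exact h.1⟩⟩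
  rw [Measure.map_apply Q.measurable_boundaryMap hS, pullbackMeasure, Measure.smul_apply,
    withDensity_apply _ hpre, ← hw.density S hS, σ, inducedMeasure, Measure.restrict_restrict hpre,
    hset, smul_eq_mul]

/-- The density `w` is positive almost everywhere. -/
theorem ae_density_pos (hn : 0 < n) {w : Cn n → ℝ} (hw : Q.IsPullbackDensity w) :
    ∀ᵐ z ∂Q.σ, 0 < w z := by
  have := Q.finite_G
  -- Requiring w = 0 on the entire orbit ensures that w vanishes a.e. on the preimage of Φ(K) for K
  -- ⊆ E, as this preimage is covered by the translates of K up to a null set. Then Φ(K) is m-null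
  -- although Φ is locally bi-Lipschitz at K. Compact K makes Φ(K) measurable.
  set E : Set (Cn n) := (Q.Γ \ (Q.Γ ∩ {z | Q.jac z = 0})) ∩ ⋂ τ : Q.G, {z | w (τ.1 z) = 0} with hE
  have hEm : MeasurableSet E := by
    refine (Q.measurableSet_Γ.diff Q.isClosed_zeros_jac.measurableSet).inter
      (MeasurableSet.iInter fun τ => ?_)
    exact (hw.measurable.comp τ.1.continuous.measurable) (measurableSet_singleton 0)
  suffices h : Q.σ E = 0 by
    have hinv : ∀ᵐ z ∂Q.σ, ∀ τ : Q.G, w (τ.1 z) = w z :=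
      ae_all_iff.mpr fun τ => hw.invariant τ.1 τ.2
    filter_upwards [measure_eq_zero_iff_ae_notMem.mp h, hinv, Q.ae_mem_Γ, Q.ae_jac_ne_zero hn]
      with z hz h1 h2 h3
    refine lt_of_le_of_ne (hw.nonneg z) fun h0 => hz ⟨⟨h2, fun h => h3 h.2⟩, ?_⟩
    exact mem_iInter.mpr fun τ => (h1 τ).trans h0.symm
  by_contra hpos
  obtain ⟨K, hKE, hK, hKpos⟩ := hEm.exists_lt_isCompact (μ := Q.σ) (r := 0)
    (pos_iff_ne_zero.mpr hpos)
  have hKΓ : K ⊆ Q.Γ := fun z hz => (hKE hz).1.1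
  have hKcl : K ⊆ closure Q.X := hKΓ.trans Q.Γ_subset_closure
  have hS : IsCompact (Q.Φ '' K) := hK.image_of_continuousOn (Q.continuousOn_Φ.mono hKcl)
  have hm : Q.m (Q.Φ '' K) = 0 := by
    have hpre := Q.measurable_boundaryMap hS.measurableSet
    rw [← (Q.measurePreserving_boundaryMap hw).measure_preimage hS.measurableSet.nullMeasurableSet,
      pullbackMeasure, Measure.smul_apply, withDensity_apply _ hpre, smul_eq_mul]
    refine mul_eq_zero_of_right _ ((setLIntegral_eq_zero_iff' hpre
      hw.measurable.ennreal_ofReal.aemeasurable).mpr ?_)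
    filter_upwards [Q.ae_exists_apply_mem hKΓ, Q.ae_mem_Γ] with z hz hzΓ hzS
    rw [mem_preimage, Q.boundaryMap_eq hzΓ] at hzS
    obtain ⟨τ, hτ, hτz⟩ := hz hzS
    have := mem_iInter.mp (hKE hτz).2 ⟨τ⁻¹, Q.G.inv_mem hτ⟩
    have h0 : w (τ⁻¹ (τ z)) = 0 := this
    rw [show τ⁻¹ (τ z) = z from τ.symm_apply_apply z] at h0
    simp [h0]
  rw [m, inducedMeasure, Measure.restrict_apply hS.measurableSet,
    inter_eq_left.mpr (show Q.Φ '' K ⊆ Q.ΓΩ from image_mono hKΓ)] at hm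
  have h0 := Q.euclideanHausdorffMeasure_eq_zero_of_image hKcl
    (fun z hz h0 => (hKE hz).1.2 ⟨hKΓ hz, h0⟩) hm
  refine hKpos.ne' (le_antisymm ?_ zero_le)
  exact (Measure.le_iff'.mp Measure.restrict_le_self K).trans h0.le

end QuotientQuadruple

/-! ### The lift from Γ_Ω to Γ_X and its norms. -/

namespace QuotientQuadruple

variable {n : ℕ} (Q : QuotientQuadruple n)

theorem coe_smul_mem_X {z : Cn n} (hz : z ∈ Q.Γ) : ∀ᶠ r : ℝ in 𝓝[<] 1, (r : ℂ) • z ∈ Q.X := by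
  filter_upwards [Ioo_mem_nhdsLT one_pos] with r hr using Q.smul_mem hz hr

theorem Φ_apply_of_mem_Γ {τ : Cn n ≃ₗᵢ[ℂ] Cn n} (hτ : τ ∈ Q.G) {z : Cn n} (hz : z ∈ Q.Γ) :
    Q.Φ (τ z) = Q.Φ z := by
  have hlim : ∀ y ∈ Q.Γ, Tendsto (fun r : ℝ => Q.Φ ((r : ℂ) • y)) (𝓝[<] 1) (𝓝 (Q.Φ y)) := by
    intro y hy
    have h1 : Tendsto (fun r : ℝ => (r : ℂ) • y) (𝓝[<] 1) (𝓝 y) := by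
      have : Continuous fun r : ℝ => (r : ℂ) • y := by fun_prop
      simpa using (this.tendsto 1).mono_left nhdsWithin_le_nhds
    exact (Q.contDiffAt_Φ (Q.Γ_subset_closure hy)).continuousAt.tendsto.comp h1
  refine tendsto_nhds_unique (hlim _ (Q.invariant_Γ τ hτ z hz)) ((hlim z hz).congr' ?_)
  filter_upwards [Q.coe_smul_mem_X hz] with r hr
  rw [← map_smul, Q.Φ_apply hτ hr]

theorem boundaryMap_apply {τ : Cn n ≃ₗᵢ[ℂ] Cn n} (hτ : τ ∈ Q.G) {z : Cn n} (hz : z ∈ Q.Γ) :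
    Q.boundaryMap (τ z) = Q.boundaryMap z := by
  rw [Q.boundaryMap_eq hz, Q.boundaryMap_eq (Q.invariant_Γ τ hτ z hz), Q.Φ_apply_of_mem_Γ hτ hz]

/-- `gs` is a measurable boundary function of the function `g`, which witnesses admissibility. -/
structure IsBoundaryDatum (w : Cn n → ℝ) (g gs : Cn n → ℂ) : Prop where
  density : Q.IsPullbackDensity w
  admissible : Q.IsAdmissible w g
  measurable : Measurable gs
  boundary : ∀ᵐ z ∂Q.σ, HasBoundaryValue g z (gs z)
  norm_sq : ∀ᵐ z ∂Q.σ, ‖gs z‖ ^ 2 = w z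
  pos : ∀ᵐ z ∂Q.σ, 0 < w z

/-- The chosen boundary values are an a.e. limit of dilates of g along a sequence of radii, hence
a.e. equal to a measurable function. -/
theorem exists_isBoundaryDatum (hn : 0 < n) {w : Cn n → ℝ} (hw : Q.IsPullbackDensity w)
    {g : Cn n → ℂ} (hg : Q.IsAdmissible w g) : ∃ gs, Q.IsBoundaryDatum w g gs := by
  obtain ⟨l, hl⟩ : ∃ l : Cn n → ℂ, ∀ᵐ z ∂Q.σ, HasBoundaryValue g z (l z) ∧ ‖l z‖ ^ 2 = w z := by
    classical
    refine ⟨fun z => if h : ∃ l : ℂ, HasBoundaryValue g z l ∧ ‖l‖ ^ 2 = w z then h.choose else 0, ?_⟩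
    filter_upwards [hg.boundary] with z hz
    rw [dif_pos hz]
    exact hz.choose_spec
  obtain ⟨r, -, hr, hr1⟩ := exists_seq_strictMono_tendsto' (one_pos : (0 : ℝ) < 1)
  have hr1' : Tendsto r atTop (𝓝[<] 1) :=
    tendsto_nhdsWithin_iff.mpr ⟨hr1, Eventually.of_forall fun k => (hr k).2⟩
  have hlm : AEMeasurable l Q.σ := aemeasurable_of_tendsto_metrizable_ae atTop
    (fun k => Q.aemeasurable_dilate hg.holomorphic.continuousOn (hr k))
    (hl.mono fun z hz => hz.1.comp hr1')
  refine ⟨hlm.mk l, hw, hg, hlm.measurable_mk, ?_, ?_, Q.ae_density_pos hn hw⟩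
  · filter_upwards [hl, hlm.ae_eq_mk] with z h1 h2
    rw [← h2]
    exact h1.1
  · filter_upwards [hl, hlm.ae_eq_mk] with z h1 h2
    rw [← h2]
    exact h1.2

variable {Q} {w : Cn n → ℝ} {g gs : Cn n → ℂ}

namespace IsBoundaryDatum

theorem ae_ne_zero (h : Q.IsBoundaryDatum w g gs) : ∀ᵐ z ∂Q.σ, gs z ≠ 0 := by
  filter_upwards [h.norm_sq, h.pos] with z h1 h2 h0
  rw [h0] at h1
  simp only [norm_zero, ne_eq, OfNat.ofNat_ne_zero, not_false_eq_true, zero_pow] at h1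
  exact h2.ne h1

theorem ae_apply_eq (h : Q.IsBoundaryDatum w g gs) {τ : Cn n ≃ₗᵢ[ℂ] Cn n} (hτ : τ ∈ Q.G) :
    ∀ᵐ z ∂Q.σ, gs (τ z) = gs z := by
  filter_upwards [h.boundary, (Q.measurePreserving_G hτ).quasiMeasurePreserving.ae h.boundary,
    Q.ae_mem_Γ] with z h1 h2 hz
  refine tendsto_nhds_unique h2 (Tendsto.congr' ?_ h1)
  filter_upwards [Q.coe_smul_mem_X hz] with r hr
  rw [← map_smul, h.admissible.invariant τ hτ _ hr]

theorem absolutelyContinuous_pullbackMeasure (h : Q.IsBoundaryDatum w g gs) :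
    Q.σ ≪ Q.pullbackMeasure w := by
  refine (withDensity_absolutelyContinuous' h.density.measurable.ennreal_ofReal.aemeasurable
    ?_).smul_right Q.card_inv_ne_zero
  filter_upwards [h.pos] with z hz
  simpa using hz

/-- Here positivity of w enters: m-null sets pull back to σ-null sets, so lifting is well defined on
a.e. classes. -/
theorem quasiMeasurePreserving_boundaryMap (h : Q.IsBoundaryDatum w g gs) :
    Measure.QuasiMeasurePreserving Q.boundaryMap Q.σ Q.m :=
  (Q.measurePreserving_boundaryMap h.density).quasiMeasurePreserving.mono_left
    h.absolutelyContinuous_pullbackMeasure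

theorem card_mul_lintegral_m (h : Q.IsBoundaryDatum w g gs) {k : Cn n → ℝ≥0∞}
    (hk : AEMeasurable k Q.m) :
    (Nat.card Q.G : ℝ≥0∞) * ∫⁻ y, k y ∂Q.m
      = ∫⁻ z, ENNReal.ofReal (w z) * k (Q.boundaryMap z) ∂Q.σ := by
  have hmp := Q.measurePreserving_boundaryMap h.density
  have := Q.finite_G
  rw [← hmp.map_eq] at hk
  rw [← hmp.map_eq, lintegral_map' hk hmp.measurable.aemeasurable, pullbackMeasure,
    lintegral_smul_measure, smul_eq_mul, ← mul_assoc, ENNReal.mul_inv_cancel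
      (Nat.cast_ne_zero.mpr Nat.card_pos.ne') (ENNReal.natCast_ne_top _), one_mul,
    lintegral_withDensity_eq_lintegral_mul₀ h.density.measurable.ennreal_ofReal.aemeasurable]
  · rfl
  · rw [hmp.map_eq] at hk
    exact hk.comp_quasiMeasurePreserving h.quasiMeasurePreserving_boundaryMap

end IsBoundaryDatum

variable (Q) in
/-- The constant `|G|^{-1/2}`. -/
noncomputable def normConst : ℂ := ((√(Nat.card Q.G : ℝ))⁻¹ : ℝ)

variable (Q) in
theorem normConst_ne_zero : Q.normConst ≠ 0 := by
  have := Q.finite_G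
  have : 0 < √(Nat.card Q.G : ℝ) := Real.sqrt_pos.mpr (Nat.cast_pos.mpr Nat.card_pos)
  simpa [normConst] using this.ne'

variable (Q) in
theorem enorm_normConst_sq : ‖Q.normConst‖ₑ ^ (2 : ℝ) = (Nat.card Q.G : ℝ≥0∞)⁻¹ := by
  have := Q.finite_G
  have h0 : (0 : ℝ) < Nat.card Q.G := Nat.cast_pos.mpr Nat.card_pos
  rw [← ofReal_norm, normConst, Complex.norm_real, Real.norm_of_nonneg (by positivity),
    ENNReal.ofReal_rpow_of_nonneg (by positivity) (by norm_num), Real.rpow_two, inv_pow,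
    Real.sq_sqrt h0.le, ENNReal.ofReal_inv_of_pos h0, ENNReal.ofReal_natCast]

variable (Q) in
/-- The function on `Γ_X` which corresponds to the function `φ` on `Γ_Ω`. -/
noncomputable def lift (gs φ : Cn n → ℂ) (z : Cn n) : ℂ :=
  Q.normConst * (φ (Q.boundaryMap z) * gs z)

namespace IsBoundaryDatum

theorem lift_congr (h : Q.IsBoundaryDatum w g gs) {φ ψ : Cn n → ℂ} (hφ : φ =ᵐ[Q.m] ψ) :
    Q.lift gs φ =ᵐ[Q.σ] Q.lift gs ψ := by
  filter_upwards [h.quasiMeasurePreserving_boundaryMap.ae hφ] with z hz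
  rw [lift, hz, lift]

theorem isInvariantΓ_lift (h : Q.IsBoundaryDatum w g gs) (φ : Cn n → ℂ) :
    Q.IsInvariantΓ (Q.lift gs φ) := by
  intro τ hτ
  filter_upwards [h.ae_apply_eq hτ, Q.ae_mem_Γ] with z h1 hz
  rw [lift, h1, Q.boundaryMap_apply hτ hz, lift]

theorem aestronglyMeasurable_lift (h : Q.IsBoundaryDatum w g gs) {φ : Cn n → ℂ}
    (hφ : AEStronglyMeasurable φ Q.m) : AEStronglyMeasurable (Q.lift gs φ) Q.σ :=
  ((hφ.comp_quasiMeasurePreserving h.quasiMeasurePreserving_boundaryMap).mul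
    h.measurable.aestronglyMeasurable).const_mul _

theorem measurable_weight (h : Q.IsBoundaryDatum w g gs) (p : ℝ) :
    Measurable fun z => ENNReal.ofReal (w z) ^ (1 - p / 2) :=
  h.density.measurable.ennreal_ofReal.pow_const _

/-- From |g*|^p = w^{p/2}, the weight w^{1-p/2} completes the integrand to the density w for every
p. -/
theorem lintegral_lift (h : Q.IsBoundaryDatum w g gs) {p : ℝ} (hp : 0 < p) {φ : Cn n → ℂ}
    (hφ : AEStronglyMeasurable φ Q.m) :
    ∫⁻ z, ‖Q.lift gs φ z‖ₑ ^ p ∂Q.weightedMeasure w p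
      = ‖Q.normConst‖ₑ ^ p * Nat.card Q.G * ∫⁻ y, ‖φ y‖ₑ ^ p ∂Q.m := by
  rw [mul_assoc, h.card_mul_lintegral_m (hφ.enorm.pow_const p), ← lintegral_const_mul'
    _ _ (ENNReal.rpow_ne_top_of_nonneg hp.le enorm_ne_top), weightedMeasure,
    lintegral_withDensity_eq_lintegral_mul₀ (h.measurable_weight p).aemeasurable
      ((h.aestronglyMeasurable_lift hφ).enorm.pow_const p)]
  refine lintegral_congr_ae ?_
  filter_upwards [h.norm_sq, h.pos, h.ae_ne_zero] with z h1 h2 h3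
  have hg : ‖gs z‖ₑ ^ p = ENNReal.ofReal (w z) ^ (p / 2) := by
    rw [← h1, ← Real.rpow_two, ← ENNReal.ofReal_rpow_of_nonneg (norm_nonneg _) (by norm_num),
      ofReal_norm, ← ENNReal.rpow_mul]
    congr 1
    ring
  have h0 : ENNReal.ofReal (w z) ≠ 0 := by simpa using h2
  simp only [Pi.mul_apply, lift]
  rw [enorm_mul, enorm_mul, ENNReal.mul_rpow_of_nonneg _ _ hp.le, ENNReal.mul_rpow_of_nonneg _ _ hp.le,
    hg]
  calc _ = ‖Q.normConst‖ₑ ^ p * (ENNReal.ofReal (w z) ^ (1 - p / 2) * ENNReal.ofReal (w z) ^ (p / 2)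
        * ‖φ (Q.boundaryMap z)‖ₑ ^ p) := by ring
    _ = _ := by
      rw [← ENNReal.rpow_add _ _ h0 ENNReal.ofReal_ne_top, sub_add_cancel, ENNReal.rpow_one]

theorem eLpNorm_lift (h : Q.IsBoundaryDatum w g gs) {p : ℝ} (hp : 0 < p) {φ : Cn n → ℂ}
    (hφ : AEStronglyMeasurable φ Q.m) :
    eLpNorm (Q.lift gs φ) (ENNReal.ofReal p) (Q.weightedMeasure w p)
      = (‖Q.normConst‖ₑ ^ p * Nat.card Q.G) ^ (1 / p) * eLpNorm φ (ENNReal.ofReal p) Q.m := by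
  have h0 : ENNReal.ofReal p ≠ 0 := by simpa using hp
  rw [eLpNorm_eq_lintegral_rpow_enorm_toReal h0 ENNReal.ofReal_ne_top,
    eLpNorm_eq_lintegral_rpow_enorm_toReal h0 ENNReal.ofReal_ne_top, ENNReal.toReal_ofReal hp.le,
    h.lintegral_lift hp hφ, ENNReal.mul_rpow_of_nonneg _ _ (by positivity)]

end IsBoundaryDatum

variable (Q) in
theorem weightedMeasure_two (w : Cn n → ℝ) : Q.weightedMeasure w 2 = Q.σ := by
  simp [weightedMeasure]

variable (Q) in
theorem weightedMeasure_absolutelyContinuous (w : Cn n → ℝ) (p : ℝ) :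
    Q.weightedMeasure w p ≪ Q.σ := withDensity_absolutelyContinuous _ _

variable (Q) in
/-- The quotient of the norms of a lifted function and of the function. -/
noncomputable def normRatio (p : ℝ) : ℝ≥0∞ := (‖Q.normConst‖ₑ ^ p * Nat.card Q.G) ^ (1 / p)

variable (Q) in
theorem normRatio_ne_top {p : ℝ} (hp : 0 < p) : Q.normRatio p ≠ ⊤ :=
  ENNReal.rpow_ne_top_of_nonneg (by positivity) (ENNReal.mul_ne_top
    (ENNReal.rpow_ne_top_of_nonneg hp.le enorm_ne_top) (ENNReal.natCast_ne_top _))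

variable (Q) in
theorem normRatio_ne_zero {p : ℝ} (hp : 0 < p) : Q.normRatio p ≠ 0 := by
  have := Q.finite_G
  refine (ENNReal.rpow_pos_of_nonneg (pos_iff_ne_zero.mpr (mul_ne_zero ?_ ?_))
    (by positivity)).ne'
  · exact (ENNReal.rpow_pos_of_nonneg (enorm_pos.mpr Q.normConst_ne_zero) hp.le).ne'
  · exact Nat.cast_ne_zero.mpr Nat.card_pos.ne'

variable (Q) in
theorem normRatio_two : Q.normRatio 2 = 1 := by
  have := Q.finite_G
  rw [normRatio, Q.enorm_normConst_sq, ENNReal.inv_mul_cancel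
      (Nat.cast_ne_zero.mpr Nat.card_pos.ne') (ENNReal.natCast_ne_top _), ENNReal.one_rpow]

namespace IsBoundaryDatum

theorem eLpNorm_two_lift (h : Q.IsBoundaryDatum w g gs) {φ : Cn n → ℂ}
    (hφ : AEStronglyMeasurable φ Q.m) : eLpNorm (Q.lift gs φ) 2 Q.σ = eLpNorm φ 2 Q.m := by
  have := h.eLpNorm_lift two_pos hφ
  rwa [Q.weightedMeasure_two, ← normRatio, Q.normRatio_two, one_mul,
    show ENNReal.ofReal 2 = 2 by simp] at this

theorem memLp_lift (h : Q.IsBoundaryDatum w g gs) (φ : Lp ℂ 2 Q.m) : MemLp (Q.lift gs φ) 2 Q.σ :=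
  ⟨h.aestronglyMeasurable_lift (Lp.aestronglyMeasurable φ), by
    rw [h.eLpNorm_two_lift (Lp.aestronglyMeasurable φ)]
    exact Lp.eLpNorm_lt_top φ⟩

/-- The isometry of `L²(Γ_Ω)` into `L²(Γ_X)` given by `lift`. -/
noncomputable def liftL (h : Q.IsBoundaryDatum w g gs) : Lp ℂ 2 Q.m →ₗᵢ[ℂ] Lp ℂ 2 Q.σ where
  toFun φ := (h.memLp_lift φ).toLp
  map_add' φ ψ := by
    refine Lp.ext ?_
    filter_upwards [(h.memLp_lift (φ + ψ)).coeFn_toLp, (h.memLp_lift φ).coeFn_toLp,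
      (h.memLp_lift ψ).coeFn_toLp, Lp.coeFn_add (h.memLp_lift φ).toLp (h.memLp_lift ψ).toLp,
      h.lift_congr (Lp.coeFn_add φ ψ)] with z h1 h2 h3 h4 h5
    rw [h1, h4, Pi.add_apply, h2, h3, h5]
    simp only [lift, Pi.add_apply]
    ring
  map_smul' c φ := by
    refine Lp.ext ?_
    filter_upwards [(h.memLp_lift (c • φ)).coeFn_toLp, (h.memLp_lift φ).coeFn_toLp,
      Lp.coeFn_smul c (h.memLp_lift φ).toLp, h.lift_congr (Lp.coeFn_smul c φ)] with z h1 h2 h3 h4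
    rw [h1, RingHom.id_apply, h3, Pi.smul_apply, h2, h4]
    simp only [lift, Pi.smul_apply, smul_eq_mul]
    ring
  norm_map' φ := by
    simp only [LinearMap.coe_mk, AddHom.coe_mk]
    rw [Lp.norm_toLp, h.eLpNorm_two_lift (Lp.aestronglyMeasurable φ), Lp.norm_def]

theorem coeFn_liftL (h : Q.IsBoundaryDatum w g gs) (φ : Lp ℂ 2 Q.m) :
    h.liftL φ =ᵐ[Q.σ] Q.lift gs φ := (h.memLp_lift φ).coeFn_toLp

theorem eLpNorm_liftL (h : Q.IsBoundaryDatum w g gs) {p : ℝ} (hp : 0 < p) (φ : Lp ℂ 2 Q.m) :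
    eLpNorm (h.liftL φ) (ENNReal.ofReal p) (Q.weightedMeasure w p)
      = Q.normRatio p * eLpNorm φ (ENNReal.ofReal p) Q.m := by
  rw [eLpNorm_congr_ae ((Q.weightedMeasure_absolutelyContinuous w p).ae_eq (h.coeFn_liftL φ)),
    h.eLpNorm_lift hp (Lp.aestronglyMeasurable φ), normRatio]

theorem memLp_liftL_iff (h : Q.IsBoundaryDatum w g gs) {p : ℝ} (hp : 0 < p) (φ : Lp ℂ 2 Q.m) :
    MemLp (h.liftL φ) (ENNReal.ofReal p) (Q.weightedMeasure w p)
      ↔ MemLp φ (ENNReal.ofReal p) Q.m := by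
  have h1 : AEStronglyMeasurable (h.liftL φ) (Q.weightedMeasure w p) :=
    (Lp.aestronglyMeasurable (h.liftL φ)).mono_ac (Q.weightedMeasure_absolutelyContinuous w p)
  rw [MemLp, MemLp, h.eLpNorm_liftL hp, and_iff_right h1,
    and_iff_right (Lp.aestronglyMeasurable φ)]
  exact ⟨fun h2 => ENNReal.lt_top_of_mul_ne_top_right h2.ne (Q.normRatio_ne_zero hp),
    fun h2 => ENNReal.mul_lt_top (Q.normRatio_ne_top hp).lt_top h2⟩

theorem isInvariantΓ_liftL (h : Q.IsBoundaryDatum w g gs) (φ : Lp ℂ 2 Q.m) :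
    Q.IsInvariantΓ (h.liftL φ) := by
  intro τ hτ
  filter_upwards [h.coeFn_liftL φ, h.isInvariantΓ_lift φ τ hτ,
    (Q.measurePreserving_G hτ).quasiMeasurePreserving.ae (h.coeFn_liftL φ)] with z h1 h2 h3
  rw [h1, h3, h2]

end IsBoundaryDatum

end QuotientQuadruple

/-! ### The range of the lift: all invariant functions. -/

namespace QuotientQuadruple

variable {n : ℕ} {Q : QuotientQuadruple n} {w : Cn n → ℝ} {g gs : Cn n → ℂ}

variable (Q) in
-- Let K be a compact set on whose orbits u is positive. Almost every fibre is an orbit, so u > 0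
-- a.e. on the preimage of Φ(K). The vanishing integral makes this preimage null, and it contains K.
theorem ae_le_zero_of_setIntegral_preimage_eq_zero {u : Cn n → ℝ} (hu : Integrable u Q.σ)
    (hinv : ∀ τ ∈ Q.G, ∀ᵐ z ∂Q.σ, u (τ z) = u z)
    (h0 : ∀ S, MeasurableSet S → ∫ z in Q.boundaryMap ⁻¹' S, u z ∂Q.σ = 0) :
    ∀ᵐ z ∂Q.σ, u z ≤ 0 := by
  have := Q.finite_G
  set v : Cn n → ℝ := hu.1.mk u with hv
  have hvm : Measurable v := hu.1.stronglyMeasurable_mk.measurable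
  have huv : ∀ᵐ z ∂Q.σ, u z = v z := hu.1.ae_eq_mk
  set E : Set (Cn n) := Q.Γ ∩ ⋂ τ : Q.G, {z | 0 < v (τ.1 z)} with hE
  have hEm : MeasurableSet E := Q.measurableSet_Γ.inter (MeasurableSet.iInter fun τ =>
    (hvm.comp τ.1.continuous.measurable) measurableSet_Ioi)
  suffices h : Q.σ E = 0 by
    have h1 : ∀ᵐ z ∂Q.σ, ∀ τ : Q.G, v (τ.1 z) = v z := by
      refine ae_all_iff.mpr fun τ => ?_
      filter_upwards [hinv τ.1 τ.2, huv,
        (Q.measurePreserving_G τ.2).quasiMeasurePreserving.ae huv] with z h1 h2 h3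
      rw [← h2, ← h1, h3]
    filter_upwards [measure_eq_zero_iff_ae_notMem.mp h, h1, Q.ae_mem_Γ, huv] with z hz h1 h2 h3
    rw [h3]
    by_contra! hlt
    exact hz ⟨h2, mem_iInter.mpr fun τ => hlt.trans_eq (h1 τ).symm⟩
  by_contra hpos
  obtain ⟨K, hKE, hK, hKpos⟩ := hEm.exists_lt_isCompact (μ := Q.σ) (r := 0)
    (pos_iff_ne_zero.mpr hpos)
  have hKΓ : K ⊆ Q.Γ := fun z hz => (hKE hz).1
  have hS : MeasurableSet (Q.Φ '' K) := (hK.image_of_continuousOn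
    (Q.continuousOn_Φ.mono (hKΓ.trans Q.Γ_subset_closure))).measurableSet
  have hpre := Q.measurable_boundaryMap hS
  have hupos : ∀ᵐ z ∂Q.σ.restrict (Q.boundaryMap ⁻¹' (Q.Φ '' K)), 0 < u z := by
    rw [ae_restrict_iff' hpre]
    filter_upwards [Q.ae_exists_apply_mem hKΓ, Q.ae_mem_Γ, huv] with z hz hzΓ huz hzS
    rw [mem_preimage, Q.boundaryMap_eq hzΓ] at hzS
    obtain ⟨τ, hτ, hτz⟩ := hz hzS
    have h1 : 0 < v (τ⁻¹ (τ z)) := mem_iInter.mp (hKE hτz).2 ⟨τ⁻¹, Q.G.inv_mem hτ⟩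
    rwa [show τ⁻¹ (τ z) = z from τ.symm_apply_apply z, ← huz] at h1
  have hzero := (integral_eq_zero_iff_of_nonneg_ae (hupos.mono fun z hz => hz.le)
    hu.integrableOn).mp (h0 _ hS)
  have hnull : Q.σ (Q.boundaryMap ⁻¹' (Q.Φ '' K)) = 0 := by
    rw [← Measure.restrict_eq_zero, ← ae_eq_bot]
    refine Filter.eventually_false_iff_eq_bot.mp ?_
    filter_upwards [hupos, hzero] with z h1 h2 using h1.ne' h2
  refine hKpos.ne' (measure_mono_null (fun z hz => ?_) hnull)
  rw [mem_preimage, Q.boundaryMap_eq (hKΓ hz)]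
  exact mem_image_of_mem _ hz

variable (Q) in
theorem ae_eq_zero_of_setIntegral_preimage_eq_zero {u : Cn n → ℂ} (hu : Integrable u Q.σ)
    (hinv : Q.IsInvariantΓ u)
    (h0 : ∀ S, MeasurableSet S → ∫ z in Q.boundaryMap ⁻¹' S, u z ∂Q.σ = 0) :
    ∀ᵐ z ∂Q.σ, u z = 0 := by
  have key : ∀ L : ℂ →L[ℝ] ℝ, ∀ᵐ z ∂Q.σ, L (u z) ≤ 0 := fun L =>
    Q.ae_le_zero_of_setIntegral_preimage_eq_zero (L.integrable_comp hu)
      (fun τ hτ => (hinv τ hτ).mono fun z hz => by simp only [hz]) fun S hS => by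
        rw [L.integral_comp_comm hu.integrableOn, h0 S hS, map_zero]
  filter_upwards [key Complex.reCLM, key (-Complex.reCLM), key Complex.imCLM,
    key (-Complex.imCLM)] with z h1 h2 h3 h4
  simp only [Complex.reCLM_apply, Complex.imCLM_apply, _root_.neg_apply] at h1 h2 h3 h4
  exact Complex.ext (by simp; linarith) (by simp; linarith)

theorem IsInvariantΓ.sub {φ ψ : Lp ℂ 2 Q.σ} (hφ : Q.IsInvariantΓ φ) (hψ : Q.IsInvariantΓ ψ) :
    Q.IsInvariantΓ (φ - ψ : Lp ℂ 2 Q.σ) := by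
  intro τ hτ
  filter_upwards [hφ τ hτ, hψ τ hτ, Lp.coeFn_sub φ ψ,
    (Q.measurePreserving_G hτ).quasiMeasurePreserving.ae (Lp.coeFn_sub φ ψ)] with z h1 h2 h3 h4
  rw [h3, h4, Pi.sub_apply, Pi.sub_apply, h1, h2]

namespace IsBoundaryDatum

/-- Testing against lifts of indicators shows that the invariant function conj(g*) ψ has integral
zero over all preimages, so it vanishes, and g* ≠ 0 a.e. -/
theorem eq_zero_of_inner_liftL_eq_zero (h : Q.IsBoundaryDatum w g gs) {ψ : Lp ℂ 2 Q.σ}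
    (hψ : Q.IsInvariantΓ ψ) (h0 : ∀ φ, inner ℂ (h.liftL φ) ψ = 0) : ψ = 0 := by
  have hgs : MemLp gs 2 Q.σ := by
    -- The lift of the constant 1 is a non-zero multiple of g*, so g* is square integrable.
    have := h.memLp_lift (indicatorConstLp 2 MeasurableSet.univ (measure_ne_top Q.m _) (1 : ℂ))
    have h2 := this.const_mul Q.normConst⁻¹
    refine h2.ae_eq ?_
    filter_upwards [h.quasiMeasurePreserving_boundaryMap.ae (indicatorConstLp_coeFn (p := 2)
      (hs := MeasurableSet.univ) (hμs := measure_ne_top Q.m _) (c := (1 : ℂ)))] with z hz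
    rw [lift, hz]
    simp [Q.normConst_ne_zero]
  have hint : Integrable (fun z => inner ℂ (gs z) (ψ z)) Q.σ :=
    (L2.integrable_inner (hgs.toLp gs) ψ).congr (hgs.coeFn_toLp.mono fun z hz => by simp only [hz])
  have hz := Q.ae_eq_zero_of_setIntegral_preimage_eq_zero hint (fun τ hτ => by
    filter_upwards [hψ τ hτ, h.ae_apply_eq hτ] with z h1 h2
    rw [h1, h2]) fun S hS => by
      have h1 := h0 (indicatorConstLp 2 hS (measure_ne_top Q.m _) (1 : ℂ))
      rw [L2.inner_def] at h1
      rw [← integral_indicator (Q.measurable_boundaryMap hS)]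
      refine (mul_eq_zero.mp ((integral_const_mul _ _).symm.trans ((integral_congr_ae ?_).trans
        h1))).resolve_left (star_ne_zero.mpr Q.normConst_ne_zero)
      filter_upwards [h.coeFn_liftL (indicatorConstLp 2 hS (measure_ne_top Q.m _) (1 : ℂ)),
        h.quasiMeasurePreserving_boundaryMap.ae (indicatorConstLp_coeFn (p := 2)
          (hs := hS) (hμs := measure_ne_top Q.m _) (c := (1 : ℂ)))] with z h1 h2
      rw [h1, lift, h2]
      by_cases hz : Q.boundaryMap z ∈ S
      · simp [hz]
        ring
      · simp [hz]
  refine Lp.eq_zero_iff_ae_eq_zero.mpr ?_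
  filter_upwards [hz, h.ae_ne_zero] with z h1 h2
  simpa [h2] using h1

/-- The range of an isometry is closed, and the component of ψ orthogonal to it is again invariant,
hence zero. -/
theorem exists_liftL_eq (h : Q.IsBoundaryDatum w g gs) {ψ : Lp ℂ 2 Q.σ}
    (hψ : Q.IsInvariantΓ ψ) : ∃ φ, h.liftL φ = ψ := by
  set R := LinearMap.range h.liftL.toLinearMap with hR
  have : CompleteSpace R := h.liftL.isometry.isUniformInducing.isComplete_range.completeSpace_coe
  obtain ⟨φ, hφ⟩ : R.starProjection ψ ∈ R := R.starProjection_apply_mem ψ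
  refine ⟨φ, (sub_eq_zero.mp (h.eq_zero_of_inner_liftL_eq_zero
    (hψ.sub (h.isInvariantΓ_liftL φ)) fun χ => ?_)).symm⟩
  have h1 : ψ - R.starProjection ψ ∈ Rᗮ := R.sub_starProjection_mem_orthogonal ψ
  rw [← hφ] at h1
  exact h1 _ ⟨χ, rfl⟩

end IsBoundaryDatum

end QuotientQuadruple

/-! ### Averaging, correspondence of Hardy spaces, and intertwining of the Szegő projections. -/

namespace QuotientQuadruple

variable {n : ℕ} (Q : QuotientQuadruple n) {w : Cn n → ℝ} {g gs : Cn n → ℂ}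

noncomputable instance fintypeG : Fintype Q.G :=
  have := Q.finite_G
  Fintype.ofFinite _

theorem card_ne_zero : (Nat.card Q.G : ℂ) ≠ 0 := by
  have := Q.finite_G
  exact Nat.cast_ne_zero.mpr Nat.card_pos.ne'

/-- The average of `F` over the group `G`. -/
noncomputable def average (F : Cn n → ℂ) (z : Cn n) : ℂ :=
  (Nat.card Q.G : ℂ)⁻¹ * ∑ τ : Q.G, F (τ.1 z)

theorem average_apply (F : Cn n → ℂ) {τ : Cn n ≃ₗᵢ[ℂ] Cn n} (hτ : τ ∈ Q.G) (z : Cn n) :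
    Q.average F (τ z) = Q.average F z := by
  rw [average, average]
  congr 1
  exact Fintype.sum_equiv (Equiv.mulRight ⟨τ, hτ⟩) _ _ fun _ => rfl

theorem differentiableOn_average {F : Cn n → ℂ} (hF : DifferentiableOn ℂ F Q.X) :
    DifferentiableOn ℂ (Q.average F) Q.X := by
  refine DifferentiableOn.const_mul ?_ _
  have : ∀ τ ∈ (Finset.univ : Finset Q.G), DifferentiableOn ℂ (fun z => F (τ.1 z)) Q.X :=
    fun τ _ => hF.comp τ.1.toContinuousLinearEquiv.differentiable.differentiableOn
      fun z hz => Q.invariant_X τ.1 τ.2 z hz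
  rw [show (fun z => ∑ τ : Q.G, F (τ.1 z)) = ∑ τ : Q.G, fun z => F (τ.1 z) by ext z; simp]
  exact DifferentiableOn.sum this

variable {Q} in
theorem IsBoundaryX.average {F ψ : Cn n → ℂ} (h : Q.IsBoundaryX F ψ) :
    Q.IsBoundaryX (Q.average F) (Q.average ψ) := by
  have h1 : ∀ᵐ z ∂Q.σ, ∀ τ : Q.G, HasBoundaryValue F (τ.1 z) (ψ (τ.1 z)) :=
    ae_all_iff.mpr fun τ => (Q.measurePreserving_G τ.2).quasiMeasurePreserving.ae h
  filter_upwards [h1] with z hz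
  refine Tendsto.const_mul _ (tendsto_finsetSum _ fun τ _ => ?_)
  simpa only [HasBoundaryValue, map_smul] using hz τ

/-- The averaging operator on `L²(Γ_X)`. -/
noncomputable def averageL (ψ : Lp ℂ 2 Q.σ) : Lp ℂ 2 Q.σ :=
  (Nat.card Q.G : ℂ)⁻¹ •
    ∑ τ : Q.G, Lp.compMeasurePreservingₗᵢ ℂ τ.1 (Q.measurePreserving_G τ.2) ψ

theorem coeFn_averageL (ψ : Lp ℂ 2 Q.σ) : Q.averageL ψ =ᵐ[Q.σ] Q.average ψ := by
  have h1 : ∀ᵐ z ∂Q.σ, ∀ τ : Q.G,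
      Lp.compMeasurePreservingₗᵢ ℂ τ.1 (Q.measurePreserving_G τ.2) ψ z = ψ (τ.1 z) :=
    ae_all_iff.mpr fun τ => Lp.coeFn_compMeasurePreserving ψ (Q.measurePreserving_G τ.2)
  filter_upwards [h1, Lp.coeFn_smul (Nat.card Q.G : ℂ)⁻¹
    (∑ τ : Q.G, Lp.compMeasurePreservingₗᵢ ℂ τ.1 (Q.measurePreserving_G τ.2) ψ),
    Lp.coeFn_fun_finsetSum Finset.univ fun τ : Q.G =>
      Lp.compMeasurePreservingₗᵢ ℂ τ.1 (Q.measurePreserving_G τ.2) ψ] with z h1 h2 h3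
  rw [averageL, h2, Pi.smul_apply, h3, average, smul_eq_mul]
  simp only [h1]

theorem isInvariantΓ_averageL (ψ : Lp ℂ 2 Q.σ) : Q.IsInvariantΓ (Q.averageL ψ) := by
  intro τ hτ
  filter_upwards [Q.coeFn_averageL ψ,
    (Q.measurePreserving_G hτ).quasiMeasurePreserving.ae (Q.coeFn_averageL ψ)] with z h1 h2
  rw [h1, h2, Q.average_apply _ hτ]

/-- G acts by isometries of L²(Γ_X) that fix φ. -/
theorem inner_averageL {φ : Lp ℂ 2 Q.σ} (hφ : Q.IsInvariantΓ φ) (ψ : Lp ℂ 2 Q.σ) :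
    inner ℂ φ (Q.averageL ψ) = inner ℂ φ ψ := by
  have h1 : ∀ τ : Q.G,
      inner ℂ φ (Lp.compMeasurePreservingₗᵢ ℂ τ.1 (Q.measurePreserving_G τ.2) ψ) = inner ℂ φ ψ := by
    intro τ
    have h2 : Lp.compMeasurePreservingₗᵢ ℂ τ.1 (Q.measurePreserving_G τ.2) φ = φ :=
      Lp.ext ((Lp.coeFn_compMeasurePreserving φ (Q.measurePreserving_G τ.2)).trans (hφ τ.1 τ.2))
    conv_lhs => rw [← h2]
    exact LinearIsometry.inner_map_map _ _ _
  rw [averageL, inner_smul_right, inner_sum, Finset.sum_congr rfl fun τ _ => h1 τ, Finset.sum_const,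
    Finset.card_univ, ← Nat.card_eq_fintype_card, nsmul_eq_mul, inv_mul_cancel_left₀ Q.card_ne_zero]

theorem averageL_eq_self {ψ : Lp ℂ 2 Q.σ} (hψ : Q.IsInvariantΓ ψ) : Q.averageL ψ = ψ := by
  refine Lp.ext ?_
  have h1 : ∀ᵐ z ∂Q.σ, ∀ τ : Q.G, ψ (τ.1 z) = ψ z := ae_all_iff.mpr fun τ => hψ τ.1 τ.2
  filter_upwards [Q.coeFn_averageL ψ, h1] with z h2 h3
  rw [h2, average, Finset.sum_congr rfl fun τ _ => h3 τ, Finset.sum_const,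
    Finset.card_univ, ← Nat.card_eq_fintype_card, nsmul_eq_mul, inv_mul_cancel_left₀ Q.card_ne_zero]

variable {Q}

theorem memWeightedHardyX_two {F : Cn n → ℂ} : Q.MemWeightedHardyX g 2 F ↔ Q.MemHardyX 2 F := by
  simp [MemWeightedHardyX, MemHardyX]

theorem MemWeightedHardyX.congr {p : ℝ} {F F' : Cn n → ℂ} (h : Q.MemWeightedHardyX g p F)
    (hF : ∀ z ∈ Q.X, F z = F' z) : Q.MemWeightedHardyX g p F' := by
  refine ⟨h.1.congr fun z hz => (hF z hz).symm, ?_⟩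
  refine (iSup₂_mono fun r hr => (lintegral_congr_ae ?_).le).trans_lt h.2
  filter_upwards [Q.ae_mem_Γ] with z hz
  rw [hF _ (Q.smul_mem hz hr)]

/-- Convexity of t ↦ t^p reduces the claim to the single translates F ∘ τ. Their integrals equal
that of F, because τ commutes with dilations and preserves both σ and g. -/
theorem MemWeightedHardyX.average (hg : Q.IsAdmissible w g) {p : ℝ} (hp : 1 ≤ p) {F : Cn n → ℂ}
    (h : Q.MemWeightedHardyX g p F) : Q.MemWeightedHardyX g p (Q.average F) := by
  refine ⟨Q.differentiableOn_average h.1, ?_⟩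
  set A := ⨆ r ∈ Ioo (0 : ℝ) 1,
      ∫⁻ z, ‖F ((r : ℂ) • z)‖ₑ ^ p * ‖g ((r : ℂ) • z)‖ₑ ^ (2 - p) ∂Q.σ with hA
  set c : ℝ≥0∞ := ‖(Nat.card Q.G : ℂ)⁻¹‖ₑ ^ p * ((Finset.univ : Finset Q.G).card : ℝ≥0∞) ^ (p - 1)
    with hc
  have hctop : c ≠ ⊤ := ENNReal.mul_ne_top
    (ENNReal.rpow_ne_top_of_nonneg (zero_le_one.trans hp) enorm_ne_top)
    (ENNReal.rpow_ne_top_of_nonneg (sub_nonneg.mpr hp) (ENNReal.natCast_ne_top _))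
  refine lt_of_le_of_lt (b := c * ∑ _τ : Q.G, A) (iSup₂_le fun r hr => ?_) ?_
  · have hterm : ∀ τ : Q.G, ∫⁻ z, ‖F (τ.1 ((r : ℂ) • z))‖ₑ ^ p * ‖g ((r : ℂ) • z)‖ₑ ^ (2 - p) ∂Q.σ
        ≤ A := by
      intro τ
      calc _ = ∫⁻ z, ‖F ((r : ℂ) • τ.1 z)‖ₑ ^ p * ‖g ((r : ℂ) • τ.1 z)‖ₑ ^ (2 - p) ∂Q.σ := by
            refine lintegral_congr_ae ?_
            filter_upwards [Q.ae_mem_Γ] with z hz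
            rw [← hg.invariant τ.1 τ.2 _ (Q.smul_mem hz hr), map_smul]
        _ = ∫⁻ z, ‖F ((r : ℂ) • z)‖ₑ ^ p * ‖g ((r : ℂ) • z)‖ₑ ^ (2 - p) ∂Q.σ :=
            (Q.measurePreserving_G τ.2).lintegral_comp_emb
              τ.1.toHomeomorph.measurableEmbedding
              fun z => ‖F ((r : ℂ) • z)‖ₑ ^ p * ‖g ((r : ℂ) • z)‖ₑ ^ (2 - p)
        _ ≤ A := le_iSup₂ (f := fun r (_ : r ∈ Ioo (0 : ℝ) 1) =>
            ∫⁻ z, ‖F ((r : ℂ) • z)‖ₑ ^ p * ‖g ((r : ℂ) • z)‖ₑ ^ (2 - p) ∂Q.σ) r hr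
    calc ∫⁻ z, ‖Q.average F ((r : ℂ) • z)‖ₑ ^ p * ‖g ((r : ℂ) • z)‖ₑ ^ (2 - p) ∂Q.σ
        ≤ ∫⁻ z, c * ∑ τ : Q.G,
            ‖F (τ.1 ((r : ℂ) • z))‖ₑ ^ p * ‖g ((r : ℂ) • z)‖ₑ ^ (2 - p) ∂Q.σ := by
          refine lintegral_mono fun z => ?_
          rw [QuotientQuadruple.average, enorm_mul, ENNReal.mul_rpow_of_nonneg _ _ (zero_le_one.trans hp), hc,
            ← Finset.sum_mul, mul_assoc, mul_assoc, ← mul_assoc (_ ^ (p - 1))]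
          gcongr
          refine (ENNReal.rpow_le_rpow (enorm_sum_le _ _) (zero_le_one.trans hp)).trans ?_
          exact ENNReal.rpow_sum_le_const_mul_sum_rpow _ _ hp
      _ = c * ∑ τ : Q.G,
            ∫⁻ z, ‖F (τ.1 ((r : ℂ) • z))‖ₑ ^ p * ‖g ((r : ℂ) • z)‖ₑ ^ (2 - p) ∂Q.σ := by
          rw [lintegral_const_mul' _ _ hctop, lintegral_finsetSum']
          intro τ _
          refine AEMeasurable.mul (AEMeasurable.pow_const (AEMeasurable.enorm ?_) _)
            ((Q.aemeasurable_dilate hg.holomorphic.continuousOn hr).enorm.pow_const _)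
          exact Q.aemeasurable_dilate (F := fun z => F (τ.1 z)) (h.1.continuousOn.comp
            τ.1.continuous.continuousOn fun z hz => Q.invariant_X τ.1 τ.2 z hz) hr
      _ ≤ c * ∑ _τ : Q.G, A := by
          gcongr with τ
          exact hterm τ
  · exact ENNReal.mul_lt_top hctop.lt_top (ENNReal.sum_lt_top.mpr fun _ _ => h.2)

/-- The holomorphic function on `X` which corresponds to the function `f` on `Ω`. -/
noncomputable def pullback (Q : QuotientQuadruple n) (g f : Cn n → ℂ) (z : Cn n) : ℂ :=
  Q.normConst * (f (Q.Φ z) * g z)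

/-- The exponents of |g| add up, p + (2 - p) = 2, so for each r the two integrals agree up to a
constant factor. -/
theorem memWeightedHardyX_pullback_iff (hg : Q.IsAdmissible w g) {p : ℝ} (hp : 0 < p)
    {f : Cn n → ℂ} (hf : DifferentiableOn ℂ f Q.Ω) :
    Q.MemWeightedHardyX g p (Q.pullback g f) ↔ Q.MemHardyΩ g p f := by
  have hd : DifferentiableOn ℂ (Q.pullback g f) Q.X :=
    ((hf.comp Q.holomorphic_Φ fun z hz => Q.Φ_mem hz).mul hg.holomorphic).const_mul _
  have hc0 : ‖Q.normConst‖ₑ ^ p ≠ 0 :=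
    (ENNReal.rpow_pos_of_nonneg (enorm_pos.mpr Q.normConst_ne_zero) hp.le).ne'
  have hct : ‖Q.normConst‖ₑ ^ p ≠ ⊤ := ENNReal.rpow_ne_top_of_nonneg hp.le enorm_ne_top
  have hint : ∀ r ∈ Ioo (0 : ℝ) 1,
      ∫⁻ z, ‖Q.pullback g f ((r : ℂ) • z)‖ₑ ^ p * ‖g ((r : ℂ) • z)‖ₑ ^ (2 - p) ∂Q.σ
        = ‖Q.normConst‖ₑ ^ p *
          ∫⁻ z, ‖f (Q.Φ ((r : ℂ) • z))‖ₑ ^ p * ‖g ((r : ℂ) • z)‖ₑ ^ (2 : ℝ) ∂Q.σ := by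
    intro r hr
    rw [← lintegral_const_mul' _ _ hct]
    refine lintegral_congr_ae ?_
    filter_upwards [Q.ae_mem_Γ] with z hz
    have h0 : ‖g ((r : ℂ) • z)‖ₑ ≠ 0 := enorm_ne_zero.mpr (hg.ne_zero _ (Q.smul_mem hz hr))
    rw [pullback, enorm_mul, enorm_mul, ENNReal.mul_rpow_of_nonneg _ _ hp.le,
      ENNReal.mul_rpow_of_nonneg _ _ hp.le, mul_assoc, mul_assoc,
      ← ENNReal.rpow_add _ _ h0 enorm_ne_top, add_sub_cancel]
  rw [MemWeightedHardyX, MemHardyΩ, and_iff_right hd, and_iff_right hf, iSup_congr fun r => iSup_congr (hint r)]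
  simp_rw [← ENNReal.mul_iSup]
  constructor <;> intro h
  · exact ENNReal.mul_lt_top Q.card_inv_ne_top.lt_top (ENNReal.lt_top_of_mul_ne_top_right h.ne hc0)
  · exact ENNReal.mul_lt_top hct.lt_top
      (ENNReal.lt_top_of_mul_ne_top_right h.ne Q.card_inv_ne_zero)

namespace IsBoundaryDatum

/-- Boundary values may be divided by those of g, which are non-zero a.e. -/
theorem isBoundaryX_pullback_iff (h : Q.IsBoundaryDatum w g gs) {f φ : Cn n → ℂ} :
    Q.IsBoundaryX (Q.pullback g f) (Q.lift gs φ) ↔ Q.IsBoundaryΩ f φ := by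
  constructor
  · intro hF
    refine ⟨φ, EventuallyEq.rfl, ?_⟩
    filter_upwards [hF, h.boundary, h.ae_ne_zero, Q.ae_mem_Γ] with z h1 h2 h3 hz
    have h4 := (h1.div_const Q.normConst).div h2 h3
    rw [lift, mul_div_cancel_left₀ _ Q.normConst_ne_zero, mul_div_cancel_right₀ _ h3,
      Q.boundaryMap_eq hz] at h4
    refine Tendsto.congr' ?_ h4
    filter_upwards [Q.coe_smul_mem_X hz] with r hr
    simp only [Pi.div_apply]
    rw [pullback, mul_div_cancel_left₀ _ Q.normConst_ne_zero,
      mul_div_cancel_right₀ _ (h.admissible.ne_zero _ hr), Function.comp_apply]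
  · rintro ⟨u, hu, hf⟩
    filter_upwards [hf, h.boundary, Q.ae_mem_Γ,
      h.quasiMeasurePreserving_boundaryMap.ae hu] with z h1 h2 hz h3
    rw [Q.boundaryMap_eq hz] at h3
    rw [lift, Q.boundaryMap_eq hz, ← h3]
    exact (h1.mul h2).const_mul _

/-- The average of a holomorphic function on `X` corresponds to a holomorphic function on `Ω`. -/
theorem exists_pullback_eq_average (h : Q.IsBoundaryDatum w g gs) {F : Cn n → ℂ}
    (hF : DifferentiableOn ℂ F Q.X) :
    ∃ f, DifferentiableOn ℂ f Q.Ω ∧ ∀ z ∈ Q.X, Q.average F z = Q.pullback g f z := by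
  have hg := h.admissible
  have hd : DifferentiableOn ℂ (fun z => Q.average F z * (Q.normConst * g z)⁻¹) Q.X :=
    (Q.differentiableOn_average hF).mul ((hg.holomorphic.const_mul _).inv fun z hz =>
      mul_ne_zero Q.normConst_ne_zero (hg.ne_zero z hz))
  have hinv : ∀ τ ∈ Q.G, ∀ z ∈ Q.X, Q.average F (τ z) * (Q.normConst * g (τ z))⁻¹
      = Q.average F z * (Q.normConst * g z)⁻¹ := fun τ hτ z hz => by
    rw [Q.average_apply _ hτ, hg.invariant τ hτ z hz]
  refine ⟨_, Q.differentiableOn_descend hd hinv, fun z hz => ?_⟩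
  rw [pullback, Q.descend_Φ hinv hz]
  have := Q.normConst_ne_zero
  have := hg.ne_zero z hz
  field_simp

theorem liftL_mem_hardySubspaceX (h : Q.IsBoundaryDatum w g gs) {φ : Lp ℂ 2 Q.m}
    (hφ : φ ∈ Q.hardySubspaceΩ g h.admissible.holomorphic.continuousOn) :
    h.liftL φ ∈ Q.hardySubspaceX := by
  obtain ⟨f, hf, hfφ⟩ := hφ
  refine ⟨Q.pullback g f, memWeightedHardyX_two.mp
    ((memWeightedHardyX_pullback_iff h.admissible two_pos hf.1).mpr hf), ?_⟩
  filter_upwards [h.isBoundaryX_pullback_iff.mpr hfφ, h.coeFn_liftL φ] with z h1 h2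
  rwa [h2]

/-- The average of F descends to f. As f does not depend on p, membership in H² and in H^p is
obtained for one and the same function. -/
theorem exists_isBoundaryΩ (h : Q.IsBoundaryDatum w g gs) {F : Cn n → ℂ} {ψ : Lp ℂ 2 Q.σ}
    (hF : Q.MemHardyX 2 F) (hψ : Q.IsBoundaryX F ψ) {η : Lp ℂ 2 Q.m}
    (hη : h.liftL η = Q.averageL ψ) :
    ∃ f, Q.MemHardyΩ g 2 f ∧ Q.IsBoundaryΩ f η ∧
      ∀ p : ℝ, 1 ≤ p → Q.MemWeightedHardyX g p F → Q.MemHardyΩ g p f := by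
  obtain ⟨f, hf, hfF⟩ := h.exists_pullback_eq_average hF.1
  have key : ∀ p : ℝ, 1 ≤ p → Q.MemWeightedHardyX g p F → Q.MemHardyΩ g p f := fun p hp hFp =>
    (memWeightedHardyX_pullback_iff h.admissible (zero_lt_one.trans_le hp) hf).mp
      ((hFp.average h.admissible hp).congr hfF)
  refine ⟨f, key 2 one_le_two (memWeightedHardyX_two.mpr hF),
    h.isBoundaryX_pullback_iff.mp ?_, key⟩
  filter_upwards [hψ.average, Q.coeFn_averageL ψ, h.coeFn_liftL η, Q.ae_mem_Γ] with z h1 h2 h3 hz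
  rw [← h3, hη, h2]
  refine Tendsto.congr' ?_ h1
  filter_upwards [Q.coe_smul_mem_X hz] with r hr using hfF _ hr

/-- The Szegő projections are intertwined by `liftL`. -/
theorem szegoX_liftL (h : Q.IsBoundaryDatum w g gs) (φ : Lp ℂ 2 Q.m) :
    Q.szegoX (h.liftL φ) = h.liftL (Q.szegoΩ g h.admissible.holomorphic.continuousOn φ) := by
  set K := Q.hardySubspaceΩ g h.admissible.holomorphic.continuousOn with hK
  refine Submodule.eq_starProjection_of_mem_orthogonal ?_ ?_
  · have hmem : K.topologicalClosure.starProjection φ ∈ K.topologicalClosure :=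
      Submodule.starProjection_apply_mem _ _
    exact MapsTo.closure (s := (K : Set (Lp ℂ 2 Q.m)))
      (fun χ hχ => h.liftL_mem_hardySubspaceX hχ) h.liftL.continuous hmem
  -- The lift of this difference is invariant, so ψ may be replaced by its average. That average is
  -- the lift of an element of H²(Ω), and the isometry moves the inner product to Γ_Ω.
  · have horth : φ - K.topologicalClosure.starProjection φ ∈ Kᗮ := by
      rw [← Submodule.orthogonal_closure]
      exact Submodule.sub_starProjection_mem_orthogonal _
    rw [Submodule.orthogonal_closure, Submodule.mem_orthogonal']
    rintro ψ ⟨F, hF, hψ⟩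
    obtain ⟨η, hη⟩ := h.exists_liftL_eq (Q.isInvariantΓ_averageL ψ)
    obtain ⟨f, hf, hfη, -⟩ := h.exists_isBoundaryΩ hF hψ hη
    rw [← map_sub, ← Q.inner_averageL (h.isInvariantΓ_liftL _), ← hη, h.liftL.inner_map_map]
    exact (Submodule.mem_orthogonal' _ _).mp horth η ⟨f, hf, hfη⟩

/-- Lifting multiplies both sides of the estimate by the same `normRatio` and reaches every
invariant function, so the same C serves on both sides. -/
theorem szegoΩBounded_iff (h : Q.IsBoundaryDatum w g gs) {p : ℝ} (hp : 0 < p) :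
    Q.SzegoΩBounded g h.admissible.holomorphic.continuousOn p ↔ Q.SzegoXBoundedOnInvariant w p := by
  refine exists_congr fun C => ⟨fun hC ψ hψ hψp => ?_, fun hC φ hφ => ?_⟩
  · obtain ⟨φ, rfl⟩ := h.exists_liftL_eq hψ
    rw [h.szegoX_liftL, h.eLpNorm_liftL hp, h.eLpNorm_liftL hp, mul_left_comm]
    gcongr
    exact hC φ ((h.memLp_liftL_iff hp φ).mp hψp)
  · have := hC (h.liftL φ) (h.isInvariantΓ_liftL φ) ((h.memLp_liftL_iff hp φ).mpr hφ)
    rwa [h.szegoX_liftL, h.eLpNorm_liftL hp, h.eLpNorm_liftL hp, mul_left_comm,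
      ENNReal.mul_le_mul_iff_right (Q.normRatio_ne_zero hp) (Q.normRatio_ne_top hp)] at this

theorem szegoΩMapsToHardy_iff (h : Q.IsBoundaryDatum w g gs) {p : ℝ} (hp : 1 ≤ p) :
    Q.SzegoΩMapsToHardy g h.admissible.holomorphic.continuousOn p
      ↔ Q.SzegoXMapsInvariantToHardy w g p := by
  have hp0 : 0 < p := zero_lt_one.trans_le hp
  refine ⟨fun hΩ ψ hψ hψp => ?_, fun hX φ hφ => ?_⟩
  · obtain ⟨φ, rfl⟩ := h.exists_liftL_eq hψ
    obtain ⟨f, hf2, hfp, hfφ⟩ := hΩ φ ((h.memLp_liftL_iff hp0 φ).mp hψp)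
    refine ⟨Q.pullback g f, memWeightedHardyX_two.mp
      ((memWeightedHardyX_pullback_iff h.admissible two_pos hf2.1).mpr hf2),
      (memWeightedHardyX_pullback_iff h.admissible hp0 hf2.1).mpr hfp, ?_⟩
    filter_upwards [h.isBoundaryX_pullback_iff.mpr hfφ, h.coeFn_liftL
      (Q.szegoΩ g h.admissible.holomorphic.continuousOn φ)] with z h1 h2
    rwa [h.szegoX_liftL, h2]
  · obtain ⟨F, hF2, hFp, hFφ⟩ :=
      hX (h.liftL φ) (h.isInvariantΓ_liftL φ) ((h.memLp_liftL_iff hp0 φ).mpr hφ)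
    obtain ⟨f, hf2, hfφ, hfp⟩ := h.exists_isBoundaryΩ hF2 hFφ
      (η := Q.szegoΩ g h.admissible.holomorphic.continuousOn φ) (by
        -- The projection of a lift is itself a lift, hence invariant: averaging F leaves its
        -- boundary function unchanged.
        rw [h.szegoX_liftL, Q.averageL_eq_self (h.isInvariantΓ_liftL _)])
    exact ⟨f, hf2, hfp p hp hFp, hfφ⟩

end IsBoundaryDatum

end QuotientQuadruple

theorem mainTheorem4 (n : ℕ) (hn : 0 < n) (Q : QuotientQuadruple n)
    (w : Cn n → ℝ) (hw : Q.IsPullbackDensity w)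
    (g : Cn n → ℂ) (hg : Q.IsAdmissible w g)
    (p : ℝ) (hp : 1 < p) :
    (Q.SzegoΩBounded g hg.holomorphic.continuousOn p ↔ Q.SzegoXBoundedOnInvariant w p) ∧
    ((Q.SzegoΩBounded g hg.holomorphic.continuousOn p ∧
        Q.SzegoΩMapsToHardy g hg.holomorphic.continuousOn p) ↔
      (Q.SzegoXBoundedOnInvariant w p ∧ Q.SzegoXMapsInvariantToHardy w g p)) := by
  obtain ⟨gs, h⟩ := Q.exists_isBoundaryDatum hn hw hg
  have h1 := h.szegoΩBounded_iff (zero_lt_one.trans hp)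
  exact ⟨h1, and_congr h1 (h.szegoΩMapsToHardy_iff hp.le)⟩
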